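/- Let $n\ge 1$ be an integer, $s\in(0,1]$ and $\beta\in(0,1)$. Write points of $\mathbb{R}^{n+1}=\mathbb{R}^n\times\mathbb{R}$ as $\overline{x}=(x,t)$. Let $P_s(x,t)$ be the inverse spatial Fourier transform $\int_{\mathbb{R}^n}e^{2\pi i\langle x,\xi\rangle}e^{-4\pi^2t|\xi|^{2s}}\,d\xi$ for $t>0$, and $P_s(x,t)=0$ for $t\le 0$. For a function $f$ on $\mathbb{R}^{n+1}$ put $$\partial_t^\beta f(x,t)=\int_{\mathbb{R}}\frac{f(x,\tau)-f(x,t)}{|\tau-t|^{1+\beta}}\,d\tau$$ wherever the integral converges absolutely. An $s$-parabolic ball $B(\overline{x},r)$ is the product of the Euclidean ball in $\mathbb{R}^n$ with centre $x$ and radius $r$ and the interval with centre $t$ and length $(2r)^{2s}$; an $s$-parabolic cube $Q$ of side length $\ell>0$ is a product of $n$ intervals of length $\ell$ and a time interval of length $\ell^{2s}$. A positive Borel measure $\mu$ on $\mathbb{R}^{n+1}$ has upper $s$-parabolic growth of degree $\rho$ with constant $A>0$ if $\mu(B(\overline{x},r))\le A\,r^{\rho}$ for all $\overline{x}\in\mathbb{R}^{n+1}$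 and $r>0$. For locally integrable $f$ let $$\|f\|_{*,p_s}=\sup_{Q}\frac{1}{|Q|}\int_Q|f-f_Q|,\qquad f_Q=\frac1{|Q|}\int_Q f,$$ the supremum being over all $s$-parabolic cubes $Q$. Then there is a constant $C>0$, depending only on $n$, $s$ and $\beta$, such that for every finite positive Borel measure $\mu$ on $\mathbb{R}^{n+1}$ with upper $s$-parabolic growth of degree $n+2s\beta$ with constant $A$, the potential $$\big(\partial_t^\beta P_s*\mu\big)(\overline{x})=\int \partial_t^\beta P_s(\overline{x}-\overline{y})\,d\mu(\overline{y})$$ is well defined for Lebesgue-almost every $\overline{x}$ (that is, $\partial_t^\beta P_s(\overline{x}-\overline{y})$ exists for $\mu$-almost every $\overline{y}$ and the integral converges absolutely), is locally integrable on $\mathbb{R}^{n+1}$, and satisfies $$\big\|\partial_t^\beta P_s*\mu\big\|_{*,p_s}\le C\,A.$$ -/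

import Mathlib

open MeasureTheory
open scoped ENNReal FourierTransform

namespace FracHeat

noncomputable section

/-- Space-time `ℝ^{n+1} = ℝⁿ × ℝ`, with points `(x, t)`; `ℝⁿ` carries the Euclidean norm. -/
abbrev SpaceTime (n : ℕ) : Type := EuclideanSpace ℝ (Fin n) × ℝ

/-- The fundamental solution `P_s`: for `t > 0` the inverse spatial Fourier transform of
`ξ ↦ exp (-4 π² t |ξ|^{2s})` (with the kernel `exp (2 π i ⟨x, ξ⟩)`), and `0` for `t ≤ 0`. The inverse
transform is real valued, since the transformed function is real and even. -/
def fundSol {n : ℕ} (s : ℝ) (p : SpaceTime n) : ℝ :=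
  if 0 < p.2 then
    (𝓕⁻ (fun ξ : EuclideanSpace ℝ (Fin n) =>
      (Real.exp (-4 * Real.pi ^ 2 * p.2 * ‖ξ‖ ^ (2 * s)) : ℂ)) p.1).re
  else 0

/-- The integrand `τ ↦ (f (x, τ) - f (x, t)) / |τ - t|^{1 + β}` at `p = (x, t)`. -/
def timeQuotient {n : ℕ} (β : ℝ) (f : SpaceTime n → ℝ) (p : SpaceTime n) (τ : ℝ) : ℝ :=
  (f (p.1, τ) - f p) / |τ - p.2| ^ (1 + β)

/-- The integral that defines the `β`-temporal derivative of `f` at `p` converges absolutely. -/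
def TimeDerivExists {n : ℕ} (β : ℝ) (f : SpaceTime n → ℝ) (p : SpaceTime n) : Prop :=
  Integrable (timeQuotient β f p)

/-- The `β`-temporal derivative
`∂_t^β f (x, t) = ∫ (f (x, τ) - f (x, t)) / |τ - t|^{1 + β} dτ`. -/
def timeDeriv {n : ℕ} (β : ℝ) (f : SpaceTime n → ℝ) (p : SpaceTime n) : ℝ :=
  ∫ τ : ℝ, timeQuotient β f p τ

/-- The potential `(K ∗ μ) (p) = ∫ K (p - q) dμ(q)` of a measure with respect to a kernel. -/
def potential {n : ℕ} (K : SpaceTime n → ℝ) (μ : Measure (SpaceTime n)) (p : SpaceTime n) : ℝ :=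
  ∫ q, K (p - q) ∂μ

/-- The `s`-parabolic ball of radius `r`: the product of the Euclidean ball of radius `r` and the
concentric time interval of length `(2 r)^{2s}`. -/
def parabolicBall {n : ℕ} (s : ℝ) (p : SpaceTime n) (r : ℝ) : Set (SpaceTime n) :=
  {q | dist q.1 p.1 < r ∧ |q.2 - p.2| < (2 * r) ^ (2 * s) / 2}

/-- `μ` has upper `s`-parabolic growth of degree `ρ` with constant `A > 0`. -/
def HasParabolicGrowth {n : ℕ} (s ρ A : ℝ) (μ : Measure (SpaceTime n)) : Prop :=
  0 < A ∧ ∀ (p : SpaceTime n) (r : ℝ), 0 < r →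
    μ (parabolicBall s p r) ≤ ENNReal.ofReal (A * r ^ ρ)

/-- The `s`-parabolic cube centred at `p` of side length `l`: a product of `n` intervals of length
`l` in space and one interval of length `l^{2s}` in time. -/
def parabolicCube {n : ℕ} (s : ℝ) (p : SpaceTime n) (l : ℝ) : Set (SpaceTime n) :=
  {q | (∀ i, |q.1 i - p.1 i| ≤ l / 2) ∧ |q.2 - p.2| ≤ l ^ (2 * s) / 2}

/-- The `s`-parabolic BMO norm: the supremum over all `s`-parabolic cubes `Q` of the mean
oscillation `|Q|⁻¹ ∫_Q |f - f_Q|`, where `f_Q` is the average of `f` over `Q`. It is the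
intended quantity for locally integrable `f`. -/
def parabolicBMONorm {n : ℕ} (s : ℝ) (f : SpaceTime n → ℝ) : ℝ≥0∞ :=
  ⨆ (p : SpaceTime n) (l : ℝ) (_ : 0 < l),
    (volume (parabolicCube s p l))⁻¹ *
      ∫⁻ q in parabolicCube s p l, ‖f q - ⨍ q' in parabolicCube s p l, f q'‖ₑ

end

end FracHeat

/-! The kernel K = ∂_t^β P_s is homogeneous of degree -(n + 2sβ) under (x, t) ↦ (l x, l^{2s} t).
This is exactly the growth degree of μ, so the size of K alone is borderline; the BMO bound comes
from a Hölder gain in differences of K. By Tonelli (`oscillation_potential_le`) the mean oscillation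
of K ∗ μ over Q is at most |Q|⁻² ∫∫∫ |K(p - q) - K(p' - q)| dp dp' dμ(q). A parabolic dilation
carries Q to the unit cube at the origin, and the factor that the growth constant picks up cancels
against the homogeneity of K. What remains is to bound ∫ `kernelOsc` dν by a multiple of the growth
constant of ν (`lintegral_kernelOsc_le`).

K can be singular along the whole time axis, not only at the origin, so space-time is cut into cells
`axisCell s j k` of size 2^j. For j ≥ 1 they lie at spatial distance about 2^j from the axis; the
cells with j = 0 surround the axis. On a cell the oscillation is O(2^{-j(n + 2sβ + α)} (1 +
|k|)^{-(1 + β/2)}) with α > 0 (`kernelOsc_le_axisCell`), while the mass is O(A 2^{j(n + 2sβ)}), so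
the double sum converges. Near the axis no pointwise bound is needed: the singularity |x|^{-a}, a <
n, is integrated over the cube.

Bounds for K follow from bounds for P_s through two one-variable lemmas: `fracQuot_of_holder`
(bounded Hölder functions) and `fracQuot_of_decay` (decay far from the support of the roughness).
The inputs on P_s are power bounds in t read off the Fourier integral, regularity of a difference of
two translates for large times (`fundSol_sub_translate_le`), and the estimate |P_s(x, t) - P_s(x,
t')| ≤ C |x|^{-(n + 2s)} |t - t'|, valid across t = 0 (`fundSol_lipschitz_time`). Geometric means of
these give the intermediate bounds.

The last estimate is the delicate one, because the Fourier integral loses absolute convergence as t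
→ 0. Symmetry and scaling reduce it to x on the unit diagonal, where the phase is A ∑ r_i. Each real
axis is then bent into the upper half-plane, so that the phase decays exponentially while exp(-κ (∑
z_i²)^s) stays bounded. The rotated integral is Lipschitz in κ down to κ = 0, where it factors into
one-dimensional integrals that vanish. The rotation itself is justified without Cauchy's theorem:
with a Gaussian regularization the integral is holomorphic in the rotation parameter w, is constant
for real w by a change of variables, and hence is constant by the identity theorem
(`integral_rotIntegrand_eq`). -/

namespace FracHeat

/-! ### Fractional derivatives of functions of one variable -/

/-- The difference quotient defining the fractional derivative of a function of one variable. -/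
noncomputable def fracQuot (β : ℝ) (g : ℝ → ℝ) (t τ : ℝ) : ℝ := (g τ - g t) / |τ - t| ^ (1 + β)

/-- The truncated power `|u|^a` on `|u| < r`. -/
noncomputable def innerPow (r a u : ℝ) : ℝ := if |u| < r then |u| ^ a else 0

/-- The truncated power `|u|^a` on `r ≤ |u|`. -/
noncomputable def outerPow (r a u : ℝ) : ℝ := if |u| < r then 0 else |u| ^ a

lemma innerPow_nonneg (r a u : ℝ) : 0 ≤ innerPow r a u := by
  unfold innerPow; split_ifs <;> positivity

lemma outerPow_nonneg (r a u : ℝ) : 0 ≤ outerPow r a u := by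
  unfold outerPow; split_ifs <;> positivity

lemma integrable_of_comp_abs {f : ℝ → ℝ} (hf : IntegrableOn f (Set.Ioi 0)) :
    Integrable (fun u => f |u|) := by
  have h1 : IntegrableOn (fun u => f |u|) (Set.Ioi 0) :=
    hf.congr_fun (fun u hu => by rw [abs_of_pos hu]) measurableSet_Ioi
  have h2 : IntegrableOn (fun u => f |u|) (Set.Iic 0) := by
    rw [← Measure.map_neg_eq_self (volume : Measure ℝ)]
    let m : MeasurableEmbedding fun x : ℝ => -x := (Homeomorph.neg ℝ).measurableEmbedding
    rw [m.integrableOn_map_iff]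
    simp only [Function.comp_def, abs_neg, Set.neg_preimage, Set.neg_Iic,
      neg_zero]
    exact Iff.mpr integrableOn_Ici_iff_integrableOn_Ioi h1
  rw [← integrableOn_univ, ← Set.Iic_union_Ioi (a := (0 : ℝ))]
  exact h2.union h1

lemma integrable_innerPow {r a : ℝ} (hr : 0 < r) (ha : -1 < a) : Integrable (innerPow r a) := by
  apply integrable_of_comp_abs (f := fun v => if v < r then v ^ a else 0)
  have h : IntegrableOn (fun v : ℝ => v ^ a) (Set.Ioo 0 r) :=
    (intervalIntegral.integrableOn_Ioo_rpow_iff hr).2 ha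
  have h2 := (integrable_indicator_iff (μ := volume.restrict (Set.Ioi (0:ℝ)))
    (f := fun v : ℝ => v ^ a) (measurableSet_Iio (a := r))).2 (by
      rw [IntegrableOn, Measure.restrict_restrict measurableSet_Iio, Set.inter_comm, Set.Ioi_inter_Iio]
      exact h)
  exact h2

lemma integral_innerPow {r a : ℝ} (hr : 0 < r) (ha : -1 < a) :
    ∫ u, innerPow r a u = 2 * (r ^ (a + 1) / (a + 1)) := by
  have h := integral_comp_abs (f := fun v => if v < r then v ^ a else 0)
  have h1 : ∫ v in Set.Ioi (0:ℝ), (if v < r then v ^ a else 0) = r ^ (a + 1) / (a + 1) := by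
    have : (fun v : ℝ => if v < r then v ^ a else 0) = (Set.Iio r).indicator (fun v => v ^ a) := by
      ext v; simp [Set.indicator]
    rw [this, setIntegral_indicator measurableSet_Iio, Set.Ioi_inter_Iio,
      ← integral_Ioc_eq_integral_Ioo, ← intervalIntegral.integral_of_le hr.le, integral_rpow (Or.inl ha),
      Real.zero_rpow (by linarith)]
    simp
  rw [h1] at h
  exact h

lemma integrable_outerPow {r a : ℝ} (hr : 0 < r) (ha : a < -1) : Integrable (outerPow r a) := by
  apply integrable_of_comp_abs (f := fun v => if v < r then 0 else v ^ a)
  have h : IntegrableOn (fun v : ℝ => v ^ a) (Set.Ici r) :=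
    (integrableOn_Ici_iff_integrableOn_Ioi).2 (integrableOn_Ioi_rpow_of_lt ha hr)
  have h2 := (integrable_indicator_iff (f := fun v : ℝ => v ^ a) (measurableSet_Ici (a := r))).2 h
  refine (h2.integrableOn (s := Set.Ioi 0)).congr_fun (fun v _ => ?_) measurableSet_Ioi
  by_cases hv : v < r
  · simp [Set.indicator, hv, not_le.2 hv]
  · simp [Set.indicator, hv, not_lt.1 hv]

lemma integral_outerPow {r a : ℝ} (hr : 0 < r) (ha : a < -1) :
    ∫ u, outerPow r a u = 2 * (r ^ (a + 1) / (-(a + 1))) := by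
  have h := integral_comp_abs (f := fun v => if v < r then 0 else v ^ a)
  have h1 : ∫ v in Set.Ioi (0:ℝ), (if v < r then 0 else v ^ a) = r ^ (a + 1) / (-(a + 1)) := by
    have : (fun v : ℝ => if v < r then 0 else v ^ a) = (Set.Ici r).indicator (fun v => v ^ a) := by
      ext v
      by_cases hv : v < r
      · simp [Set.indicator, hv, not_le.2 hv]
      · simp [Set.indicator, hv, not_lt.1 hv]
    rw [this, setIntegral_indicator measurableSet_Ici, Set.inter_eq_right.2
      (show Set.Ici r ⊆ Set.Ioi 0 from fun v hv => lt_of_lt_of_le hr hv), integral_Ici_eq_integral_Ioi, integral_Ioi_rpow_of_lt ha hr,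
      neg_div, div_neg]
  rw [h1] at h
  exact h

lemma measurable_fracQuot {β : ℝ} {g : ℝ → ℝ} (hg : Measurable g) (t : ℝ) :
    Measurable (fracQuot β g t) := by
  unfold fracQuot; fun_prop

/-- Bound for the fractional derivative of a bounded Hölder continuous function. -/
lemma fracQuot_of_holder {β γ : ℝ} (hβ0 : 0 < β) (hγ : β < γ) :
    ∃ C : ℝ, 0 < C ∧ ∀ (g : ℝ → ℝ) (M t : ℝ), Measurable g →
      (∀ τ, |g τ - g t| ≤ M * |τ - t| ^ γ) → (∀ τ, |g τ| ≤ M) →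
      Integrable (fracQuot β g t) ∧ |∫ τ, fracQuot β g t τ| ≤ C * M := by
  set C : ℝ := ∫ u, (innerPow 1 (γ - (1 + β)) u + 2 * outerPow 1 (-(1 + β)) u) with hC
  have hi1 : Integrable (innerPow 1 (γ - (1 + β))) := integrable_innerPow one_pos (by linarith)
  have hi2 : Integrable (outerPow 1 (-(1 + β))) := integrable_outerPow one_pos (by linarith)
  have hCp : 0 ≤ C := integral_nonneg fun u => by
    have := innerPow_nonneg 1 (γ - (1 + β)) u
    have := outerPow_nonneg 1 (-(1 + β)) u
    positivity
  refine ⟨C + 1, by linarith, fun g M t hg h1 h2 => ?_⟩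
  have hM : 0 ≤ M := (abs_nonneg _).trans (h2 0)
  -- The integral is split at distance 1 from `t`: inside, Hölder continuity leaves the exponent γ -
  -- 1 - β > -1; outside, |g τ - g t| ≤ 2M.
  set D : ℝ → ℝ := fun u => M * (innerPow 1 (γ - (1 + β)) u + 2 * outerPow 1 (-(1 + β)) u)
  have hD : Integrable D := (hi1.add (hi2.const_mul 2)).const_mul M
  have hDt : Integrable (fun τ => D (τ - t)) := hD.comp_sub_right t
  have hb : ∀ τ, ‖fracQuot β g t τ‖ ≤ D (τ - t) := by
    intro τ
    rcases eq_or_ne τ t with rfl | hne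
    · simp only [fracQuot, sub_self, zero_div, norm_zero, D]
      have := innerPow_nonneg 1 (γ - (1 + β)) 0
      have := outerPow_nonneg 1 (-(1 + β)) 0
      positivity
    have hu : 0 < |τ - t| := abs_pos.2 (sub_ne_zero.2 hne)
    rw [fracQuot, Real.norm_eq_abs, abs_div, abs_of_nonneg (Real.rpow_nonneg hu.le _)]
    by_cases hlt : |τ - t| < 1
    · simp only [D, innerPow, outerPow, hlt, if_true, mul_zero, add_zero]
      rw [Real.rpow_sub hu, ← mul_div_assoc]
      gcongr
      exact h1 τ
    · simp only [D, innerPow, outerPow, hlt, if_false, zero_add]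
      rw [Real.rpow_neg hu.le, ← mul_assoc, ← div_eq_mul_inv]
      gcongr
      calc |g τ - g t| ≤ |g τ| + |g t| := abs_sub _ _
        _ ≤ M * 2 := by linarith [h2 τ, h2 t]
  have hint : Integrable (fracQuot β g t) :=
    hDt.mono' (measurable_fracQuot hg t).aestronglyMeasurable (Filter.Eventually.of_forall hb)
  refine ⟨hint, ?_⟩
  calc |∫ τ, fracQuot β g t τ| ≤ ∫ τ, D (τ - t) :=
        norm_integral_le_of_norm_le hDt (Filter.Eventually.of_forall hb)
    _ = ∫ u, D u := integral_sub_right_eq_self D t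
    _ = M * C := by rw [hC, ← integral_const_mul]
    _ ≤ (C + 1) * M := by nlinarith

lemma rpow_neg_half_le {β x r : ℝ} (hβ0 : 0 ≤ β) (hr : 0 < r) (h : r ≤ x) :
    (x ^ (1 + β))⁻¹ ≤ r ^ (-(1 + β)) := by
  rw [Real.rpow_neg hr.le]
  gcongr

/-- Decay of the fractional derivative, far from the origin, of a function that is integrable
near the origin and decays regularly for large times. -/
lemma fracQuot_of_decay {β ε : ℝ} (hβ0 : 0 < β) (hβ1 : β < 1) (hε0 : 0 < ε) (hε1 : ε < 1) :
    ∃ C : ℝ, 0 < C ∧ ∀ (g : ℝ → ℝ) (M t : ℝ), Measurable g →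
      (∀ τ, τ < -1 → g τ = 0) → IntegrableOn g (Set.Icc (-1) 2) →
      (∫ τ in Set.Icc (-1) 2, |g τ|) ≤ M →
      (∀ τ, 2 ≤ τ → |g τ| ≤ M * τ ^ (-ε)) →
      (∀ τ τ', 2 ≤ τ → τ ≤ τ' → |g τ - g τ'| ≤ M * τ ^ (-1 - ε) * |τ - τ'|) → 4 ≤ |t| →
      Integrable (fracQuot β g t) ∧ |∫ τ, fracQuot β g t τ| ≤ C * M * |t| ^ (-(β + ε)) := by
  set C : ℝ := 2 / (1 - β) + 4 / β + 2 / (1 - ε) + 1 with hCdef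
  have hC : 0 < C := by
    have : 0 < 1 - β := by linarith
    have : 0 < 1 - ε := by linarith
    positivity
  refine ⟨C * 2 ^ (β + ε), by positivity, fun g M t hg h0 hI hIM h1 h2 ht => ?_⟩
  have hM : 0 ≤ M := le_trans (by positivity) hIM
  -- Points within `r` of `t` lie either in the regular range τ ≥ 2 or in the region τ < -1 where
  -- `g` vanishes.
  set r : ℝ := |t| / 2 with hr
  have hr2 : 2 ≤ r := by linarith
  have hr0 : 0 < r := by linarith
  -- The four terms are: τ close to `t`, by the Lipschitz bound; τ far from `t`, for the values `g
  -- t` and `g τ` with τ ≥ r; the range 2 < τ < r, by the decay of `g`; and the rough part of `g`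
  -- near the origin. Each integrates to at most a multiple of M r^{-(β + ε)}, the last one because
  -- r ≥ 1 and ε < 1.
  set D : ℝ → ℝ := fun τ => M * r ^ (-1 - ε) * innerPow r (-β) (τ - t)
    + 2 * M * r ^ (-ε) * outerPow r (-(1 + β)) (τ - t)
    + M * r ^ (-(1 + β)) * innerPow r (-ε) τ
    + r ^ (-(1 + β)) * (Set.Icc (-1) 2).indicator (fun τ => |g τ|) τ with hDdef
  have i1 : Integrable (fun τ => innerPow r (-β) (τ - t)) :=
    (integrable_innerPow hr0 (by linarith)).comp_sub_right t
  have i2 : Integrable (fun τ => outerPow r (-(1 + β)) (τ - t)) :=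
    (integrable_outerPow hr0 (by linarith)).comp_sub_right t
  have i3 : Integrable (innerPow r (-ε)) := integrable_innerPow hr0 (by linarith)
  have i4 : Integrable ((Set.Icc (-1 : ℝ) 2).indicator (fun τ => |g τ|)) :=
    (integrable_indicator_iff measurableSet_Icc).2 hI.abs
  have j1 := i1.const_mul (M * r ^ (-1 - ε))
  have j2 := i2.const_mul (2 * M * r ^ (-ε))
  have j3 := i3.const_mul (M * r ^ (-(1 + β)))
  have j4 := i4.const_mul (r ^ (-(1 + β)))
  have hD : Integrable D := ((j1.add j2).add j3).add j4
  have hb : ∀ τ, ‖fracQuot β g t τ‖ ≤ D τ := by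
    intro τ
    have p1 := innerPow_nonneg r (-β) (τ - t)
    have p2 := outerPow_nonneg r (-(1 + β)) (τ - t)
    have p3 := innerPow_nonneg r (-ε) τ
    have p4 : 0 ≤ (Set.Icc (-1 : ℝ) 2).indicator (fun τ => |g τ|) τ :=
      Set.indicator_nonneg (fun _ _ => abs_nonneg _) _
    have q1 : 0 ≤ M * r ^ (-1 - ε) * innerPow r (-β) (τ - t) := by positivity
    have q2 : 0 ≤ 2 * M * r ^ (-ε) * outerPow r (-(1 + β)) (τ - t) := by positivity
    have q3 : 0 ≤ M * r ^ (-(1 + β)) * innerPow r (-ε) τ := by positivity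
    have q4 : 0 ≤ r ^ (-(1 + β)) * (Set.Icc (-1) 2).indicator (fun τ => |g τ|) τ := by positivity
    rcases eq_or_ne τ t with rfl | hne
    · simp only [fracQuot, sub_self, zero_div, norm_zero, D] at *
      linarith
    have hu : 0 < |τ - t| := abs_pos.2 (sub_ne_zero.2 hne)
    rw [fracQuot, Real.norm_eq_abs, abs_div, abs_of_nonneg (Real.rpow_nonneg hu.le _)]
    have hgt : |g t| ≤ M * r ^ (-ε) := by
      rcases le_or_gt 0 t with h | h
      · rw [abs_of_nonneg h] at ht hr
        calc |g t| ≤ M * t ^ (-ε) := h1 t (by linarith)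
          _ ≤ M * r ^ (-ε) := by
            gcongr 1
            exact Real.rpow_le_rpow_of_nonpos hr0 (by linarith) (by linarith)
      · rw [abs_of_neg h] at ht
        rw [h0 t (by linarith), abs_zero]; positivity
    by_cases hlt : |τ - t| < r
    · have key : |g τ - g t| ≤ M * r ^ (-1 - ε) * |τ - t| := by
        rcases le_or_gt 0 t with h | h
        · rw [abs_of_nonneg h] at ht hr
          rw [abs_lt] at hlt
          rcases le_total τ t with hle | hle
          · refine (h2 τ t (by linarith) hle).trans ?_
            gcongr M * ?_ * _
            exact Real.rpow_le_rpow_of_nonpos hr0 (by linarith) (by linarith)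
          · rw [abs_sub_comm, abs_sub_comm τ]
            refine (h2 t τ (by linarith) hle).trans ?_
            gcongr M * ?_ * _
            exact Real.rpow_le_rpow_of_nonpos hr0 (by linarith) (by linarith)
        · rw [abs_of_neg h] at ht hr
          rw [abs_lt] at hlt
          rw [h0 t (by linarith), h0 τ (by linarith)]
          simp only [sub_self, abs_zero]; positivity
      have : |g τ - g t| / |τ - t| ^ (1 + β) ≤ M * r ^ (-1 - ε) * innerPow r (-β) (τ - t) := by
        simp only [innerPow, hlt, if_true]
        have e : |τ - t| ^ (-β) = |τ - t| / |τ - t| ^ (1 + β) := by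
          rw [div_eq_mul_inv, ← Real.rpow_neg hu.le]
          nth_rw 2 [← Real.rpow_one |τ - t|]
          rw [← Real.rpow_add hu]; ring_nf
        rw [e, ← mul_div_assoc]
        gcongr
      simp only [D]; linarith
    · have hlt' := not_lt.1 hlt
      have hmain : |g τ| / |τ - t| ^ (1 + β) ≤ M * r ^ (-ε) * outerPow r (-(1 + β)) (τ - t)
          + M * r ^ (-(1 + β)) * innerPow r (-ε) τ
          + r ^ (-(1 + β)) * (Set.Icc (-1) 2).indicator (fun τ => |g τ|) τ := by
        have q2' : 0 ≤ M * r ^ (-ε) * outerPow r (-(1 + β)) (τ - t) := by positivity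
        have hinv := rpow_neg_half_le hβ0.le hr0 hlt'
        rcases lt_or_ge τ (-1) with ha | ha
        · rw [h0 τ ha]; simp only [abs_zero, zero_div]; positivity
        rcases le_or_gt τ 2 with hb | hb
        · have : (Set.Icc (-1 : ℝ) 2).indicator (fun τ => |g τ|) τ = |g τ| :=
            Set.indicator_of_mem (Set.mem_Icc.2 ⟨ha, hb⟩) _
          have : |g τ| / |τ - t| ^ (1 + β) ≤
              r ^ (-(1 + β)) * (Set.Icc (-1) 2).indicator (fun τ => |g τ|) τ := by
            rw [this, div_eq_mul_inv, mul_comm]; gcongr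
          linarith
        rcases lt_or_ge τ r with hc | hc
        · have e : innerPow r (-ε) τ = τ ^ (-ε) := by
            simp only [innerPow, abs_of_pos (show 0 < τ by linarith), hc, if_true]
          have : |g τ| / |τ - t| ^ (1 + β) ≤ M * r ^ (-(1 + β)) * innerPow r (-ε) τ := by
            rw [e, div_eq_mul_inv, mul_right_comm]
            gcongr
            exact h1 τ hb.le
          linarith
        · have : |g τ| / |τ - t| ^ (1 + β) ≤ M * r ^ (-ε) * outerPow r (-(1 + β)) (τ - t) := by
            simp only [outerPow, hlt, if_false]
            rw [Real.rpow_neg hu.le, ← div_eq_mul_inv]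
            gcongr
            refine (h1 τ hb.le).trans ?_
            gcongr 1
            exact Real.rpow_le_rpow_of_nonpos hr0 hc (by linarith)
          linarith
      have hgt' : |g t| / |τ - t| ^ (1 + β) ≤ M * r ^ (-ε) * outerPow r (-(1 + β)) (τ - t) := by
        simp only [outerPow, hlt, if_false]
        rw [Real.rpow_neg hu.le, ← div_eq_mul_inv]
        gcongr
      have : |g τ - g t| / |τ - t| ^ (1 + β) ≤
          |g τ| / |τ - t| ^ (1 + β) + |g t| / |τ - t| ^ (1 + β) := by
        rw [← add_div]; gcongr; exact abs_sub _ _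
      simp only [D]; linarith
  have hint : Integrable (fracQuot β g t) :=
    hD.mono' (measurable_fracQuot hg t).aestronglyMeasurable (Filter.Eventually.of_forall hb)
  refine ⟨hint, ?_⟩
  have hDval : ∫ τ, D τ = M * r ^ (-1 - ε) * (2 * (r ^ (-β + 1) / (-β + 1)))
      + 2 * M * r ^ (-ε) * (2 * (r ^ (-(1 + β) + 1) / (-(-(1 + β) + 1))))
      + M * r ^ (-(1 + β)) * (2 * (r ^ (-ε + 1) / (-ε + 1)))
      + r ^ (-(1 + β)) * ∫ τ in Set.Icc (-1) 2, |g τ| := by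
    have e1 : ∫ τ, innerPow r (-β) (τ - t) = 2 * (r ^ (-β + 1) / (-β + 1)) := by
      rw [integral_sub_right_eq_self (innerPow r (-β)) t, integral_innerPow hr0 (by linarith)]
    have e2 : ∫ τ, outerPow r (-(1 + β)) (τ - t) =
        2 * (r ^ (-(1 + β) + 1) / (-(-(1 + β) + 1))) := by
      rw [integral_sub_right_eq_self (outerPow r (-(1 + β))) t,
        integral_outerPow hr0 (by linarith)]
    have k2 : Integrable (fun τ => M * r ^ (-1 - ε) * innerPow r (-β) (τ - t)
      + 2 * M * r ^ (-ε) * outerPow r (-(1 + β)) (τ - t)) := j1.add j2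
    have k3 : Integrable (fun τ => M * r ^ (-1 - ε) * innerPow r (-β) (τ - t)
      + 2 * M * r ^ (-ε) * outerPow r (-(1 + β)) (τ - t)
      + M * r ^ (-(1 + β)) * innerPow r (-ε) τ) := k2.add j3
    rw [← e1, ← e2, ← integral_innerPow hr0 (by linarith : -1 < -ε),
      ← integral_indicator measurableSet_Icc, ← integral_const_mul, ← integral_const_mul,
      ← integral_const_mul, ← integral_const_mul, ← integral_add j1 j2,
      ← integral_add k2 j3, ← integral_add k3 j4]
  have hrt : |t| ^ (-(β + ε)) * 2 ^ (β + ε) = r ^ (-(β + ε)) := by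
    rw [hr, Real.div_rpow (abs_nonneg _) (by norm_num), Real.rpow_neg (by norm_num : (0:ℝ) ≤ 2),
      div_inv_eq_mul]
  have m1 : r ^ (-1 - ε) * r ^ (-β + 1) = r ^ (-(β + ε)) := by
    rw [← Real.rpow_add hr0]; ring_nf
  have m2 : r ^ (-ε) * r ^ (-(1 + β) + 1) = r ^ (-(β + ε)) := by
    rw [← Real.rpow_add hr0]; ring_nf
  have m3 : r ^ (-(1 + β)) * r ^ (-ε + 1) = r ^ (-(β + ε)) := by
    rw [← Real.rpow_add hr0]; ring_nf
  have m4 : r ^ (-(1 + β)) ≤ r ^ (-(β + ε)) :=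
    Real.rpow_le_rpow_of_exponent_le (by linarith) (by linarith)
  have m5 : r ^ (-(1 + β)) * ∫ τ in Set.Icc (-1) 2, |g τ| ≤ r ^ (-(β + ε)) * M := by
    gcongr
  calc |∫ τ, fracQuot β g t τ| ≤ ∫ τ, D τ :=
        norm_integral_le_of_norm_le hD (Filter.Eventually.of_forall hb)
    _ ≤ M * r ^ (-(β + ε)) * (2 / (1 - β)) + M * r ^ (-(β + ε)) * (4 / β)
        + M * r ^ (-(β + ε)) * (2 / (1 - ε)) + r ^ (-(β + ε)) * M := by
      rw [hDval]
      refine add_le_add (le_of_eq ?_) m5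
      have hb1 : (-β + 1) ≠ 0 := by linarith
      have he1 : (-ε + 1) ≠ 0 := by linarith
      nth_rw 1 [← m1]
      nth_rw 1 [← m2]
      rw [← m3]
      rw [show -(-(1 + β) + 1) = β by ring, show -β + 1 = 1 - β by ring,
        show -ε + 1 = 1 - ε by ring]
      ring
    _ = C * 2 ^ (β + ε) * M * |t| ^ (-(β + ε)) := by
      rw [← hrt, hCdef]; ring

/-! ### Holomorphic parameter integrals -/

/-- An integral depending holomorphically on a parameter, with an integrable bound, is
holomorphic. -/
lemma differentiableOn_integral_of_norm_le {α : Type*} [MeasurableSpace α] {μ : Measure α}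
    {F : ℂ → α → ℂ} {U : Set ℂ} {b : α → ℝ} (hU : IsOpen U)
    (hm : ∀ w ∈ U, AEStronglyMeasurable (F w) μ)
    (hd : ∀ a, DifferentiableOn ℂ (fun w => F w a) U)
    (hb : ∀ a, ∀ w ∈ U, ‖F w a‖ ≤ b a) (hbi : Integrable b μ) :
    DifferentiableOn ℂ (fun w => ∫ a, F w a ∂μ) U := by
  intro w₀ hw₀
  obtain ⟨ρ, hρ, hsub⟩ := Metric.isOpen_iff.1 hU w₀ hw₀
  have hball : ∀ w ∈ Metric.ball w₀ (ρ / 2), Metric.closedBall w (ρ / 4) ⊆ U := by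
    intro w hw z hz
    apply hsub
    rw [Metric.mem_ball] at *
    rw [Metric.mem_closedBall] at hz
    linarith [dist_triangle z w w₀]
  have hda : ∀ a, ∀ w ∈ U, DifferentiableAt ℂ (fun w => F w a) w := fun a w hw =>
    (hd a w hw).differentiableAt (hU.mem_nhds hw)
  -- The derivative in the parameter is measurable as a limit of difference quotients along a
  -- sequence of increments.
  have hmeas : AEStronglyMeasurable (fun a => deriv (fun w => F w a) w₀) μ := by
    have hlim : ∀ a, Filter.Tendsto (fun k : ℕ => ((ρ / 2 / (k + 1) : ℝ) : ℂ)⁻¹ •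
        (F (w₀ + ((ρ / 2 / (k + 1) : ℝ) : ℂ)) a - F w₀ a)) Filter.atTop
        (nhds (deriv (fun w => F w a) w₀)) := by
      intro a
      have h1 := (hda a w₀ hw₀).hasDerivAt.tendsto_slope_zero
      refine h1.comp (tendsto_nhdsWithin_iff.2 ⟨?_, Filter.Eventually.of_forall fun k => ?_⟩)
      · have : Filter.Tendsto (fun k : ℕ => ρ / 2 / ((k : ℝ) + 1)) Filter.atTop (nhds 0) :=
          (tendsto_const_nhds (x := ρ / 2)).div_atTop
            (Filter.tendsto_atTop_add_const_right _ _ tendsto_natCast_atTop_atTop)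
        exact_mod_cast (Complex.continuous_ofReal.tendsto 0).comp this
      · simp only [Set.mem_compl_iff, Set.mem_singleton_iff, Complex.ofReal_eq_zero]
        positivity
    refine aestronglyMeasurable_of_tendsto_ae Filter.atTop (fun k => ?_)
      (Filter.Eventually.of_forall hlim)
    refine ((hm _ (hsub ?_)).sub (hm _ hw₀)).const_smul (((ρ / 2 / (k + 1) : ℝ) : ℂ)⁻¹)
    have hk : ρ / 2 / ((k : ℝ) + 1) ≤ ρ / 2 := div_le_self (by linarith) (by linarith [k.cast_nonneg (α := ℝ)])
    have hk' : 0 ≤ ρ / 2 / ((k : ℝ) + 1) := by positivity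
    rw [Metric.mem_ball, dist_eq_norm, add_sub_cancel_left, Complex.norm_real, Real.norm_eq_abs,
      abs_of_nonneg hk']
    linarith
  -- Cauchy's estimate on discs of radius ρ/4 turns the bound on `F` into the bound `b a / (ρ / 4)`
  -- on its derivative.
  have key := hasDerivAt_integral_of_dominated_loc_of_deriv_le (μ := μ) (F := F)
    (F' := fun w a => deriv (fun w => F w a) w) (x₀ := w₀) (s := Metric.ball w₀ (ρ / 2))
    (bound := fun a => b a / (ρ / 4)) (Metric.ball_mem_nhds _ (by linarith))
    (Filter.eventually_of_mem (hU.mem_nhds hw₀) hm)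
    (hbi.mono' (hm _ hw₀) (Filter.Eventually.of_forall fun a => hb a _ hw₀)) hmeas
    (Filter.Eventually.of_forall fun a w hw => by
      refine Complex.norm_deriv_le_of_forall_mem_sphere_norm_le (by linarith) ?_ (fun z hz =>
        hb a z (hball w hw (Metric.sphere_subset_closedBall hz)))
      refine ((hd a).mono ?_).diffContOnCl
      exact (closure_minimal Metric.ball_subset_closedBall Metric.isClosed_closedBall).trans
        (hball w hw))
    (hbi.div_const _)
    (Filter.Eventually.of_forall fun a w hw => (hda a w (hball w hw
      (Metric.mem_closedBall_self (by linarith)))).hasDerivAt)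
  exact key.2.differentiableAt.differentiableWithinAt

/-! ### The bent real axis and its change of variables -/

/-- The two rays `x w`, `x ≥ 0`, and `x / w`, `x < 0`. -/
noncomputable def rot (w : ℂ) (x : ℝ) : ℂ := if 0 ≤ x then x * w else x * w⁻¹

/-- The derivative of `rot`. -/
noncomputable def jac (w : ℂ) (x : ℝ) : ℂ := if 0 ≤ x then w else w⁻¹

/-- `rot` for a real parameter. -/
noncomputable def rotR (v x : ℝ) : ℝ := if 0 ≤ x then x * v else x * v⁻¹

/-- `jac` for a real parameter. -/
noncomputable def jacR (v x : ℝ) : ℝ := if 0 ≤ x then v else v⁻¹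

lemma rot_ofReal (v x : ℝ) : rot v x = rotR v x := by
  unfold rot rotR; split_ifs <;> simp

lemma jac_ofReal (v x : ℝ) : jac v x = jacR v x := by
  unfold jac jacR; split_ifs <;> simp

lemma jacR_pos {v : ℝ} (hv : 0 < v) (x : ℝ) : 0 < jacR v x := by
  unfold jacR; split_ifs <;> positivity

lemma rotR_nonneg_iff {v : ℝ} (hv : 0 < v) (x : ℝ) : 0 ≤ rotR v x ↔ 0 ≤ x := by
  unfold rotR
  split_ifs with h
  · simp [h, mul_nonneg h hv.le]
  · simp only [h, iff_false, not_le]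
    exact mul_neg_of_neg_of_pos (not_le.1 h) (inv_pos.2 hv)

lemma rotR_inv_rotR {v : ℝ} (hv : 0 < v) (x : ℝ) : rotR v⁻¹ (rotR v x) = x := by
  have h := rotR_nonneg_iff hv x
  by_cases hx : 0 ≤ x
  · have e : rotR v x = x * v := by simp [rotR, hx]
    rw [rotR, if_pos (h.2 hx), e]; field_simp
  · have e : rotR v x = x * v⁻¹ := by simp [rotR, hx]
    rw [rotR, if_neg (fun h' => hx (h.1 h')), e]; field_simp

lemma hasDerivAt_rotR (v : ℝ) {x : ℝ} (hx : x ≠ 0) : HasDerivAt (rotR v) (jacR v x) x := by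
  rcases lt_or_gt_of_ne hx with h | h
  · have : HasDerivAt (fun y : ℝ => y * v⁻¹) (1 * v⁻¹) x := (hasDerivAt_id x).mul_const _
    rw [one_mul] at this
    simp only [jacR, not_le.2 h, if_false]
    refine this.congr_of_eventuallyEq ?_
    filter_upwards [Iio_mem_nhds h] with y hy
    simp [rotR, not_le.2 (Set.mem_Iio.1 hy)]
  · have : HasDerivAt (fun y : ℝ => y * v) (1 * v) x := (hasDerivAt_id x).mul_const _
    rw [one_mul] at this
    simp only [jacR, h.le, if_true]
    refine this.congr_of_eventuallyEq ?_
    filter_upwards [Ioi_mem_nhds h] with y hy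
    simp [rotR, (Set.mem_Ioi.1 hy).le]

lemma ae_forall_ne_zero (n : ℕ) : ∀ᵐ r : Fin n → ℝ, ∀ i, r i ≠ 0 := by
  rw [ae_all_iff]
  intro i
  rw [ae_iff]
  simp only [ne_eq, not_not]
  exact Measure.pi_hyperplane (fun _ => volume) i 0

/-- Change of variables under the piecewise linear map `rotR v` in each coordinate. -/
lemma integral_comp_rotR {n : ℕ} {v : ℝ} (hv : 0 < v) (f : (Fin n → ℝ) → ℂ) :
    ∫ r : Fin n → ℝ, (∏ i, (jacR v (r i) : ℂ)) * f (fun i => rotR v (r i)) = ∫ r, f r := by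
  -- The coordinate hyperplanes, where `rotR v` has a kink, are removed; they are null, and the map
  -- preserves their complement.
  set S : Set (Fin n → ℝ) := {r | ∀ i, r i ≠ 0} with hS
  have hSm : MeasurableSet S := by
    have : S = ⋂ i, {r : Fin n → ℝ | r i ≠ 0} := by ext; simp [hS]
    rw [this]
    exact MeasurableSet.iInter fun i => (measurableSet_singleton (0:ℝ)).compl.preimage
      (measurable_pi_apply i)
  have hae : S =ᵐ[volume] Set.univ := by
    rw [ae_eq_univ]; exact ae_forall_ne_zero n
  set T : (Fin n → ℝ) → (Fin n → ℝ) := fun r i => rotR v (r i) with hT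
  set T' : (Fin n → ℝ) → ((Fin n → ℝ) →L[ℝ] (Fin n → ℝ)) := fun r =>
    ContinuousLinearMap.pi fun i =>
      (ContinuousLinearMap.toSpanSingleton ℝ (jacR v (r i))) ∘L ContinuousLinearMap.proj i with hT'
  have hd : ∀ r ∈ S, HasFDerivWithinAt T (T' r) S r := by
    intro r hr
    refine HasFDerivAt.hasFDerivWithinAt (hasFDerivAt_pi.2 fun i => ?_)
    exact ((hasDerivAt_rotR v (hr i)).hasFDerivAt).comp r
      (ContinuousLinearMap.proj (R := ℝ) (φ := fun _ : Fin n => ℝ) i).hasFDerivAt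
  have hinv : ∀ r, (fun i => rotR v⁻¹ (T r i)) = r := fun r => by
    ext i; exact rotR_inv_rotR hv (r i)
  have hinj : Set.InjOn T S := fun r _ r' _ h => by rw [← hinv r, ← hinv r', h]
  have him : T '' S = S := by
    ext r
    constructor
    · rintro ⟨r', hr', rfl⟩ i h0
      have := rotR_inv_rotR hv (r' i)
      simp only [hT] at h0
      rw [h0] at this
      exact hr' i (by rw [← this]; simp [rotR])
    · intro hr
      refine ⟨fun i => rotR v⁻¹ (r i), fun i h0 => ?_, ?_⟩
      · have := rotR_inv_rotR (inv_pos.2 hv) (r i)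
        simp only at h0
        rw [h0] at this
        exact hr i (by rw [← this]; simp [rotR])
      · ext i
        have := rotR_inv_rotR (inv_pos.2 hv) (r i)
        rwa [inv_inv] at this
  have hdet : ∀ r, |(T' r).det| = ∏ i, jacR v (r i) := by
    intro r
    rw [hT', ContinuousLinearMap.det_pi]
    rw [abs_of_nonneg]
    · exact Finset.prod_congr rfl fun i _ => by
        simp [ContinuousLinearMap.det, LinearMap.det_ring]
    · exact Finset.prod_nonneg fun i _ => by
        simpa [ContinuousLinearMap.det, LinearMap.det_ring] using (jacR_pos hv (r i)).le
  have key := integral_image_eq_integral_abs_det_fderiv_smul volume hSm hd hinj f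
  rw [him, setIntegral_congr_set hae, setIntegral_congr_set hae, setIntegral_univ,
    setIntegral_univ] at key
  rw [key]
  refine integral_congr_ae (Filter.Eventually.of_forall fun r => ?_)
  simp only [hdet r, Complex.real_smul, Complex.ofReal_prod]
  rfl

/-! ### Rotation of the contour inside a sector -/

/-- A bounded sector around `1` in which the contour is rotated. -/
def sector : Set ℂ := {w | 1 / 2 < w.re ∧ w.re < 2 ∧ |w.im| < w.re / 4}

lemma isOpen_sector : IsOpen sector := by
  refine (isOpen_lt continuous_const Complex.continuous_re).inter
    ((isOpen_lt Complex.continuous_re continuous_const).inter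
      (isOpen_lt Complex.continuous_im.abs (Complex.continuous_re.div_const _)))

lemma convex_sector : Convex ℝ sector := by
  intro z hz w hw a b ha hb hab
  simp only [sector, Set.mem_ofPred_eq, abs_lt, Complex.add_re, Complex.add_im, Complex.real_smul,
    Complex.re_ofReal_mul, Complex.im_ofReal_mul] at *
  obtain ⟨h1, h2, h3, h4⟩ := hz
  obtain ⟨k1, k2, k3, k4⟩ := hw
  rcases ha.eq_or_lt with rfl | ha'
  · rw [zero_add] at hab
    subst hab
    simp only [zero_mul, one_mul, zero_add]
    exact ⟨k1, k2, k3, k4⟩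
  · refine ⟨?_, ?_, ?_, ?_⟩ <;> obtain rfl : b = 1 - a := by linarith
    all_goals nlinarith

lemma one_mem_sector : (1 : ℂ) ∈ sector := by
  simp only [sector, Set.mem_ofPred_eq, Complex.one_re, Complex.one_im, abs_zero]; norm_num

lemma rotated_mem_sector : (1 + Complex.I / 8 : ℂ) ∈ sector := by
  simp only [sector, Set.mem_ofPred_eq, Complex.add_re, Complex.add_im, Complex.one_re,
    Complex.one_im, Complex.div_ofNat_re, Complex.div_ofNat_im, Complex.I_re, Complex.I_im]
  norm_num [abs_lt]

lemma ne_zero_of_mem_sector {w : ℂ} (hw : w ∈ sector) : w ≠ 0 := by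
  rintro rfl
  have := hw.1
  simp at this
  linarith

lemma norm_le_of_mem_sector {w : ℂ} (hw : w ∈ sector) : ‖w‖ ≤ 3 := by
  obtain ⟨h1, h2, h3⟩ := hw
  calc ‖w‖ ≤ |w.re| + |w.im| := Complex.norm_le_abs_re_add_abs_im w
    _ ≤ 3 := by rw [abs_of_pos (by linarith : 0 < w.re)]; linarith

lemma norm_inv_le_of_mem_sector {w : ℂ} (hw : w ∈ sector) : ‖w⁻¹‖ ≤ 3 := by
  obtain ⟨h1, h2, h3⟩ := hw
  rw [norm_inv]
  have : 1 / 2 ≤ ‖w‖ := h1.le.trans ((le_abs_self _).trans (Complex.abs_re_le_norm w))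
  calc ‖w‖⁻¹ ≤ (1 / 2)⁻¹ := by gcongr
    _ ≤ 3 := by norm_num

lemma norm_rot_le {w : ℂ} (hw : w ∈ sector) (x : ℝ) : ‖rot w x‖ ≤ 3 * |x| := by
  have h1 := norm_le_of_mem_sector hw
  have h2 := norm_inv_le_of_mem_sector hw
  unfold rot
  split_ifs <;> rw [norm_mul, Complex.norm_real, Real.norm_eq_abs, mul_comm] <;> gcongr

lemma norm_jac_le {w : ℂ} (hw : w ∈ sector) (x : ℝ) : ‖jac w x‖ ≤ 3 := by
  unfold jac
  split_ifs
  exacts [norm_le_of_mem_sector hw, norm_inv_le_of_mem_sector hw]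

/-- In the sector the argument stays below π/4 in absolute value, so the squares of both rays lie in
the right half-plane; the bounds on the real part of `w` make this quantitative for `w` and for
`w⁻¹`. -/
lemma rot_sq_re_ge {w : ℂ} (hw : w ∈ sector) (x : ℝ) : x ^ 2 / 8 ≤ (rot w x ^ 2).re := by
  obtain ⟨h1, h2, h3⟩ := hw
  rw [abs_lt] at h3
  have hv : w.im ^ 2 ≤ w.re ^ 2 / 16 := by nlinarith
  unfold rot
  split_ifs
  · rw [mul_pow, ← Complex.ofReal_pow, Complex.re_ofReal_mul, div_eq_mul_inv]
    gcongr
    rw [sq w, Complex.mul_re]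
    nlinarith
  · rw [mul_pow, ← Complex.ofReal_pow, Complex.re_ofReal_mul, div_eq_mul_inv]
    gcongr
    rw [sq w⁻¹, Complex.mul_re, Complex.inv_re, Complex.inv_im, Complex.normSq_apply]
    set N := w.re * w.re + w.im * w.im with hN
    have hNp : 0 < N := by nlinarith
    have hN2 : N ≤ 17 / 4 := by nlinarith
    have e : w.re / N * (w.re / N) - -w.im / N * (-w.im / N) =
        (w.re ^ 2 - w.im ^ 2) / N ^ 2 := by field_simp
    rw [e, le_div_iff₀ (by positivity)]
    nlinarith

/-- The sum of the squares of the rotated coordinates. -/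
noncomputable def rotSq {n : ℕ} (w : ℂ) (r : Fin n → ℝ) : ℂ := ∑ i, rot w (r i) ^ 2

lemma rotSq_re_ge {n : ℕ} {w : ℂ} (hw : w ∈ sector) (r : Fin n → ℝ) :
    (∑ i, r i ^ 2) / 8 ≤ (rotSq w r).re := by
  rw [rotSq, Complex.re_sum, Finset.sum_div]
  exact Finset.sum_le_sum fun i _ => rot_sq_re_ge hw (r i)

lemma rotSq_re_nonneg {n : ℕ} {w : ℂ} (hw : w ∈ sector) (r : Fin n → ℝ) :
    0 ≤ (rotSq w r).re :=
  le_trans (by positivity) (rotSq_re_ge hw r)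

lemma norm_rotSq_le {n : ℕ} {w : ℂ} (hw : w ∈ sector) (r : Fin n → ℝ) :
    ‖rotSq w r‖ ≤ ∑ i, 9 * r i ^ 2 := by
  refine (norm_sum_le _ _).trans (Finset.sum_le_sum fun i _ => ?_)
  rw [norm_pow, ← sq_abs (r i)]
  calc ‖rot w (r i)‖ ^ 2 ≤ (3 * |r i|) ^ 2 := by gcongr; exact norm_rot_le hw _
    _ = 9 * |r i| ^ 2 := by ring

/-- The power multiplies the argument, which is at most π/2, by s ≤ 1. This keeps exp(-κ z^s)
bounded on the rotated contour. -/
lemma cpow_re_nonneg {z : ℂ} (hz : 0 ≤ z.re) {s : ℝ} (hs0 : 0 ≤ s) (hs1 : s ≤ 1) :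
    0 ≤ (z ^ (s : ℂ)).re := by
  rw [Complex.cpow_ofReal_re]
  have h := Complex.abs_arg_le_pi_div_two_iff.2 hz
  refine mul_nonneg (by positivity) (Real.cos_nonneg_of_mem_Icc (abs_le.1 ?_))
  rw [abs_mul, abs_of_nonneg hs0]
  calc |z.arg| * s ≤ |z.arg| * 1 := by gcongr
    _ ≤ _ := by linarith

/-- The integrand on the rotated contour. -/
noncomputable def rotIntegrand {n : ℕ} (A s κ η : ℝ) (w : ℂ) (r : Fin n → ℝ) : ℂ :=
  (∏ i, jac w (r i)) * (Complex.exp (A * Complex.I * ∑ i, rot w (r i)) *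
    Complex.exp (-κ * rotSq w r ^ (s : ℂ) - η * rotSq w r))

lemma measurable_rot (w : ℂ) : Measurable (rot w) := by
  unfold rot
  exact Measurable.ite measurableSet_Ici (by fun_prop) (by fun_prop)

lemma measurable_jac (w : ℂ) : Measurable (jac w) := by
  unfold jac
  exact Measurable.ite measurableSet_Ici (by fun_prop) (by fun_prop)

lemma measurable_rotSq {n : ℕ} (w : ℂ) : Measurable (rotSq (n := n) w) := by
  have := measurable_rot w
  unfold rotSq; fun_prop

lemma measurable_rotIntegrand {n : ℕ} (A s κ η : ℝ) (w : ℂ) :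
    Measurable (rotIntegrand (n := n) A s κ η w) := by
  have := measurable_rot w
  have := measurable_jac w
  have := measurable_rotSq (n := n) w
  unfold rotIntegrand; fun_prop

lemma norm_exp_rotSq_le {n : ℕ} {s κ η : ℝ} (hs0 : 0 ≤ s) (hs1 : s ≤ 1) (hκ : 0 ≤ κ) (hη : 0 ≤ η)
    {w : ℂ} (hw : w ∈ sector) (r : Fin n → ℝ) :
    ‖Complex.exp (-κ * rotSq w r ^ (s : ℂ) - η * rotSq w r)‖ ≤
      Real.exp (-(η * ((∑ i, r i ^ 2) / 8))) := by
  rw [Complex.norm_exp]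
  refine Real.exp_le_exp.2 ?_
  have h1 := mul_nonneg hκ (cpow_re_nonneg (rotSq_re_nonneg hw r) hs0 hs1)
  have h2 := mul_le_mul_of_nonneg_left (rotSq_re_ge hw r) hη
  rw [Complex.sub_re, ← Complex.ofReal_neg, Complex.re_ofReal_mul, Complex.re_ofReal_mul]
  linarith

lemma norm_prod_jac_le {n : ℕ} {w : ℂ} (hw : w ∈ sector) (r : Fin n → ℝ) :
    ‖∏ i, jac w (r i)‖ ≤ ∏ _i : Fin n, 3 := by
  rw [norm_prod]
  exact Finset.prod_le_prod (fun _ _ => norm_nonneg _) fun i _ => norm_jac_le hw _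

lemma integrable_exp_abs_sub_sq (b : ℝ) {c : ℝ} (hc : 0 < c) :
    Integrable fun x : ℝ => Real.exp (b * |x| - c * x ^ 2) := by
  have h := (integrable_exp_neg_mul_sq (half_pos hc)).const_mul (Real.exp (b ^ 2 / (2 * c)))
  refine h.mono' (by fun_prop) (Filter.Eventually.of_forall fun x => ?_)
  rw [Real.norm_eq_abs, abs_of_pos (Real.exp_pos _), ← Real.exp_add]
  refine Real.exp_le_exp.2 ?_
  have e : b ^ 2 / (2 * c) + -(c / 2) * x ^ 2 - (b * |x| - c * x ^ 2) =
      (c * |x| - b) ^ 2 / (2 * c) := by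
    rw [← sq_abs x]; field_simp; ring
  have : 0 ≤ (c * |x| - b) ^ 2 / (2 * c) := by positivity
  linarith

/-- In half of the sector the phase grows exponentially. The Gaussian factor with parameter η
absorbs this growth and gives a majorant independent of `w`, as holomorphy of the integral requires.
-/
lemma norm_rotIntegrand_le {n : ℕ} {A s κ η : ℝ} (hA : 0 ≤ A) (hs0 : 0 ≤ s) (hs1 : s ≤ 1)
    (hκ : 0 ≤ κ) (hη : 0 ≤ η) {w : ℂ} (hw : w ∈ sector) (r : Fin n → ℝ) :
    ‖rotIntegrand A s κ η w r‖ ≤ ∏ i, 3 * Real.exp (3 * A * |r i| - η / 8 * r i ^ 2) := by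
  have h1 : ‖Complex.exp (A * Complex.I * ∑ i, rot w (r i))‖ ≤ Real.exp (∑ i, 3 * A * |r i|) := by
    refine (Complex.norm_exp_le_exp_norm _).trans (Real.exp_le_exp.2 ?_)
    rw [norm_mul, norm_mul, Complex.norm_I, Complex.norm_real, Real.norm_eq_abs, abs_of_nonneg hA,
      mul_one]
    calc A * ‖∑ i, rot w (r i)‖ ≤ A * ∑ i, 3 * |r i| := by
          gcongr
          exact (norm_sum_le _ _).trans (Finset.sum_le_sum fun i _ => norm_rot_le hw _)
      _ = ∑ i, 3 * A * |r i| := by rw [Finset.mul_sum]; exact Finset.sum_congr rfl fun _ _ => by ring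
  have h2 := norm_exp_rotSq_le hs0 hs1 hκ hη hw r
  rw [Finset.prod_mul_distrib, ← Real.exp_sum, Finset.sum_sub_distrib, sub_eq_add_neg, Real.exp_add,
    rotIntegrand, norm_mul, norm_mul]
  gcongr
  · exact norm_prod_jac_le hw r
  · refine h2.trans (le_of_eq ?_)
    rw [← Finset.mul_sum]; ring_nf

lemma integrable_rotIntegrand_bound {n : ℕ} (A : ℝ) {η : ℝ} (hη : 0 < η) :
    Integrable fun r : Fin n → ℝ => ∏ i, 3 * Real.exp (3 * A * |r i| - η / 8 * r i ^ 2) :=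
  Integrable.fintype_prod (f := fun _ x => 3 * Real.exp (3 * A * |x| - η / 8 * x ^ 2)) fun _ =>
    (integrable_exp_abs_sub_sq (3 * A) (by positivity)).const_mul 3

lemma differentiableOn_rotIntegrand {n : ℕ} (A s κ η : ℝ)
    (r : Fin n → ℝ) : DifferentiableOn ℂ (fun w => rotIntegrand A s κ η w r) sector := by
  have hrot : ∀ i, DifferentiableOn ℂ (fun w => rot w (r i)) sector := by
    intro i
    unfold rot
    split_ifs
    · fun_prop
    · exact (differentiableOn_inv.mono fun w hw => ne_zero_of_mem_sector hw).const_mul _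
  have hjac : ∀ i, DifferentiableOn ℂ (fun w => jac w (r i)) sector := by
    intro i
    unfold jac
    split_ifs
    · fun_prop
    · exact differentiableOn_inv.mono fun w hw => ne_zero_of_mem_sector hw
  have hsq : DifferentiableOn ℂ (fun w => rotSq w r) sector :=
    DifferentiableOn.fun_sum fun i _ => (hrot i).pow 2
  have hpow : DifferentiableOn ℂ (fun w => rotSq w r ^ (s : ℂ)) sector := by
    -- Away from r = 0 the base of the power has positive real part, hence avoids the branch cut; at
    -- r = 0 it is constantly zero.
    by_cases h0 : ∀ i, r i = 0
    · have : ∀ w, rotSq w r = 0 := fun w => by simp [rotSq, rot, h0]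
      simp only [this]
      exact differentiableOn_const _
    · push Not at h0
      obtain ⟨j, hj⟩ := h0
      intro w hw
      refine DifferentiableWithinAt.cpow (hsq w hw) (differentiableWithinAt_const _) (Or.inl ?_)
      refine lt_of_lt_of_le ?_ (rotSq_re_ge hw r)
      have : r j ^ 2 ≤ ∑ i, r i ^ 2 :=
        Finset.single_le_sum (f := fun i => r i ^ 2) (fun i _ => sq_nonneg _) (Finset.mem_univ j)
      have hj2 : 0 < r j ^ 2 := by positivity
      linarith
  unfold rotIntegrand
  refine (DifferentiableOn.fun_finsetProd fun i _ => hjac i).mul (DifferentiableOn.mul ?_ ?_)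
  · exact ((DifferentiableOn.fun_sum fun i _ => hrot i).const_mul _).cexp
  · exact ((hpow.const_mul _).sub (hsq.const_mul _)).cexp

/-- Rotating the contour does not change the regularized integral. -/
lemma integral_rotIntegrand_eq {n : ℕ} {A s κ η : ℝ} (hA : 0 ≤ A) (hs0 : 0 < s) (hs1 : s ≤ 1)
    (hκ : 0 ≤ κ) (hη : 0 < η) {w : ℂ} (hw : w ∈ sector) :
    ∫ r : Fin n → ℝ, rotIntegrand A s κ η w r = ∫ r : Fin n → ℝ, rotIntegrand A s κ η 1 r := by
  set H : ℂ → ℂ := fun w => ∫ r : Fin n → ℝ, rotIntegrand A s κ η w r with hH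
  have hdiff : DifferentiableOn ℂ H sector :=
    differentiableOn_integral_of_norm_le isOpen_sector
      (fun w _ => (measurable_rotIntegrand A s κ η w).aestronglyMeasurable)
      (fun r => differentiableOn_rotIntegrand A s κ η r)
      (fun r w hw => norm_rotIntegrand_le hA hs0.le hs1 hκ hη.le hw r)
      (integrable_rotIntegrand_bound A hη)
  -- For real parameters both rays stay on the real line, so the rotation is a real substitution.
  have hreal : ∀ v : ℝ, 0 < v → H v = H 1 := by
    intro v hv
    set f : (Fin n → ℝ) → ℂ := fun r => Complex.exp (A * Complex.I * ∑ i, (r i : ℂ)) *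
      Complex.exp (-κ * (∑ i, (r i : ℂ) ^ 2) ^ (s : ℂ) - η * ∑ i, (r i : ℂ) ^ 2) with hf
    have h : ∀ v : ℝ, 0 < v → H v = ∫ r, f r := by
      intro v hv
      rw [← integral_comp_rotR hv f]
      simp only [hH, hf, rotIntegrand, rotSq, rot_ofReal, jac_ofReal]
    have h1 := h 1 one_pos
    rw [Complex.ofReal_one] at h1
    rw [h v hv, h1]
  have han := hdiff.analyticOnNhd isOpen_sector
  refine han.eqOn_of_preconnected_of_frequently_eq (g := fun _ => H 1) analyticOnNhd_const
    convex_sector.isPreconnected one_mem_sector ?_ hw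
  -- The identity theorem only needs equality at real points accumulating at 1.
  have ht : Filter.Tendsto (fun k : ℕ => ((1 + 1 / ((k : ℝ) + 1) : ℝ) : ℂ)) Filter.atTop
      (nhdsWithin 1 {1}ᶜ) := by
    refine tendsto_nhdsWithin_iff.2 ⟨?_, Filter.Eventually.of_forall fun k => ?_⟩
    · have := (tendsto_one_div_add_atTop_nhds_zero_nat (𝕜 := ℝ)).const_add 1
      rw [add_zero] at this
      exact_mod_cast (Complex.continuous_ofReal.tendsto 1).comp this
    · simp only [Set.mem_compl_iff, Set.mem_singleton_iff]
      intro h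
      have h' : (1 + 1 / ((k : ℝ) + 1)) = 1 := by exact_mod_cast h
      have : 0 < 1 / ((k : ℝ) + 1) := by positivity
      linarith
  refine ht.frequently (Filter.Frequently.of_forall fun k => hreal _ (by positivity))

/-! ### Decay on the rotated contour -/

/-- The parameter of the rotated contour. -/
noncomputable def rotPar : ℂ := 1 + Complex.I / 8

lemma rotPar_mem : rotPar ∈ sector := rotated_mem_sector

/-- The parameter has positive imaginary part and its inverse negative imaginary part, so both rays
point into the upper half-plane. Using the inverse on the negative axis, rather than the conjugate,
keeps the dependence on the parameter holomorphic. -/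
lemma abs_le_rot_im (x : ℝ) : |x| / 9 ≤ (rot rotPar x).im := by
  unfold rot rotPar
  split_ifs with h
  · rw [Complex.im_ofReal_mul, abs_of_nonneg h]
    simp only [Complex.add_im, Complex.one_im, Complex.div_ofNat_im, Complex.I_im]
    linarith
  · rw [Complex.im_ofReal_mul, abs_of_neg (not_le.1 h), Complex.inv_im, Complex.normSq_apply]
    simp only [Complex.add_im, Complex.one_im, Complex.div_ofNat_im, Complex.I_im, Complex.add_re,
      Complex.one_re, Complex.div_ofNat_re, Complex.I_re]
    norm_num
    linarith [not_le.1 h]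

lemma norm_exp_rot_le {n : ℕ} {A : ℝ} (hA : 0 ≤ A) (r : Fin n → ℝ) :
    ‖Complex.exp (A * Complex.I * ∑ i, rot rotPar (r i))‖ ≤ ∏ i, Real.exp (-(A / 9) * |r i|) := by
  rw [Complex.norm_exp, ← Real.exp_sum]
  refine Real.exp_le_exp.2 ?_
  have : (A * Complex.I * ∑ i, rot rotPar (r i)).re = -(A * ∑ i, (rot rotPar (r i)).im) := by
    rw [mul_assoc, Complex.re_ofReal_mul, Complex.I_mul_re, Complex.im_sum]; ring
  rw [this, Finset.mul_sum, ← Finset.sum_neg_distrib]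
  refine Finset.sum_le_sum fun i _ => ?_
  have := mul_le_mul_of_nonneg_left (abs_le_rot_im (r i)) hA
  linarith

lemma integrable_rpow_mul_exp_abs {b : ℝ} (hb : 0 < b) :
    Integrable fun x : ℝ => 3 * ((1 + 9 * x ^ 2) * Real.exp (-b * |x|)) := by
  have h1 := integrableOn_rpow_mul_exp_neg_mul_rpow (p := 1) (s := 0) (by norm_num) one_pos hb
  have h2 := integrableOn_rpow_mul_exp_neg_mul_rpow (p := 1) (s := 2) (by norm_num) one_pos hb
  have h3 := integrable_of_comp_abs ((h1.add (h2.const_mul 9)).const_mul 3)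
  refine h3.congr (Filter.Eventually.of_forall fun x => ?_)
  simp only [Pi.add_apply, Real.rpow_zero, Real.rpow_one, Real.rpow_two, sq_abs]
  ring

/-- This makes the majorant a product over coordinates, so that its integrability is a
one-dimensional question. -/
lemma one_add_sum_le_prod {n : ℕ} (f : Fin n → ℝ) (hf : ∀ i, 0 ≤ f i) :
    1 + ∑ i, f i ≤ ∏ i, (1 + f i) := by
  refine Finset.induction_on (Finset.univ : Finset (Fin n)) (by simp) fun a s ha ih => ?_
  rw [Finset.sum_insert ha, Finset.prod_insert ha]
  have : 0 ≤ ∑ i ∈ s, f i := Finset.sum_nonneg fun i _ => hf i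
  nlinarith [hf a, mul_le_mul_of_nonneg_left ih (by linarith [hf a] : 0 ≤ 1 + f a),
    mul_nonneg (hf a) this]

/-- The derivative of exp(-z) is bounded by 1 on the right half-plane, which is convex, so the mean
value inequality applies. -/
lemma norm_exp_neg_sub_le {z w : ℂ} (hz : 0 ≤ z.re) (hw : 0 ≤ w.re) :
    ‖Complex.exp (-z) - Complex.exp (-w)‖ ≤ ‖z - w‖ := by
  have h := (convex_halfSpace_re_ge (0 : ℝ)).norm_image_sub_le_of_norm_deriv_le (𝕜 := ℂ)
    (f := fun z => Complex.exp (-z)) (x := w) (y := z) (C := 1) (fun x _ => by fun_prop)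
    (fun x hx => by
      have : deriv (fun z => Complex.exp (-z)) x = -Complex.exp (-x) := by
        have h : HasDerivAt (fun z => Complex.exp (-z)) (Complex.exp (-x) * -1) x :=
          (Complex.hasDerivAt_exp (-x)).comp x (hasDerivAt_neg x)
        rw [h.deriv, mul_neg_one]
      rw [this, norm_neg, Complex.norm_exp, Complex.neg_re]
      exact Real.exp_le_one_iff.2 (by simpa using hx)) hw hz
  simpa using h

/-- The integrable majorant on the rotated contour. -/
noncomputable def rotMajorant {n : ℕ} (A : ℝ) (r : Fin n → ℝ) : ℝ :=
  ∏ i, 3 * ((1 + 9 * r i ^ 2) * Real.exp (-(A / 9) * |r i|))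

lemma integrable_rotMajorant {n : ℕ} {A : ℝ} (hA : 0 < A) :
    Integrable (rotMajorant (n := n) A) :=
  Integrable.fintype_prod (f := fun _ x => 3 * ((1 + 9 * x ^ 2) * Real.exp (-(A / 9) * |x|)))
    fun _ => integrable_rpow_mul_exp_abs (by positivity)

lemma rotMajorant_ge {n : ℕ} {A : ℝ} (hA : 0 ≤ A) (r : Fin n → ℝ) :
    ‖∏ i, jac rotPar (r i)‖ * (‖Complex.exp (A * Complex.I * ∑ i, rot rotPar (r i))‖ *
      (1 + ‖rotSq rotPar r‖)) ≤ rotMajorant A r := by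
  rw [rotMajorant, Finset.prod_mul_distrib, Finset.prod_mul_distrib]
  have h3 : 1 + ‖rotSq rotPar r‖ ≤ ∏ i, (1 + 9 * r i ^ 2) :=
    (add_le_add_right (norm_rotSq_le rotPar_mem r) 1).trans
      (one_add_sum_le_prod _ fun i => by positivity)
  have h2 := norm_exp_rot_le hA r
  have h1 := norm_prod_jac_le rotPar_mem r
  rw [mul_comm ‖Complex.exp _‖]
  gcongr

/-- On both rays the integrand has the antiderivative exp(i A z)/(i A), which vanishes at infinity;
the two contributions from the corner at 0 cancel. -/
lemma integral_rot_one_dim {A : ℝ} (hA : 0 < A) :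
    ∫ x : ℝ, jac rotPar x * Complex.exp (A * Complex.I * rot rotPar x) = 0 := by
  have hne : rotPar ≠ 0 := ne_zero_of_mem_sector rotPar_mem
  have hAI : (A * Complex.I : ℂ) ≠ 0 := by simp [hA.ne']
  have hre1 : (A * Complex.I * rotPar).re < 0 := by
    simp only [rotPar, Complex.mul_re, Complex.mul_im, Complex.ofReal_re, Complex.ofReal_im,
      Complex.add_im, Complex.one_im, Complex.div_ofNat_im, Complex.I_im, Complex.add_re,
      Complex.one_re, Complex.div_ofNat_re, Complex.I_re]
    linarith
  have hre2 : 0 < (A * Complex.I * rotPar⁻¹).re := by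
    have h := abs_le_rot_im (-1)
    have e : rot rotPar (-1) = -rotPar⁻¹ := by
      simp [rot, show ¬ ((0 : ℝ) ≤ -1) by norm_num]
    rw [e, Complex.neg_im] at h
    rw [mul_assoc, Complex.re_ofReal_mul, Complex.I_mul_re]
    refine mul_pos hA ?_
    rw [abs_neg, abs_one] at h
    linarith
  have e1 : Set.EqOn (fun x : ℝ => jac rotPar x * Complex.exp (A * Complex.I * rot rotPar x))
      (fun x : ℝ => rotPar * Complex.exp (A * Complex.I * rotPar * x)) (Set.Ioi 0) := by
    intro x hx
    simp only [jac, rot, (Set.mem_Ioi.1 hx).le, if_true]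
    ring_nf
  have e2 : Set.EqOn (fun x : ℝ => jac rotPar x * Complex.exp (A * Complex.I * rot rotPar x))
      (fun x : ℝ => rotPar⁻¹ * Complex.exp (A * Complex.I * rotPar⁻¹ * x)) (Set.Iio 0) := by
    intro x hx
    simp only [jac, rot, not_le.2 (Set.mem_Iio.1 hx), if_false]
    ring_nf
  have i1 := (integrableOn_exp_mul_complex_Ioi hre1 0).const_mul rotPar
  have i2 : IntegrableOn (fun x : ℝ => rotPar⁻¹ * Complex.exp (A * Complex.I * rotPar⁻¹ * x))
      (Set.Iio 0) :=
    ((integrableOn_exp_mul_complex_Iic hre2 0).mono_set Set.Iio_subset_Iic_self).const_mul _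
  have j1 := (integrableOn_congr_fun e1 measurableSet_Ioi).2 i1
  have j2 := (integrableOn_congr_fun e2 measurableSet_Iio).2 i2
  have j2' := (integrableOn_Iic_iff_integrableOn_Iio).2 j2
  rw [← intervalIntegral.integral_Iic_add_Ioi j2' j1, integral_Iic_eq_integral_Iio,
    setIntegral_congr_fun measurableSet_Ioi e1, setIntegral_congr_fun measurableSet_Iio e2,
    integral_const_mul, integral_const_mul, ← integral_Iic_eq_integral_Iio,
    integral_exp_mul_complex_Ioi hre1, integral_exp_mul_complex_Iic hre2]
  simp only [Complex.ofReal_zero, mul_zero, Complex.exp_zero]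
  field_simp
  ring

lemma integral_rot_eq_zero {n : ℕ} (hn : 1 ≤ n) {A : ℝ} (hA : 0 < A) :
    ∫ r : Fin n → ℝ, (∏ i, jac rotPar (r i)) *
      Complex.exp (A * Complex.I * ∑ i, rot rotPar (r i)) = 0 := by
  have e : ∀ r : Fin n → ℝ, (∏ i, jac rotPar (r i)) *
      Complex.exp (A * Complex.I * ∑ i, rot rotPar (r i)) =
      ∏ i, (jac rotPar (r i) * Complex.exp (A * Complex.I * rot rotPar (r i))) := by
    intro r
    rw [Finset.prod_mul_distrib, ← Complex.exp_sum, Finset.mul_sum]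
  simp only [e]
  rw [integral_fintype_prod_volume_eq_prod
    (fun (_ : Fin n) (x : ℝ) => jac rotPar x * Complex.exp (A * Complex.I * rot rotPar x))]
  simp only [integral_rot_one_dim hA]
  simp only [Finset.prod_const, Finset.card_univ, Fintype.card_fin]
  exact zero_pow (by omega)

/-! ### The oscillatory integral in the diagonal direction -/

/-- The oscillatory integral of `exp (-κ |r|^{2s})` in the diagonal direction. -/
noncomputable def diagIntegral (n : ℕ) (A s κ : ℝ) : ℂ :=
  ∫ r : Fin n → ℝ, Complex.exp (A * Complex.I * ∑ i, (r i : ℂ)) *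
    (Real.exp (-κ * (∑ i, r i ^ 2) ^ s) : ℂ)

/-- The Gaussian regularization is removed on both sides of the rotation identity by dominated
convergence: on the rotated contour through the exponential decay of the phase, on the real contour
through the assumed integrability of exp(-κ |r|^{2s}). -/
lemma diagIntegral_eq {n : ℕ} {A s κ : ℝ} (hA : 0 < A) (hs0 : 0 < s) (hs1 : s ≤ 1) (hκ : 0 ≤ κ)
    (hint : Integrable fun r : Fin n → ℝ => Real.exp (-κ * (∑ i, r i ^ 2) ^ s)) :
    diagIntegral n A s κ = ∫ r : Fin n → ℝ, rotIntegrand A s κ 0 rotPar r := by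
  set u : ℕ → ℝ := fun k => 1 / ((k : ℝ) + 1) with hu
  have hup : ∀ k, 0 < u k := fun k => by simp only [hu]; positivity
  have hu0 : Filter.Tendsto u Filter.atTop (nhds 0) := tendsto_one_div_add_atTop_nhds_zero_nat
  have huc : Filter.Tendsto (fun k => (u k : ℂ)) Filter.atTop (nhds 0) := by
    exact_mod_cast (Complex.continuous_ofReal.tendsto 0).comp hu0
  have hlim : ∀ (w : ℂ) (r : Fin n → ℝ), Filter.Tendsto (fun k => rotIntegrand A s κ (u k) w r)
      Filter.atTop (nhds (rotIntegrand A s κ 0 w r)) := by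
    intro w r
    unfold rotIntegrand
    refine Filter.Tendsto.const_mul _ (Filter.Tendsto.const_mul _ ?_)
    refine (Complex.continuous_exp.tendsto _).comp ?_
    refine Filter.Tendsto.const_sub _ (Filter.Tendsto.mul_const _ ?_)
    rw [Complex.ofReal_zero]
    exact huc
  have h1 : Filter.Tendsto (fun k => ∫ r : Fin n → ℝ, rotIntegrand A s κ (u k) rotPar r)
      Filter.atTop (nhds (∫ r : Fin n → ℝ, rotIntegrand A s κ 0 rotPar r)) := by
    refine tendsto_integral_of_dominated_convergence (rotMajorant A)
      (fun k => (measurable_rotIntegrand _ _ _ _ _).aestronglyMeasurable)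
      (integrable_rotMajorant hA) (fun k => Filter.Eventually.of_forall fun r => ?_)
      (Filter.Eventually.of_forall fun r => hlim _ r)
    refine le_trans ?_ (rotMajorant_ge hA.le r)
    rw [rotIntegrand, norm_mul, norm_mul]
    gcongr
    refine (norm_exp_rotSq_le hs0.le hs1 hκ (hup k).le rotPar_mem r).trans ?_
    have : Real.exp (-(u k * ((∑ i, r i ^ 2) / 8))) ≤ 1 := by
      rw [Real.exp_le_one_iff]
      have := hup k
      have : 0 ≤ u k * ((∑ i, r i ^ 2) / 8) := by positivity
      linarith
    linarith [norm_nonneg (rotSq rotPar r)]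
  have hone : ∀ (η : ℝ) (r : Fin n → ℝ), rotIntegrand A s κ η 1 r =
      Complex.exp (A * Complex.I * ∑ i, (r i : ℂ)) *
      ((Real.exp (-κ * (∑ i, r i ^ 2) ^ s - η * ∑ i, r i ^ 2) : ℝ) : ℂ) := by
    intro η r
    have e1 : ∀ x : ℝ, rot 1 x = x := fun x => by simp [rot]
    have e2 : ∀ x : ℝ, jac 1 x = 1 := fun x => by simp [jac]
    simp only [rotIntegrand, rotSq, e1, e2, Finset.prod_const_one, one_mul]
    have e3 : (∑ i, (r i : ℂ) ^ 2) = ((∑ i, r i ^ 2 : ℝ) : ℂ) := by push_cast; rfl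
    rw [e3, ← Complex.ofReal_cpow (by positivity)]
    push_cast
    rfl
  have h2 : Filter.Tendsto (fun k => ∫ r : Fin n → ℝ, rotIntegrand A s κ (u k) 1 r)
      Filter.atTop (nhds (∫ r : Fin n → ℝ, rotIntegrand A s κ 0 1 r)) := by
    refine tendsto_integral_of_dominated_convergence _
      (fun k => (measurable_rotIntegrand _ _ _ _ _).aestronglyMeasurable)
      hint (fun k => Filter.Eventually.of_forall fun r => ?_)
      (Filter.Eventually.of_forall fun r => hlim _ r)
    rw [hone, norm_mul, Complex.norm_real, Real.norm_eq_abs, abs_of_pos (Real.exp_pos _)]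
    have : ‖Complex.exp (A * Complex.I * ∑ i, (r i : ℂ))‖ = 1 := by
      rw [← Complex.ofReal_sum, mul_right_comm, ← Complex.ofReal_mul, Complex.norm_exp_ofReal_mul_I]
    rw [this, one_mul]
    refine Real.exp_le_exp.2 ?_
    have := hup k
    have : 0 ≤ u k * (∑ i, r i ^ 2) := by positivity
    linarith
  have h3 : ∀ k, ∫ r : Fin n → ℝ, rotIntegrand A s κ (u k) rotPar r =
      ∫ r : Fin n → ℝ, rotIntegrand A s κ (u k) 1 r := fun k =>
    integral_rotIntegrand_eq hA.le hs0 hs1 hκ (hup k) rotPar_mem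
  simp only [h3] at h1
  rw [← tendsto_nhds_unique h2 h1, diagIntegral]
  refine integral_congr_ae (Filter.Eventually.of_forall fun r => ?_)
  simp only [hone, zero_mul, sub_zero]

/-- The oscillatory integral is Lipschitz in `κ` and tends to zero as `κ → 0`. -/
lemma diagIntegral_lipschitz {n : ℕ} (hn : 1 ≤ n) {A s : ℝ} (hA : 0 < A) (hs0 : 0 < s)
    (hs1 : s ≤ 1)
    (hint : ∀ κ, 0 < κ → Integrable fun r : Fin n → ℝ => Real.exp (-κ * (∑ i, r i ^ 2) ^ s)) :
    ∃ C : ℝ, 0 ≤ C ∧ (∀ κ, 0 < κ → ‖diagIntegral n A s κ‖ ≤ C * κ) ∧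
      ∀ κ κ', 0 < κ → 0 < κ' →
        ‖diagIntegral n A s κ - diagIntegral n A s κ'‖ ≤ C * |κ - κ'| := by
  -- The rotated integral converges absolutely even at κ = 0, where the original one does not;
  -- smallness in κ is the Lipschitz bound together with R 0 = 0.
  set R : ℝ → ℂ := fun κ => ∫ r : Fin n → ℝ, rotIntegrand A s κ 0 rotPar r with hR
  have hi : ∀ κ, 0 ≤ κ → Integrable (fun r : Fin n → ℝ => rotIntegrand A s κ 0 rotPar r) := by
    intro κ hκ
    refine (integrable_rotMajorant hA).mono' (measurable_rotIntegrand _ _ _ _ _).aestronglyMeasurable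
      (Filter.Eventually.of_forall fun r => ?_)
    refine le_trans ?_ (rotMajorant_ge hA.le r)
    rw [rotIntegrand, norm_mul, norm_mul]
    gcongr
    refine (norm_exp_rotSq_le hs0.le hs1 hκ le_rfl rotPar_mem r).trans ?_
    simp
  have hlip : ∀ κ κ', 0 ≤ κ → 0 ≤ κ' →
      ‖R κ - R κ'‖ ≤ (∫ r : Fin n → ℝ, rotMajorant A r) * |κ - κ'| := by
    intro κ κ' hκ hκ'
    rw [hR, ← integral_sub (hi κ hκ) (hi κ' hκ'), ← integral_mul_const]
    refine norm_integral_le_of_norm_le ((integrable_rotMajorant hA).mul_const _)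
      (Filter.Eventually.of_forall fun r => ?_)
    have hz := cpow_re_nonneg (rotSq_re_nonneg rotPar_mem r) hs0.le hs1
    have h1 : ‖Complex.exp (-κ * rotSq rotPar r ^ (s : ℂ) - (0 : ℝ) * rotSq rotPar r) -
        Complex.exp (-κ' * rotSq rotPar r ^ (s : ℂ) - (0 : ℝ) * rotSq rotPar r)‖ ≤
        (1 + ‖rotSq rotPar r‖) * |κ - κ'| := by
      simp only [Complex.ofReal_zero, zero_mul, sub_zero, neg_mul]
      refine (norm_exp_neg_sub_le ?_ ?_).trans ?_
      · rw [Complex.re_ofReal_mul]; positivity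
      · rw [Complex.re_ofReal_mul]; positivity
      · rw [← sub_mul, norm_mul, ← Complex.ofReal_sub, Complex.norm_real, Real.norm_eq_abs, mul_comm]
        gcongr
        -- Since 0 < s ≤ 1, |z|^s ≤ 1 + |z|, which is the factor allowed for in `rotMajorant`.
        rcases eq_or_ne (rotSq rotPar r) 0 with h0 | h0
        · rw [h0, Complex.zero_cpow (by exact_mod_cast hs0.ne')]; simp
        · rw [Complex.norm_cpow_real]
          rcases le_total ‖rotSq rotPar r‖ 1 with h | h
          · have := Real.rpow_le_one (norm_nonneg _) h hs0.le
            linarith [norm_nonneg (rotSq rotPar r)]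
          · have := Real.rpow_le_rpow_of_exponent_le h hs1
            rw [Real.rpow_one] at this
            linarith
    calc ‖rotIntegrand A s κ 0 rotPar r - rotIntegrand A s κ' 0 rotPar r‖
        = ‖∏ i, jac rotPar (r i)‖ * (‖Complex.exp (A * Complex.I * ∑ i, rot rotPar (r i))‖ *
          ‖Complex.exp (-κ * rotSq rotPar r ^ (s : ℂ) - (0 : ℝ) * rotSq rotPar r) -
          Complex.exp (-κ' * rotSq rotPar r ^ (s : ℂ) - (0 : ℝ) * rotSq rotPar r)‖) := by
          rw [rotIntegrand, rotIntegrand, ← mul_sub, ← mul_sub, norm_mul, norm_mul]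
      _ ≤ ‖∏ i, jac rotPar (r i)‖ * (‖Complex.exp (A * Complex.I * ∑ i, rot rotPar (r i))‖ *
          ((1 + ‖rotSq rotPar r‖) * |κ - κ'|)) := by gcongr
      _ = ‖∏ i, jac rotPar (r i)‖ * (‖Complex.exp (A * Complex.I * ∑ i, rot rotPar (r i))‖ *
          (1 + ‖rotSq rotPar r‖)) * |κ - κ'| := by ring
      _ ≤ _ := by gcongr; exact rotMajorant_ge hA.le r
  have hR0 : R 0 = 0 := by
    rw [← integral_rot_eq_zero hn hA]
    simp only [hR]
    refine integral_congr_ae (Filter.Eventually.of_forall fun r => ?_)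
    simp [rotIntegrand]
  have hL : ∀ κ, 0 < κ → diagIntegral n A s κ = R κ := fun κ hκ =>
    diagIntegral_eq hA hs0 hs1 hκ.le (hint κ hκ)
  refine ⟨∫ r : Fin n → ℝ, rotMajorant A r, integral_nonneg fun r => ?_, fun κ hκ => ?_,
    fun κ κ' hκ hκ' => ?_⟩
  · exact Finset.prod_nonneg fun i _ => by positivity
  · have := hlip κ 0 hκ.le le_rfl
    rwa [hR0, sub_zero, sub_zero, abs_of_pos hκ, ← hL κ hκ] at this
  · rw [hL κ hκ, hL κ' hκ']
    exact hlip κ κ' hκ.le hκ'.le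

/-! ### Moments, Fourier formulas and symmetries of the fundamental solution -/

lemma integrable_norm_rpow_mul_exp {n : ℕ} (hn : 1 ≤ n) {s m b : ℝ} (hs0 : 0 < s) (hm : 0 ≤ m)
    (hb : 0 < b) :
    Integrable fun ξ : EuclideanSpace ℝ (Fin n) => ‖ξ‖ ^ m * Real.exp (-b * ‖ξ‖ ^ (2 * s)) := by
  have : Nonempty (Fin n) := ⟨⟨0, hn⟩⟩
  refine (integrable_fun_norm_addHaar volume
    (f := fun y : ℝ => y ^ m * Real.exp (-b * y ^ (2 * s)))).2 ?_
  have h := integrableOn_rpow_mul_exp_neg_mul_rpow (p := 2 * s) (s := (n - 1 : ℕ) + m) (b := b)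
    (by have : (0 : ℝ) ≤ (n - 1 : ℕ) := Nat.cast_nonneg _
        linarith) (by linarith) hb
  refine h.congr_fun (fun y hy => ?_) measurableSet_Ioi
  simp only [finrank_euclideanSpace, Fintype.card_fin, smul_eq_mul]
  rw [Real.rpow_add hy, Real.rpow_natCast, mul_assoc]

lemma integrable_exp_neg_norm_rpow {n : ℕ} (hn : 1 ≤ n) {s b : ℝ} (hs0 : 0 < s) (hb : 0 < b) :
    Integrable fun ξ : EuclideanSpace ℝ (Fin n) => Real.exp (-b * ‖ξ‖ ^ (2 * s)) := by
  simpa using integrable_norm_rpow_mul_exp hn hs0 le_rfl hb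

/-- The moments of `exp (-|ξ|^{2s})`. -/
noncomputable def expMoment (n : ℕ) (s m : ℝ) : ℝ :=
  ∫ ξ : EuclideanSpace ℝ (Fin n), ‖ξ‖ ^ m * Real.exp (-‖ξ‖ ^ (2 * s))

lemma expMoment_nonneg (n : ℕ) (s m : ℝ) : 0 ≤ expMoment n s m :=
  integral_nonneg fun ξ => by positivity

/-- Dilating the frequency by b^{1/(2s)} normalizes the exponential. With b a multiple of t, every
factor |ξ|^m in a Fourier integral costs t^{-m/(2s)}. -/
lemma integral_norm_rpow_mul_exp {n : ℕ} {s m b : ℝ} (hs0 : 0 < s) (hb : 0 < b) :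
    ∫ ξ : EuclideanSpace ℝ (Fin n), ‖ξ‖ ^ m * Real.exp (-b * ‖ξ‖ ^ (2 * s)) =
      b ^ (-((n + m) / (2 * s))) * expMoment n s m := by
  set R : ℝ := b ^ (1 / (2 * s)) with hR
  have hRp : 0 < R := Real.rpow_pos_of_pos hb _
  have hRs : R ^ (2 * s) = b := by
    rw [hR, ← Real.rpow_mul hb.le, one_div_mul_cancel (by positivity), Real.rpow_one]
  have h := Measure.integral_comp_smul (volume : Measure (EuclideanSpace ℝ (Fin n)))
    (fun ξ => ‖ξ‖ ^ m * Real.exp (-‖ξ‖ ^ (2 * s))) R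
  have e : ∀ ξ : EuclideanSpace ℝ (Fin n), ‖R • ξ‖ ^ m * Real.exp (-‖R • ξ‖ ^ (2 * s)) =
      R ^ m * (‖ξ‖ ^ m * Real.exp (-b * ‖ξ‖ ^ (2 * s))) := by
    intro ξ
    rw [norm_smul, Real.norm_eq_abs, abs_of_pos hRp, Real.mul_rpow hRp.le (norm_nonneg _),
      Real.mul_rpow hRp.le (norm_nonneg _), hRs]
    ring_nf
  simp only [e, integral_const_mul] at h
  rw [finrank_euclideanSpace, Fintype.card_fin, abs_of_pos (by positivity), smul_eq_mul] at h
  have h2 : R ^ m ≠ 0 := (Real.rpow_pos_of_pos hRp _).ne'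
  have h3 : b ^ (-((n + m) / (2 * s))) = (R ^ m)⁻¹ * (R ^ n)⁻¹ := by
    rw [← Real.rpow_natCast, ← Real.rpow_neg hRp.le, ← Real.rpow_neg hRp.le, ← Real.rpow_add hRp, hR,
      ← Real.rpow_mul hb.le]
    congr 1
    field_simp
    ring
  rw [h3, mul_assoc, expMoment, ← h, ← mul_assoc, inv_mul_cancel₀ h2, one_mul]

lemma fundSol_of_nonpos {n : ℕ} (s : ℝ) (x : EuclideanSpace ℝ (Fin n)) {t : ℝ} (ht : t ≤ 0) :
    fundSol s (x, t) = 0 := by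
  simp [fundSol, not_lt.2 ht]

lemma fundSol_eq_re {n : ℕ} (s : ℝ) (x : EuclideanSpace ℝ (Fin n)) {t : ℝ} (ht : 0 < t) :
    fundSol s (x, t) = (∫ ξ : EuclideanSpace ℝ (Fin n),
      Complex.exp (↑(2 * Real.pi * inner ℝ ξ x) * Complex.I) *
        (Real.exp (-(4 * Real.pi ^ 2 * t) * ‖ξ‖ ^ (2 * s)) : ℂ)).re := by
  simp only [fundSol, ht, if_true, Real.fourierInv_eq', smul_eq_mul]
  congr 3
  ext ξ
  push_cast
  ring_nf

lemma fundSol_eq_integral_cos {n : ℕ} (hn : 1 ≤ n) {s : ℝ} (hs0 : 0 < s)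
    (x : EuclideanSpace ℝ (Fin n)) {t : ℝ} (ht : 0 < t) :
    fundSol s (x, t) = ∫ ξ : EuclideanSpace ℝ (Fin n),
      Real.cos (2 * Real.pi * inner ℝ ξ x) *
        Real.exp (-(4 * Real.pi ^ 2 * t) * ‖ξ‖ ^ (2 * s)) := by
  rw [fundSol_eq_re s x ht]
  have hi : Integrable fun ξ : EuclideanSpace ℝ (Fin n) =>
      Complex.exp (↑(2 * Real.pi * inner ℝ ξ x) * Complex.I) *
        (Real.exp (-(4 * Real.pi ^ 2 * t) * ‖ξ‖ ^ (2 * s)) : ℂ) := by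
    refine (integrable_exp_neg_norm_rpow hn hs0 (b := 4 * Real.pi ^ 2 * t) (by positivity)).mono'
      (Measurable.aestronglyMeasurable (by fun_prop)) (Filter.Eventually.of_forall fun ξ => ?_)
    rw [norm_mul, Complex.norm_exp_ofReal_mul_I, one_mul, Complex.norm_real, Real.norm_eq_abs,
      abs_of_pos (Real.exp_pos _)]
  rw [← Complex.reCLM_apply, ← Complex.reCLM.integral_comp_comm hi]
  refine integral_congr_ae (Filter.Eventually.of_forall fun ξ => ?_)
  simp only [Complex.reCLM_apply]
  rw [mul_comm, Complex.re_ofReal_mul, Complex.exp_ofReal_mul_I_re, mul_comm]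

lemma integrable_cos_mul_exp {n : ℕ} (hn : 1 ≤ n) {s : ℝ} (hs0 : 0 < s)
    (x : EuclideanSpace ℝ (Fin n)) {t : ℝ} (ht : 0 < t) :
    Integrable fun ξ : EuclideanSpace ℝ (Fin n) => Real.cos (2 * Real.pi * inner ℝ ξ x) *
        Real.exp (-(4 * Real.pi ^ 2 * t) * ‖ξ‖ ^ (2 * s)) := by
  refine (integrable_exp_neg_norm_rpow hn hs0 (b := 4 * Real.pi ^ 2 * t) (by positivity)).mono'
    (Measurable.aestronglyMeasurable (by fun_prop)) (Filter.Eventually.of_forall fun ξ => ?_)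
  rw [norm_mul, Real.norm_eq_abs, Real.norm_eq_abs, abs_of_pos (Real.exp_pos _)]
  exact mul_le_of_le_one_left (Real.exp_pos _).le (Real.abs_cos_le_one _)

lemma fundSol_smul {n : ℕ} (s : ℝ) {l : ℝ} (hl : 0 < l)
    (x : EuclideanSpace ℝ (Fin n)) (t : ℝ) :
    fundSol s (l • x, l ^ (2 * s) * t) = l ^ (-(n : ℝ)) * fundSol s (x, t) := by
  rcases le_or_gt t 0 with ht | ht
  · rw [fundSol_of_nonpos s x ht, fundSol_of_nonpos, mul_zero]
    exact mul_nonpos_of_nonneg_of_nonpos (Real.rpow_nonneg hl.le _) ht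
  · have hl2 : 0 < l ^ (2 * s) := Real.rpow_pos_of_pos hl _
    rw [fundSol_eq_re s x ht, fundSol_eq_re s _ (mul_pos hl2 ht)]
    have h := Measure.integral_comp_smul (volume : Measure (EuclideanSpace ℝ (Fin n)))
      (fun ξ => Complex.exp (↑(2 * Real.pi * inner ℝ ξ x) * Complex.I) *
        (Real.exp (-(4 * Real.pi ^ 2 * t) * ‖ξ‖ ^ (2 * s)) : ℂ)) l
    rw [finrank_euclideanSpace, Fintype.card_fin, abs_of_pos (by positivity),
      ← Real.rpow_natCast l n, ← Real.rpow_neg hl.le] at h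
    rw [← Complex.re_ofReal_mul, ← Complex.real_smul, ← h]
    congr 2
    ext ξ
    rw [norm_smul, Real.norm_eq_abs, abs_of_pos hl, Real.mul_rpow hl.le (norm_nonneg _),
      real_inner_smul_left, real_inner_smul_right]
    ring_nf

/-- The reflection in the hyperplane orthogonal to x - y exchanges the two points and preserves both
the symbol and Lebesgue measure. -/
lemma fundSol_eq_of_norm_eq {n : ℕ} (s : ℝ) {x y : EuclideanSpace ℝ (Fin n)} (h : ‖x‖ = ‖y‖)
    (t : ℝ) : fundSol s (x, t) = fundSol s (y, t) := by
  rcases le_or_gt t 0 with ht | ht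
  · rw [fundSol_of_nonpos s x ht, fundSol_of_nonpos s y ht]
  · set U := (Submodule.span ℝ {x - y})ᗮ.reflection with hU
    have hUx : U x = y := Submodule.reflection_sub h
    symm
    rw [fundSol_eq_re s x ht, fundSol_eq_re s y ht,
      ← U.measurePreserving.integral_comp U.toHomeomorph.measurableEmbedding]
    congr 2
    ext ξ
    have e1 : inner ℝ (U ξ) y = inner ℝ ξ x := by rw [← hUx, LinearIsometryEquiv.inner_map_map]
    rw [e1, LinearIsometryEquiv.norm_map]

lemma diagIntegral_eq_integral {n : ℕ} (s a κ : ℝ) :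
    diagIntegral n (2 * Real.pi * a) s κ = ∫ ξ : EuclideanSpace ℝ (Fin n),
      Complex.exp (↑(2 * Real.pi * inner ℝ ξ (WithLp.toLp 2 fun _ : Fin n => a)) * Complex.I) *
        (Real.exp (-κ * ‖ξ‖ ^ (2 * s)) : ℂ) := by
  have hmp := PiLp.volume_preserving_toLp (Fin n)
  rw [← hmp.integral_comp (MeasurableEquiv.toLp 2 (Fin n → ℝ)).measurableEmbedding, diagIntegral]
  refine integral_congr_ae (Filter.Eventually.of_forall fun r => ?_)
  have h1 : ‖(WithLp.toLp 2 r : EuclideanSpace ℝ (Fin n))‖ ^ (2 * s) = (∑ i, r i ^ 2) ^ s := by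
    rw [EuclideanSpace.norm_eq, Real.sqrt_eq_rpow, ← Real.rpow_mul (by positivity)]
    simp only [Real.norm_eq_abs, sq_abs]
    congr 1; ring
  have h2 : inner ℝ (WithLp.toLp 2 r : EuclideanSpace ℝ (Fin n)) (WithLp.toLp 2 fun _ => a) =
      a * ∑ i, r i := by
    simp [PiLp.inner_apply, Finset.mul_sum]
  simp only [h1, h2]
  congr 2
  push_cast
  ring

lemma integrable_exp_neg_sum_sq {n : ℕ} (hn : 1 ≤ n) {s κ : ℝ} (hs0 : 0 < s) (hκ : 0 < κ) :
    Integrable fun r : Fin n → ℝ => Real.exp (-κ * (∑ i, r i ^ 2) ^ s) := by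
  have h := (PiLp.volume_preserving_toLp (Fin n)).integrable_comp_of_integrable
    (integrable_exp_neg_norm_rpow hn hs0 hκ)
  refine h.congr (Filter.Eventually.of_forall fun r => ?_)
  have h1 : ‖(WithLp.toLp 2 r : EuclideanSpace ℝ (Fin n))‖ ^ (2 * s) = (∑ i, r i ^ 2) ^ s := by
    rw [EuclideanSpace.norm_eq, Real.sqrt_eq_rpow, ← Real.rpow_mul (by positivity)]
    simp only [Real.norm_eq_abs, sq_abs]
    congr 1; ring
  simp only [Function.comp, h1]

/-! ### Lipschitz continuity in time across t = 0 -/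

/-- Away from the time axis the fundamental solution is Lipschitz in time, up to `t = 0`. -/
lemma fundSol_lipschitz_time {n : ℕ} (hn : 1 ≤ n) {s : ℝ} (hs0 : 0 < s) (hs1 : s ≤ 1) :
    ∃ C : ℝ, 0 < C ∧ ∀ (x : EuclideanSpace ℝ (Fin n)) (t t' : ℝ), x ≠ 0 →
      |fundSol s (x, t) - fundSol s (x, t')| ≤ C * ‖x‖ ^ (-(n + 2 * s)) * |t - t'| := by
  set a : ℝ := (Real.sqrt n)⁻¹ with ha
  have hn0 : (0 : ℝ) < n := by exact_mod_cast hn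
  have hap : 0 < a := by positivity
  -- By radial symmetry and scaling a single unit vector suffices. The diagonal one gives all
  -- coordinates the same positive frequency, so that they can all be rotated with one parameter.
  set e : EuclideanSpace ℝ (Fin n) := WithLp.toLp 2 fun _ : Fin n => a with he
  have hnorm : ‖e‖ = 1 := by
    rw [EuclideanSpace.norm_eq]
    simp only [he, Real.norm_eq_abs, sq_abs, Finset.sum_const, Finset.card_univ, Fintype.card_fin,
      nsmul_eq_mul]
    rw [ha, inv_pow, Real.sq_sqrt hn0.le, mul_inv_cancel₀ hn0.ne', Real.sqrt_one]
  obtain ⟨C, hC0, hC1, hC2⟩ := diagIntegral_lipschitz hn (A := 2 * Real.pi * a) (by positivity) hs0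
    hs1 (fun κ hκ => integrable_exp_neg_sum_sq hn hs0 hκ)
  have hrep : ∀ t, 0 < t → fundSol s (e, t) =
      (diagIntegral n (2 * Real.pi * a) s (4 * Real.pi ^ 2 * t)).re := by
    intro t ht
    rw [fundSol_eq_re s e ht, diagIntegral_eq_integral]
  set K : ℝ := C * (4 * Real.pi ^ 2) + 1 with hK
  have hKp : 0 < K := by positivity
  have hCK : ∀ d : ℝ, 0 ≤ d → C * (4 * Real.pi ^ 2 * d) ≤ K * d := fun d hd => by
    rw [hK]; nlinarith
  have h0 : ∀ t, 0 < t → |fundSol s (e, t)| ≤ K * t := by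
    intro t ht
    rw [hrep t ht]
    exact (Complex.abs_re_le_norm _).trans ((hC1 _ (by positivity)).trans (hCK t ht.le))
  have hunit : ∀ t t', |fundSol s (e, t) - fundSol s (e, t')| ≤ K * |t - t'| := by
    intro t t'
    -- When the two times have opposite signs, the linear vanishing at t = 0⁺ is what gives the
    -- Lipschitz bound.
    rcases le_or_gt t 0 with ht | ht <;> rcases le_or_gt t' 0 with ht' | ht'
    · rw [fundSol_of_nonpos s e ht, fundSol_of_nonpos s e ht', sub_self, abs_zero]; positivity
    · rw [fundSol_of_nonpos s e ht, zero_sub, abs_neg, abs_sub_comm t,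
        abs_of_pos (by linarith : 0 < t' - t)]
      exact (h0 t' ht').trans (by gcongr; linarith)
    · rw [fundSol_of_nonpos s e ht', sub_zero, abs_of_pos (by linarith : 0 < t - t')]
      exact (h0 t ht).trans (by gcongr; linarith)
    · rw [hrep t ht, hrep t' ht', ← Complex.sub_re]
      refine (Complex.abs_re_le_norm _).trans ((hC2 _ _ (by positivity) (by positivity)).trans ?_)
      rw [← mul_sub, abs_mul, abs_of_pos (by positivity : 0 < 4 * Real.pi ^ 2)]
      exact hCK _ (abs_nonneg _)
  refine ⟨K, hKp, fun x t t' hx => ?_⟩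
  set l := ‖x‖ with hl
  have hlp : 0 < l := norm_pos_iff.2 hx
  have hsc : ∀ t, fundSol s (x, t) = l ^ (-(n : ℝ)) * fundSol s (e, l ^ (-(2 * s)) * t) := by
    intro t
    rw [← fundSol_smul s hlp, ← mul_assoc, ← Real.rpow_add hlp]
    simp only [add_neg_cancel, Real.rpow_zero, one_mul]
    apply fundSol_eq_of_norm_eq
    rw [norm_smul, hnorm, mul_one, Real.norm_eq_abs, abs_of_pos hlp]
  rw [hsc, hsc, ← mul_sub, abs_mul, abs_of_pos (Real.rpow_pos_of_pos hlp _)]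
  calc l ^ (-(n : ℝ)) * |fundSol s (e, l ^ (-(2 * s)) * t) - fundSol s (e, l ^ (-(2 * s)) * t')|
      ≤ l ^ (-(n : ℝ)) * (K * |l ^ (-(2 * s)) * t - l ^ (-(2 * s)) * t'|) := by
        gcongr; exact hunit _ _
    _ = K * l ^ (-(n + 2 * s)) * |t - t'| := by
      rw [← mul_sub, abs_mul, abs_of_pos (Real.rpow_pos_of_pos hlp _), neg_add,
        Real.rpow_add hlp]
      ring

/-! ### Estimates of the fundamental solution on the Fourier side -/

lemma abs_cos_sub_cos_le (a b : ℝ) : |Real.cos a - Real.cos b| ≤ |a ^ 2 - b ^ 2| / 2 := by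
  rw [Real.cos_sub_cos, abs_mul, abs_mul, abs_neg, abs_two]
  have h1 := Real.abs_sin_le_abs (x := (a + b) / 2)
  have h2 := Real.abs_sin_le_abs (x := (a - b) / 2)
  calc 2 * |Real.sin ((a + b) / 2)| * |Real.sin ((a - b) / 2)|
      ≤ 2 * |(a + b) / 2| * |(a - b) / 2| := by gcongr
    _ = |a ^ 2 - b ^ 2| / 2 := by
      rw [show a ^ 2 - b ^ 2 = 4 * (((a + b) / 2) * ((a - b) / 2)) by ring, abs_mul, abs_mul]
      norm_num
      ring

lemma abs_exp_neg_mul_sub_le {κ t t' : ℝ} (hκ : 0 ≤ κ) (h : t ≤ t') :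
    |Real.exp (-(κ * t)) - Real.exp (-(κ * t'))| ≤ κ * |t - t'| * Real.exp (-(κ * t)) := by
  have e : Real.exp (-(κ * t)) - Real.exp (-(κ * t')) =
      Real.exp (-(κ * t)) * (1 - Real.exp (-(κ * (t' - t)))) := by
    rw [mul_sub, ← Real.exp_add]; ring_nf
  have h1 : 0 ≤ κ * (t' - t) := mul_nonneg hκ (by linarith)
  have h2 := Real.add_one_le_exp (-(κ * (t' - t)))
  have h3 : Real.exp (-(κ * (t' - t))) ≤ 1 := Real.exp_le_one_iff.2 (by linarith)
  rw [e, abs_mul, abs_of_pos (Real.exp_pos _), abs_of_nonneg (by linarith : 0 ≤ 1 - Real.exp (-(κ * (t' - t)))),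
    abs_sub_comm, abs_of_nonneg (by linarith : 0 ≤ t' - t), mul_comm]
  gcongr
  linarith

lemma fundSol_abs_le {n : ℕ} (hn : 1 ≤ n) {s : ℝ} (hs0 : 0 < s) :
    ∃ C : ℝ, 0 < C ∧ ∀ (x : EuclideanSpace ℝ (Fin n)) (t : ℝ), 0 < t →
      |fundSol s (x, t)| ≤ C * t ^ (-(n / (2 * s))) := by
  refine ⟨(4 * Real.pi ^ 2) ^ (-(n / (2 * s))) * expMoment n s 0 + 1, by
    have := expMoment_nonneg n s 0; positivity, fun x t ht => ?_⟩
  rw [fundSol_eq_integral_cos hn hs0 x ht]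
  have hb : (0 : ℝ) < 4 * Real.pi ^ 2 * t := by positivity
  have h := norm_integral_le_of_norm_le
    (f := fun ξ : EuclideanSpace ℝ (Fin n) => Real.cos (2 * Real.pi * inner ℝ ξ x) *
      Real.exp (-(4 * Real.pi ^ 2 * t) * ‖ξ‖ ^ (2 * s)))
    (integrable_norm_rpow_mul_exp hn hs0 le_rfl hb) (Filter.Eventually.of_forall fun ξ => by
      rw [norm_mul, Real.norm_eq_abs, Real.norm_eq_abs, abs_of_pos (Real.exp_pos _), Real.rpow_zero]
      exact mul_le_mul_of_nonneg_right (Real.abs_cos_le_one _) (Real.exp_pos _).le)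
  rw [integral_norm_rpow_mul_exp hs0 hb, add_zero, Real.mul_rpow (by positivity) ht.le] at h
  refine h.trans ?_
  have : 0 ≤ t ^ (-(n / (2 * s))) := by positivity
  linarith

lemma fundSol_sub_time_le {n : ℕ} (hn : 1 ≤ n) {s : ℝ} (hs0 : 0 < s) :
    ∃ C : ℝ, 0 < C ∧ ∀ (x : EuclideanSpace ℝ (Fin n)) (t t' : ℝ), 0 < t → t ≤ t' →
      |fundSol s (x, t) - fundSol s (x, t')| ≤ C * t ^ (-(n / (2 * s) + 1)) * |t - t'| := by
  refine ⟨4 * Real.pi ^ 2 * ((4 * Real.pi ^ 2) ^ (-(n / (2 * s) + 1)) * expMoment n s (2 * s)) + 1,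
    by have := expMoment_nonneg n s (2 * s); positivity, fun x t t' ht htt => ?_⟩
  have ht' : 0 < t' := ht.trans_le htt
  rw [fundSol_eq_integral_cos hn hs0 x ht, fundSol_eq_integral_cos hn hs0 x ht',
    ← integral_sub (integrable_cos_mul_exp hn hs0 x ht) (integrable_cos_mul_exp hn hs0 x ht')]
  have hb : (0 : ℝ) < 4 * Real.pi ^ 2 * t := by positivity
  have h := norm_integral_le_of_norm_le
    (f := fun ξ : EuclideanSpace ℝ (Fin n) => Real.cos (2 * Real.pi * inner ℝ ξ x) *
      Real.exp (-(4 * Real.pi ^ 2 * t) * ‖ξ‖ ^ (2 * s)) - Real.cos (2 * Real.pi * inner ℝ ξ x) *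
      Real.exp (-(4 * Real.pi ^ 2 * t') * ‖ξ‖ ^ (2 * s)))
    ((integrable_norm_rpow_mul_exp hn hs0 (by linarith : 0 ≤ 2 * s) hb).const_mul
      (4 * Real.pi ^ 2 * |t - t'|)) (Filter.Eventually.of_forall fun ξ => by
      rw [← mul_sub, norm_mul, Real.norm_eq_abs, Real.norm_eq_abs]
      refine (mul_le_of_le_one_left (abs_nonneg _) (Real.abs_cos_le_one _)).trans ?_
      have := abs_exp_neg_mul_sub_le (κ := 4 * Real.pi ^ 2 * ‖ξ‖ ^ (2 * s)) (by positivity) htt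
      rw [show -(4 * Real.pi ^ 2 * t) * ‖ξ‖ ^ (2 * s) = -(4 * Real.pi ^ 2 * ‖ξ‖ ^ (2 * s) * t) by ring,
        show -(4 * Real.pi ^ 2 * t') * ‖ξ‖ ^ (2 * s) = -(4 * Real.pi ^ 2 * ‖ξ‖ ^ (2 * s) * t') by ring]
      refine this.trans (le_of_eq (by ring)))
  rw [integral_const_mul, integral_norm_rpow_mul_exp hs0 hb,
    show ((n : ℝ) + 2 * s) / (2 * s) = n / (2 * s) + 1 by field_simp,
    Real.mul_rpow (by positivity) ht.le] at h
  refine h.trans ?_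
  have : 0 ≤ t ^ (-(n / (2 * s) + 1)) * |t - t'| := by positivity
  nlinarith

/-- The symbol of a difference of two translates of the fundamental solution. -/
lemma abs_symbol_sub_le {κ a a' h : ℝ} (hκ : 0 ≤ κ) (hh : |h| ≤ 1) :
    |Real.cos a - Real.cos a' * Real.exp (-(κ * h))| ≤
      (|a ^ 2 - a' ^ 2| / 2 + κ * |h|) * Real.exp κ := by
  have h1 : |1 - Real.exp (-(κ * h))| ≤ κ * |h| * Real.exp κ := by
    rw [abs_le] at hh
    rcases le_total 0 h with h0 | h0
    · have := abs_exp_neg_mul_sub_le hκ h0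
      simp only [mul_zero, neg_zero, Real.exp_zero, zero_sub, abs_neg, mul_one] at this
      refine this.trans (le_mul_of_one_le_right (by positivity) (Real.one_le_exp hκ))
    · have := abs_exp_neg_mul_sub_le hκ h0
      simp only [mul_zero, neg_zero, Real.exp_zero, sub_zero] at this
      rw [abs_sub_comm]
      refine this.trans ?_
      gcongr
      nlinarith
  have h2 := abs_cos_sub_cos_le a a'
  have e : Real.cos a - Real.cos a' * Real.exp (-(κ * h)) =
      (Real.cos a - Real.cos a') + Real.cos a' * (1 - Real.exp (-(κ * h))) := by ring
  rw [e]
  refine (abs_add_le _ _).trans ?_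
  rw [abs_mul, add_mul]
  refine add_le_add (h2.trans (le_mul_of_one_le_right (by positivity) (Real.one_le_exp hκ))) ?_
  exact (mul_le_of_le_one_left (abs_nonneg _) (Real.abs_cos_le_one _)).trans h1

/-- Regularity for large times of a difference of two translates of the fundamental solution. -/
lemma fundSol_sub_translate_le {n : ℕ} (hn : 1 ≤ n) {s : ℝ} (hs0 : 0 < s) (hs1 : s ≤ 1) {R : ℝ}
    (hR : 0 ≤ R) :
    ∃ C : ℝ, 0 < C ∧ ∀ (x x' : EuclideanSpace ℝ (Fin n)) (h : ℝ), ‖x‖ ≤ R → ‖x'‖ ≤ R → |h| ≤ 1 →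
      (∀ τ, 2 ≤ τ → |fundSol s (x, τ) - fundSol s (x', τ + h)| ≤ C * (‖x - x'‖ + |h|) * τ⁻¹) ∧
      ∀ τ τ', 2 ≤ τ → τ ≤ τ' → |(fundSol s (x, τ) - fundSol s (x', τ + h)) -
        (fundSol s (x, τ') - fundSol s (x', τ' + h))| ≤
          C * (‖x - x'‖ + |h|) * (τ ^ 2)⁻¹ * |τ - τ'| := by
  obtain ⟨p, hp⟩ : ∃ p : ℝ, p = 4 * Real.pi ^ 2 := ⟨_, rfl⟩
  have hpp : 0 < p := by rw [hp]; positivity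
  set E : EuclideanSpace ℝ (Fin n) → ℝ → ℝ := fun ξ τ => Real.exp (-(p / 2 * τ) * ‖ξ‖ ^ (2 * s))
  have hn1 : (1 : ℝ) ≤ n := by exact_mod_cast hn
  -- The true decay exponent is (n + m)/(2s); as τ ≥ 1, any smaller exponent `k` may be used. Only k
  -- = 1 and k = 2 are needed.
  have hmom : ∀ m k : ℝ, 0 ≤ k → k * (2 * s) ≤ n + m → ∀ τ : ℝ, 2 ≤ τ →
      ∫ ξ : EuclideanSpace ℝ (Fin n), ‖ξ‖ ^ m * E ξ τ ≤
      (p / 2) ^ (-((n + m) / (2 * s))) * expMoment n s m * τ ^ (-k) := by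
    intro m k hk hkm τ hτ
    rw [integral_norm_rpow_mul_exp hs0 (by positivity), Real.mul_rpow (by positivity) (by linarith),
      mul_right_comm]
    have := expMoment_nonneg n s m
    gcongr
    · linarith
    · rwa [le_div_iff₀ (by linarith)]
  set M : ℝ → ℝ := fun m => (p / 2) ^ (-((n + m) / (2 * s))) * expMoment n s m with hM
  have hMp : ∀ m, 0 ≤ M m := fun m => mul_nonneg (by positivity) (expMoment_nonneg _ _ _)
  obtain ⟨K, hK⟩ : ∃ K : ℝ, K = p * R + p := ⟨_, rfl⟩
  have hKp : 0 < K := by rw [hK]; positivity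
  set C : ℝ := K * (M 2 + M (2 * s)) + K * p * (M (2 + 2 * s) + M (4 * s)) + 1 with hC
  have hCp : 0 < C := by
    have := hMp 2; have := hMp (2 * s); have := hMp (2 + 2 * s); have := hMp (4 * s)
    positivity
  refine ⟨C, hCp, fun x x' h hx hx' hh => ?_⟩
  set d : ℝ := ‖x - x'‖ + |h| with hd
  have hd0 : 0 ≤ d := by positivity
  -- The symbol of the difference is `B ξ` times the decaying exponential at time τ, so that `B`
  -- carries all the smallness and does not depend on τ.
  set B : EuclideanSpace ℝ (Fin n) → ℝ := fun ξ => Real.cos (2 * Real.pi * inner ℝ ξ x) -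
    Real.cos (2 * Real.pi * inner ℝ ξ x') * Real.exp (-(p * ‖ξ‖ ^ (2 * s) * h)) with hB
  have hBle : ∀ ξ, |B ξ| ≤ K * d * (‖ξ‖ ^ (2 : ℝ) + ‖ξ‖ ^ (2 * s)) *
      Real.exp (p * ‖ξ‖ ^ (2 * s)) := by
    intro ξ
    refine (abs_symbol_sub_le (κ := p * ‖ξ‖ ^ (2 * s)) (by positivity) hh).trans ?_
    gcongr
    have h1 : |(2 * Real.pi * inner ℝ ξ x) ^ 2 - (2 * Real.pi * inner ℝ ξ x') ^ 2| / 2 ≤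
        p * R * ‖x - x'‖ * ‖ξ‖ ^ (2 : ℝ) := by
      have e : (2 * Real.pi * inner ℝ ξ x) ^ 2 - (2 * Real.pi * inner ℝ ξ x') ^ 2 =
          p * (inner ℝ ξ (x - x') * inner ℝ ξ (x + x')) := by
        rw [inner_sub_right, inner_add_right, hp]; ring
      have h2 : ‖x + x'‖ ≤ 2 * R := (norm_add_le _ _).trans (by linarith)
      rw [e, abs_mul, abs_mul, abs_of_pos hpp, Real.rpow_two]
      calc p * (|inner ℝ ξ (x - x')| * |inner ℝ ξ (x + x')|) / 2
          ≤ p * ((‖ξ‖ * ‖x - x'‖) * (‖ξ‖ * (2 * R))) / 2 := by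
            gcongr
            · exact abs_real_inner_le_norm _ _
            · exact (abs_real_inner_le_norm _ _).trans (by gcongr)
        _ = p * R * ‖x - x'‖ * ‖ξ‖ ^ 2 := by ring
    have ha : ‖x - x'‖ ≤ d := by rw [hd]; linarith [abs_nonneg h]
    have hb : |h| ≤ d := by rw [hd]; linarith [norm_nonneg (x - x')]
    have h3 : p * R * ‖x - x'‖ * ‖ξ‖ ^ (2 : ℝ) ≤ K * d * ‖ξ‖ ^ (2 : ℝ) := by
      gcongr; rw [hK]; linarith
    have h4 : p * ‖ξ‖ ^ (2 * s) * |h| ≤ K * d * ‖ξ‖ ^ (2 * s) := by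
      rw [mul_right_comm]
      gcongr; rw [hK]; nlinarith
    rw [mul_add]
    linarith
  -- A backward time shift costs a factor exp κ, with κ = p |ξ|^{2s}. For τ ≥ 2 half of the decay
  -- exp(-κτ) pays for it, which explains the `p / 2` in `E`.
  have hexp : ∀ ξ : EuclideanSpace ℝ (Fin n), ∀ τ, 2 ≤ τ →
      Real.exp (p * ‖ξ‖ ^ (2 * s)) * Real.exp (-(p * ‖ξ‖ ^ (2 * s) * τ)) ≤ E ξ τ := by
    intro ξ τ hτ
    rw [← Real.exp_add]
    refine Real.exp_le_exp.2 ?_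
    have : 0 ≤ p * ‖ξ‖ ^ (2 * s) := by positivity
    nlinarith
  have hrep : ∀ τ, 2 ≤ τ → fundSol s (x, τ) - fundSol s (x', τ + h) =
      ∫ ξ, B ξ * Real.exp (-(p * ‖ξ‖ ^ (2 * s) * τ)) := by
    intro τ hτ
    have hτ0 : 0 < τ := by linarith
    have hτh : 0 < τ + h := by linarith [(abs_le.1 hh).1]
    rw [fundSol_eq_integral_cos hn hs0 x hτ0, fundSol_eq_integral_cos hn hs0 x' hτh,
      ← integral_sub (integrable_cos_mul_exp hn hs0 x hτ0) (integrable_cos_mul_exp hn hs0 x' hτh)]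
    refine integral_congr_ae (Filter.Eventually.of_forall fun ξ => ?_)
    simp only [hB]
    rw [sub_mul, mul_assoc (Real.cos _), ← Real.exp_add, hp]
    ring_nf
  have hint : ∀ τ, 2 ≤ τ → Integrable fun ξ => B ξ * Real.exp (-(p * ‖ξ‖ ^ (2 * s) * τ)) := by
    intro τ hτ
    have hτ0 : 0 < τ := by linarith
    have hτh : 0 < τ + h := by linarith [(abs_le.1 hh).1]
    refine ((integrable_cos_mul_exp hn hs0 x hτ0).sub
      (integrable_cos_mul_exp hn hs0 x' hτh)).congr (Filter.Eventually.of_forall fun ξ => ?_)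
    simp only [hB, Pi.sub_apply]
    rw [sub_mul, mul_assoc (Real.cos _), ← Real.exp_add, hp]
    ring_nf
  have iE : ∀ m τ : ℝ, 0 ≤ m → 2 ≤ τ → Integrable fun ξ : EuclideanSpace ℝ (Fin n) =>
      ‖ξ‖ ^ m * E ξ τ := fun m τ hm hτ =>
    integrable_norm_rpow_mul_exp hn hs0 hm (by positivity)
  refine ⟨fun τ hτ => ?_, fun τ τ' hτ hττ => ?_⟩
  · rw [hrep τ hτ]
    have hle := norm_integral_le_of_norm_le
      (((iE 2 τ (by norm_num) hτ).add (iE (2 * s) τ (by linarith) hτ)).const_mul (K * d))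
      (f := fun ξ => B ξ * Real.exp (-(p * ‖ξ‖ ^ (2 * s) * τ)))
      (Filter.Eventually.of_forall fun ξ => by
        rw [norm_mul, Real.norm_eq_abs, Real.norm_eq_abs, abs_of_pos (Real.exp_pos _)]
        calc |B ξ| * Real.exp (-(p * ‖ξ‖ ^ (2 * s) * τ))
            ≤ K * d * (‖ξ‖ ^ (2 : ℝ) + ‖ξ‖ ^ (2 * s)) * Real.exp (p * ‖ξ‖ ^ (2 * s)) *
              Real.exp (-(p * ‖ξ‖ ^ (2 * s) * τ)) := by gcongr; exact hBle ξ
          _ ≤ K * d * (‖ξ‖ ^ (2 : ℝ) + ‖ξ‖ ^ (2 * s)) * E ξ τ := by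
            rw [mul_assoc _ (Real.exp _)]; gcongr; exact hexp ξ τ hτ
          _ = _ := by simp only [Pi.add_apply]; ring)
    refine hle.trans ?_
    rw [integral_const_mul]
    simp only [Pi.add_apply]
    rw [integral_add (iE 2 τ (by norm_num) hτ) (iE (2 * s) τ (by linarith) hτ)]
    have m1 := hmom 2 1 (by norm_num) (by linarith) τ hτ
    have m2 := hmom (2 * s) 1 (by norm_num) (by linarith) τ hτ
    rw [Real.rpow_neg_one] at m1 m2
    have hτi : 0 ≤ τ⁻¹ := by have : 0 ≤ τ := by linarith
                             positivity
    have a3 := hMp (2 + 2 * s); have a4 := hMp (4 * s)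
    calc K * d * ((∫ ξ, ‖ξ‖ ^ (2 : ℝ) * E ξ τ) + ∫ ξ, ‖ξ‖ ^ (2 * s) * E ξ τ)
        ≤ K * d * (M 2 * τ⁻¹ + M (2 * s) * τ⁻¹) := by gcongr
      _ = K * (M 2 + M (2 * s)) * d * τ⁻¹ := by ring
      _ ≤ C * d * τ⁻¹ := by
        gcongr
        rw [hC]
        have : 0 ≤ K * p * (M (2 + 2 * s) + M (4 * s)) := by positivity
        linarith
  · have hτ' : 2 ≤ τ' := hτ.trans hττ
    rw [hrep τ hτ, hrep τ' hτ', ← integral_sub (hint τ hτ) (hint τ' hτ')]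
    have hle := norm_integral_le_of_norm_le
      (((iE (2 + 2 * s) τ (by positivity) hτ).add (iE (4 * s) τ (by linarith) hτ)).const_mul
        (K * d * p * |τ - τ'|))
      (f := fun ξ => B ξ * Real.exp (-(p * ‖ξ‖ ^ (2 * s) * τ)) -
        B ξ * Real.exp (-(p * ‖ξ‖ ^ (2 * s) * τ')))
      ((ae_iff.2 (by
        have : Nonempty (Fin n) := ⟨⟨0, hn⟩⟩
        simp) :
        ∀ᵐ ξ : EuclideanSpace ℝ (Fin n), ξ ≠ 0).mono fun ξ hξ => by
        have hξ0 : 0 < ‖ξ‖ := norm_pos_iff.2 hξ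
        rw [← mul_sub, norm_mul, Real.norm_eq_abs, Real.norm_eq_abs]
        calc |B ξ| * |Real.exp (-(p * ‖ξ‖ ^ (2 * s) * τ)) - Real.exp (-(p * ‖ξ‖ ^ (2 * s) * τ'))|
            ≤ K * d * (‖ξ‖ ^ (2 : ℝ) + ‖ξ‖ ^ (2 * s)) * Real.exp (p * ‖ξ‖ ^ (2 * s)) *
              (p * ‖ξ‖ ^ (2 * s) * |τ - τ'| * Real.exp (-(p * ‖ξ‖ ^ (2 * s) * τ))) := by
              gcongr
              · exact hBle ξ
              · exact abs_exp_neg_mul_sub_le (by positivity) hττ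
          _ = K * d * p * |τ - τ'| * ((‖ξ‖ ^ (2 : ℝ) + ‖ξ‖ ^ (2 * s)) * ‖ξ‖ ^ (2 * s)) *
              (Real.exp (p * ‖ξ‖ ^ (2 * s)) * Real.exp (-(p * ‖ξ‖ ^ (2 * s) * τ))) := by ring
          _ ≤ K * d * p * |τ - τ'| * ((‖ξ‖ ^ (2 : ℝ) + ‖ξ‖ ^ (2 * s)) * ‖ξ‖ ^ (2 * s)) *
              E ξ τ := by gcongr; exact hexp ξ τ hτ
          _ = _ := by
            simp only [Pi.add_apply]
            rw [add_mul, ← Real.rpow_add hξ0, ← Real.rpow_add hξ0,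
              show 2 * s + 2 * s = 4 * s by ring]
            ring)
    refine hle.trans ?_
    rw [integral_const_mul]
    simp only [Pi.add_apply]
    rw [integral_add (iE (2 + 2 * s) τ (by positivity) hτ) (iE (4 * s) τ (by linarith) hτ)]
    have m1 := hmom (2 + 2 * s) 2 (by norm_num) (by linarith) τ hτ
    have m2 := hmom (4 * s) 2 (by norm_num) (by linarith) τ hτ
    rw [Real.rpow_neg (by linarith : 0 ≤ τ), Real.rpow_two] at m1 m2
    have a3 := hMp 2; have a4 := hMp (2 * s)
    calc K * d * p * |τ - τ'| *
          ((∫ ξ, ‖ξ‖ ^ (2 + 2 * s) * E ξ τ) + ∫ ξ, ‖ξ‖ ^ (4 * s) * E ξ τ)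
        ≤ K * d * p * |τ - τ'| * (M (2 + 2 * s) * (τ ^ 2)⁻¹ + M (4 * s) * (τ ^ 2)⁻¹) := by gcongr
      _ = K * p * (M (2 + 2 * s) + M (4 * s)) * d * (τ ^ 2)⁻¹ * |τ - τ'| := by ring
      _ ≤ C * d * (τ ^ 2)⁻¹ * |τ - τ'| := by
        gcongr
        rw [hC]
        have : 0 ≤ K * (M 2 + M (2 * s)) := by positivity
        linarith

lemma measurable_fundSol {n : ℕ} (s : ℝ) : Measurable (fundSol (n := n) s) := by
  unfold fundSol
  refine Measurable.ite (measurableSet_lt measurable_const measurable_snd) ?_ measurable_const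
  refine Complex.measurable_re.comp ?_
  simp only [Real.fourierInv_eq']
  refine (StronglyMeasurable.integral_prod_right (ν := volume)
    (f := fun (p : SpaceTime n) (v : EuclideanSpace ℝ (Fin n)) =>
      Complex.exp (↑(2 * Real.pi * inner ℝ v p.1) * Complex.I) •
      (Real.exp (-4 * Real.pi ^ 2 * p.2 * ‖v‖ ^ (2 * s)) : ℂ)) ?_).measurable
  refine Measurable.stronglyMeasurable ?_
  have h1 : Measurable fun q : SpaceTime n × EuclideanSpace ℝ (Fin n) => inner ℝ q.2 q.1.1 :=
    measurable_snd.inner measurable_fst.fst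
  simp only [Function.uncurry_def]
  fun_prop

lemma le_rpow_mul_rpow {a b c θ : ℝ} (ha : 0 ≤ a) (hb : a ≤ b) (hc : a ≤ c) (h0 : 0 ≤ θ)
    (h1 : θ ≤ 1) : a ≤ b ^ θ * c ^ (1 - θ) := by
  have e : a = a ^ θ * a ^ (1 - θ) := by
    rw [← Real.rpow_add_of_nonneg ha h0 (by linarith)]; simp
  calc a = a ^ θ * a ^ (1 - θ) := e
    _ ≤ b ^ θ * c ^ (1 - θ) := by
      have h1' : 0 ≤ 1 - θ := by linarith
      have hb0 : 0 ≤ b := ha.trans hb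
      gcongr

lemma integral_fracQuot_eq_timeDeriv {n : ℕ} (s β : ℝ) (x : EuclideanSpace ℝ (Fin n)) (t : ℝ) :
    ∫ τ, fracQuot β (fun τ => fundSol s (x, τ)) t τ = timeDeriv β (fundSol s) (x, t) := rfl

lemma measurable_fundSol_time {n : ℕ} (s : ℝ) (x : EuclideanSpace ℝ (Fin n)) :
    Measurable fun τ => fundSol s (x, τ) :=
  (measurable_fundSol s).comp measurable_prodMk_left

/-! ### Interpolation, existence and size of the kernel -/

/-- Interpolation between the two regimes of the fundamental solution. -/
lemma fundSol_interpolation {n : ℕ} (hn : 1 ≤ n) {s ε : ℝ} (hs0 : 0 < s) (hs1 : s ≤ 1)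
    (hε0 : 0 < ε) (hε1 : ε ≤ 1 / 2) :
    ∃ C : ℝ, 0 < C ∧ ∀ x : EuclideanSpace ℝ (Fin n), x ≠ 0 →
      (∀ τ, 0 < τ → |fundSol s (x, τ)| ≤ C * ‖x‖ ^ (-(n - 2 * s * ε)) * τ ^ (-ε)) ∧
      ∀ τ τ', 0 < τ → τ ≤ τ' → |fundSol s (x, τ) - fundSol s (x, τ')| ≤
        C * ‖x‖ ^ (-(n - 2 * s * ε)) * τ ^ (-1 - ε) * |τ - τ'| := by
  obtain ⟨C₁, hC₁, h₁⟩ := fundSol_lipschitz_time (n := n) hn hs0 hs1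
  obtain ⟨C₂, hC₂, h₂⟩ := fundSol_abs_le (n := n) hn hs0
  obtain ⟨C₃, hC₃, h₃⟩ := fundSol_sub_time_le (n := n) hn hs0
  have hn1 : (1 : ℝ) ≤ n := by exact_mod_cast hn
  have hns : 0 < (n : ℝ) + 2 * s := by linarith
  set C := C₁ + C₂ + C₃ with hC
  have hCp : 0 < C := by positivity
  -- This weight lowers the exponent n + 2s of |x| to n - 2sε, just below the dimension; homogeneity
  -- then forces the powers of τ. That θ ≥ 0 uses 2sε ≤ 1 ≤ n.
  obtain ⟨θ, hθ⟩ : ∃ θ : ℝ, θ = (n - 2 * s * ε) / (n + 2 * s) := ⟨_, rfl⟩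
  have hse : 2 * s * ε ≤ 1 := by nlinarith
  have hθ0 : 0 ≤ θ := by rw [hθ]; exact div_nonneg (by linarith) hns.le
  have hθ1 : θ ≤ 1 := by
    rw [hθ, div_le_one hns]
    have : 0 < 2 * s * ε := by positivity
    linarith
  have hCC : C ^ θ * C ^ (1 - θ) = C := by rw [← Real.rpow_add hCp]; simp
  refine ⟨C, hCp, fun x hx => ?_⟩
  have hxp : 0 < ‖x‖ := norm_pos_iff.2 hx
  have hxθ : (‖x‖ ^ (-(n + 2 * s))) ^ θ = ‖x‖ ^ (-(n - 2 * s * ε)) := by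
    rw [← Real.rpow_mul hxp.le, hθ]
    congr 1; field_simp
  refine ⟨fun τ hτ => ?_, fun τ τ' hτ hττ => ?_⟩
  · have b1 : |fundSol s (x, τ)| ≤ C * (‖x‖ ^ (-(n + 2 * s)) * τ) := by
      have := h₁ x τ 0 hx
      rw [fundSol_of_nonpos s x le_rfl, sub_zero, sub_zero, abs_of_pos hτ, mul_assoc] at this
      refine this.trans ?_
      gcongr; rw [hC]; linarith
    have b2 : |fundSol s (x, τ)| ≤ C * τ ^ (-(n / (2 * s))) := by
      refine (h₂ x τ hτ).trans ?_
      gcongr; rw [hC]; linarith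
    refine (le_rpow_mul_rpow (abs_nonneg _) b1 b2 hθ0 hθ1).trans (le_of_eq ?_)
    rw [Real.mul_rpow hCp.le (by positivity), Real.mul_rpow hCp.le (by positivity),
      Real.mul_rpow (by positivity) hτ.le, hxθ, ← Real.rpow_mul hτ.le]
    have : τ ^ θ * τ ^ (-(n / (2 * s)) * (1 - θ)) = τ ^ (-ε) := by
      rw [← Real.rpow_add hτ, hθ]
      congr 1; field_simp; ring
    calc _ = (C ^ θ * C ^ (1 - θ)) * ‖x‖ ^ (-(n - 2 * s * ε)) *
          (τ ^ θ * τ ^ (-(n / (2 * s)) * (1 - θ))) := by ring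
      _ = _ := by rw [this, hCC]
  · have b1 : |fundSol s (x, τ) - fundSol s (x, τ')| ≤ C * (‖x‖ ^ (-(n + 2 * s)) * |τ - τ'|) := by
      refine (h₁ x τ τ' hx).trans ?_
      rw [mul_assoc]
      gcongr; rw [hC]; linarith
    have b2 : |fundSol s (x, τ) - fundSol s (x, τ')| ≤
        C * (τ ^ (-(n / (2 * s) + 1)) * |τ - τ'|) := by
      refine (h₃ x τ τ' hτ hττ).trans ?_
      rw [mul_assoc]
      gcongr; rw [hC]; linarith
    refine (le_rpow_mul_rpow (abs_nonneg _) b1 b2 hθ0 hθ1).trans (le_of_eq ?_)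
    rw [Real.mul_rpow hCp.le (by positivity), Real.mul_rpow hCp.le (by positivity),
      Real.mul_rpow (by positivity) (abs_nonneg _), Real.mul_rpow (by positivity) (abs_nonneg _),
      hxθ, ← Real.rpow_mul hτ.le]
    have e1 : τ ^ (-(n / (2 * s) + 1) * (1 - θ)) = τ ^ (-1 - ε) := by
      rw [hθ]
      congr 1; field_simp; ring
    have e2 : |τ - τ'| ^ θ * |τ - τ'| ^ (1 - θ) = |τ - τ'| := by
      rw [← Real.rpow_add_of_nonneg (abs_nonneg _) hθ0 (by linarith)]; simp
    calc _ = (C ^ θ * C ^ (1 - θ)) * ‖x‖ ^ (-(n - 2 * s * ε)) *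
          τ ^ (-(n / (2 * s) + 1) * (1 - θ)) * (|τ - τ'| ^ θ * |τ - τ'| ^ (1 - θ)) := by ring
      _ = _ := by rw [e1, e2, hCC]

/-- Away from the time axis the fractional derivative of the fundamental solution exists. -/
lemma integrable_fracQuot_fundSol {n : ℕ} (hn : 1 ≤ n) {s β : ℝ} (hs0 : 0 < s) (hs1 : s ≤ 1)
    (hβ0 : 0 < β) (hβ1 : β < 1) {x : EuclideanSpace ℝ (Fin n)} (hx : x ≠ 0) (t : ℝ) :
    Integrable (fracQuot β (fun τ => fundSol s (x, τ)) t) := by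
  obtain ⟨C₁, hC₁, h₁⟩ := fundSol_lipschitz_time (n := n) hn hs0 hs1
  obtain ⟨C₂, hC₂, h₂⟩ := fundSol_abs_le (n := n) hn hs0
  obtain ⟨C, -, h⟩ := fracQuot_of_holder hβ0 hβ1
  have hB : 0 ≤ C₁ * ‖x‖ ^ (-(n + 2 * s)) := by positivity
  refine (h (fun τ => fundSol s (x, τ)) (C₁ * ‖x‖ ^ (-(n + 2 * s)) + C₂) t
    (measurable_fundSol_time s x) (fun τ => ?_) (fun τ => ?_)).1
  · rw [Real.rpow_one]
    refine (h₁ x τ t hx).trans ?_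
    gcongr; linarith
  · rcases le_or_gt τ 0 with h0 | h0
    · rw [fundSol_of_nonpos s x h0, abs_zero]; positivity
    rcases le_or_gt τ 1 with h1 | h1
    · have := h₁ x τ 0 hx
      rw [fundSol_of_nonpos s x le_rfl, sub_zero, sub_zero, abs_of_pos h0] at this
      refine this.trans ?_
      nlinarith
    · refine (h₂ x τ h0).trans ?_
      have : τ ^ (-(n / (2 * s))) ≤ 1 :=
        Real.rpow_le_one_of_one_le_of_nonpos h1.le (by simp only [Left.neg_nonpos_iff]; positivity)
      nlinarith

/-- The parabolic homogeneity of the kernel. -/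
lemma timeDeriv_fundSol_smul {n : ℕ} (s β : ℝ) {l : ℝ} (hl : 0 < l)
    (x : EuclideanSpace ℝ (Fin n)) (t : ℝ) :
    timeDeriv β (fundSol s) (l • x, l ^ (2 * s) * t) =
      l ^ (-(n + 2 * s * β)) * timeDeriv β (fundSol s) (x, t) := by
  rw [← integral_fracQuot_eq_timeDeriv, ← integral_fracQuot_eq_timeDeriv]
  obtain ⟨c, hc⟩ : ∃ c : ℝ, c = l ^ (2 * s) := ⟨_, rfl⟩
  have hcp : 0 < c := by rw [hc]; exact Real.rpow_pos_of_pos hl _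
  have h := Measure.integral_comp_mul_left
    (fracQuot β (fun τ => fundSol s (l • x, τ)) (l ^ (2 * s) * t)) c
  rw [abs_of_pos (inv_pos.2 hcp), smul_eq_mul, eq_inv_mul_iff_mul_eq₀ hcp.ne'] at h
  rw [← h, ← integral_const_mul, ← integral_const_mul]
  refine integral_congr_ae (Filter.Eventually.of_forall fun τ => ?_)
  simp only [fracQuot]
  rw [hc, fundSol_smul s hl, fundSol_smul s hl, ← mul_sub, ← mul_sub, ← hc, abs_mul,
    abs_of_pos hcp, Real.mul_rpow hcp.le (abs_nonneg _)]
  have e : l ^ (-(n + 2 * s * β)) = c * l ^ (-(n : ℝ)) * (c ^ (1 + β))⁻¹ := by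
    rw [hc, ← Real.rpow_mul hl.le, ← Real.rpow_neg hl.le, ← Real.rpow_add hl, ← Real.rpow_add hl]
    congr 1; ring
  rw [e]
  field_simp

lemma abs_fundSol_le_innerPow {n : ℕ} {s ε C : ℝ} {x : EuclideanSpace ℝ (Fin n)} (hC : 0 ≤ C)
    (h : ∀ τ, 0 < τ → |fundSol s (x, τ)| ≤ C * τ ^ (-ε)) {τ : ℝ} (hτ : τ < 4) :
    |fundSol s (x, τ)| ≤ C * innerPow 4 (-ε) τ := by
  rcases le_or_gt τ 0 with h0 | h0
  · rw [fundSol_of_nonpos s x h0, abs_zero]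
    exact mul_nonneg hC (innerPow_nonneg _ _ _)
  · have e : innerPow 4 (-ε) τ = τ ^ (-ε) := by
      simp only [innerPow, abs_of_pos h0, hτ, if_true]
    rw [e]
    exact h τ h0

/-- Size of the kernel. -/
lemma timeDeriv_fundSol_abs_le {n : ℕ} (hn : 1 ≤ n) {s β ε : ℝ} (hs0 : 0 < s) (hs1 : s ≤ 1)
    (hβ0 : 0 < β) (hβ1 : β < 1) (hε0 : 0 < ε) (hε1 : ε ≤ 1 / 2) :
    ∃ C : ℝ, 0 < C ∧ ∀ (x : EuclideanSpace ℝ (Fin n)) (t : ℝ), x ≠ 0 → t ≠ 0 →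
      |timeDeriv β (fundSol s) (x, t)| ≤ C * ‖x‖ ^ (-(n - 2 * s * ε)) * |t| ^ (-(β + ε)) := by
  obtain ⟨C₁, hC₁, h₁⟩ := fundSol_interpolation (n := n) hn hs0 hs1 hε0 hε1
  obtain ⟨C₂, hC₂, h₂⟩ := fracQuot_of_decay hβ0 hβ1 hε0 (by linarith)
  set I : ℝ := ∫ τ, innerPow 4 (-ε) τ with hI
  have hI0 : 0 ≤ I := integral_nonneg fun τ => innerPow_nonneg _ _ _
  have hIi : Integrable (innerPow 4 (-ε)) := integrable_innerPow (by norm_num) (by linarith)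
  set C : ℝ := C₂ * (C₁ * (1 + I)) with hC
  have hCp : 0 < C := by positivity
  -- Homogeneity reduces the general case to |t| = 4, the smallest value allowed in
  -- `fracQuot_of_decay`.
  have key : ∀ (x : EuclideanSpace ℝ (Fin n)) (t : ℝ), x ≠ 0 → |t| = 4 →
      |timeDeriv β (fundSol s) (x, t)| ≤ C * ‖x‖ ^ (-(n - 2 * s * ε)) * 4 ^ (-(β + ε)) := by
    intro x t hx ht
    obtain ⟨ha, hb⟩ := h₁ x hx
    set Φ := ‖x‖ ^ (-(n - 2 * s * ε)) with hΦ
    have hΦ0 : 0 ≤ Φ := by positivity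
    have hle : ∀ τ, τ < 4 → |fundSol s (x, τ)| ≤ C₁ * Φ * innerPow 4 (-ε) τ := fun τ hτ =>
      abs_fundSol_le_innerPow (by positivity) ha hτ
    have hi : IntegrableOn (fun τ => fundSol s (x, τ)) (Set.Icc (-1) 2) :=
      (hIi.const_mul (C₁ * Φ)).integrableOn.mono'
        (measurable_fundSol_time s x).aestronglyMeasurable
        ((ae_restrict_mem measurableSet_Icc).mono fun τ hτ => hle τ (by linarith [hτ.2]))
    have hM : C₁ * Φ ≤ C₁ * (1 + I) * Φ := by nlinarith [mul_nonneg hC₁.le hΦ0]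
    have hM0 : 0 ≤ C₁ * Φ := by positivity
    have := (h₂ (fun τ => fundSol s (x, τ)) (C₁ * (1 + I) * Φ) t (measurable_fundSol_time s x)
      (fun τ hτ => fundSol_of_nonpos s x (by linarith)) hi ?_ (fun τ hτ => ?_)
      (fun τ τ' hτ hττ => ?_) ht.ge).2
    · rw [integral_fracQuot_eq_timeDeriv, ht] at this
      refine this.trans (le_of_eq ?_)
      rw [hC]; ring
    · calc ∫ τ in Set.Icc (-1) 2, |fundSol s (x, τ)|
          ≤ ∫ τ in Set.Icc (-1) 2, C₁ * Φ * innerPow 4 (-ε) τ :=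
            setIntegral_mono_on hi.abs (hIi.const_mul _).integrableOn measurableSet_Icc
              fun τ hτ => hle τ (by linarith [hτ.2])
        _ ≤ ∫ τ, C₁ * Φ * innerPow 4 (-ε) τ :=
            setIntegral_le_integral (hIi.const_mul _) (Filter.Eventually.of_forall fun τ =>
              mul_nonneg hM0 (innerPow_nonneg _ _ _))
        _ = C₁ * Φ * I := by rw [integral_const_mul]
        _ ≤ C₁ * (1 + I) * Φ := by nlinarith
    · refine (ha τ (by linarith)).trans ?_
      have : 0 ≤ τ := by linarith
      gcongr
    · refine (hb τ τ' (by linarith) hττ).trans ?_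
      have : 0 ≤ τ := by linarith
      gcongr
  refine ⟨C, hCp, fun x t hx ht => ?_⟩
  have htp : 0 < |t| := abs_pos.2 ht
  obtain ⟨q, hq⟩ : ∃ q : ℝ, q = |t| / 4 := ⟨_, rfl⟩
  have hqp : 0 < q := by rw [hq]; positivity
  obtain ⟨l, hl⟩ : ∃ l : ℝ, l = q ^ (1 / (2 * s)) := ⟨_, rfl⟩
  have hlp : 0 < l := by rw [hl]; exact Real.rpow_pos_of_pos hqp _
  have hls : l ^ (2 * s) = q := by
    rw [hl, ← Real.rpow_mul hqp.le, one_div_mul_cancel (by positivity), Real.rpow_one]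
  have hsplit : timeDeriv β (fundSol s) (x, t) =
      l ^ (-(n + 2 * s * β)) * timeDeriv β (fundSol s) (l⁻¹ • x, q⁻¹ * t) := by
    rw [← timeDeriv_fundSol_smul s β hlp, smul_smul, mul_inv_cancel₀ hlp.ne', one_smul, hls,
      mul_inv_cancel_left₀ hqp.ne']
  have h4 : |q⁻¹ * t| = 4 := by
    rw [abs_mul, abs_of_pos (inv_pos.2 hqp), hq]; field_simp
  have hk := key (l⁻¹ • x) (q⁻¹ * t) (smul_ne_zero (inv_ne_zero hlp.ne') hx) h4
  rw [norm_smul, Real.norm_eq_abs, abs_of_pos (inv_pos.2 hlp),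
    Real.mul_rpow (inv_pos.2 hlp).le (norm_nonneg _), Real.inv_rpow hlp.le] at hk
  have hlneg : 0 < l ^ (-(n + 2 * s * β)) := Real.rpow_pos_of_pos hlp _
  rw [hsplit, abs_mul, abs_of_pos hlneg]
  refine (mul_le_mul_of_nonneg_left hk hlneg.le).trans (le_of_eq ?_)
  have e1 : l ^ (-(n + 2 * s * β)) * (l ^ (-(n - 2 * s * ε)))⁻¹ = q ^ (-(β + ε)) := by
    rw [← hls, ← Real.rpow_neg hlp.le, ← Real.rpow_add hlp, ← Real.rpow_mul hlp.le]
    congr 1; ring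
  have e2 : q ^ (-(β + ε)) * 4 ^ (-(β + ε)) = |t| ^ (-(β + ε)) := by
    rw [← Real.mul_rpow hqp.le (by norm_num), hq]
    congr 1; ring
  rw [← e2, ← e1]
  ring

/-! ### Differences of the kernel -/

lemma fracQuot_sub (β : ℝ) (g g' : ℝ → ℝ) (t τ : ℝ) :
    fracQuot β (fun τ => g τ - g' τ) t τ = fracQuot β g t τ - fracQuot β g' t τ := by
  simp only [fracQuot]; ring

lemma fracQuot_translate (β : ℝ) (g : ℝ → ℝ) (t h τ : ℝ) :
    fracQuot β (fun τ => g (τ + h)) t τ = fracQuot β g (t + h) (τ + h) := by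
  simp only [fracQuot]; ring_nf

/-- A difference of two values of the kernel as one fractional derivative. -/
lemma timeDeriv_fundSol_sub {n : ℕ} (hn : 1 ≤ n) {s β : ℝ} (hs0 : 0 < s) (hs1 : s ≤ 1)
    (hβ0 : 0 < β) (hβ1 : β < 1) {x x' : EuclideanSpace ℝ (Fin n)} (hx : x ≠ 0) (hx' : x' ≠ 0)
    (t h : ℝ) :
    timeDeriv β (fundSol s) (x, t) - timeDeriv β (fundSol s) (x', t + h) =
      ∫ τ, fracQuot β (fun τ => fundSol s (x, τ) - fundSol s (x', τ + h)) t τ := by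
  have i1 := integrable_fracQuot_fundSol hn hs0 hs1 hβ0 hβ1 hx t
  have i2 := (integrable_fracQuot_fundSol hn hs0 hs1 hβ0 hβ1 hx' (t + h)).comp_add_right h
  simp only [fracQuot_sub, fracQuot_translate β (fun τ => fundSol s (x', τ))]
  rw [integral_sub i1 i2, integral_fracQuot_eq_timeDeriv,
    integral_add_right_eq_self (fracQuot β (fun τ => fundSol s (x', τ)) (t + h)),
    integral_fracQuot_eq_timeDeriv]

/-- Decay of differences of the kernel for large times. -/
lemma timeDeriv_fundSol_sub_le_of_large {n : ℕ} (hn : 1 ≤ n) {s β : ℝ} (hs0 : 0 < s) (hs1 : s ≤ 1)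
    (hβ0 : 0 < β) (hβ1 : β < 1) {R : ℝ} (hR : 0 ≤ R) :
    ∃ C : ℝ, 0 < C ∧ ∀ (x x' : EuclideanSpace ℝ (Fin n)) (h t m : ℝ), x ≠ 0 → x' ≠ 0 →
      ‖x‖ ≤ R → ‖x'‖ ≤ R → |h| ≤ 1 → 4 ≤ |t| → ‖x - x'‖ + |h| ≤ m →
      IntegrableOn (fun τ => fundSol s (x, τ) - fundSol s (x', τ + h)) (Set.Icc (-1) 2) →
      (∫ τ in Set.Icc (-1) 2, |fundSol s (x, τ) - fundSol s (x', τ + h)|) ≤ m →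
      |timeDeriv β (fundSol s) (x, t) - timeDeriv β (fundSol s) (x', t + h)| ≤
        C * m * |t| ^ (-(1 + β / 2)) := by
  obtain ⟨C₁, hC₁, h₁⟩ := fundSol_sub_translate_le (n := n) hn hs0 hs1 hR
  -- The resulting exponent β + ε = 1 + β/2 exceeds 1, which makes the later sum over time steps
  -- converge, while ε stays below 1. The available decay τ⁻¹ is more than enough.
  obtain ⟨C₂, hC₂, h₂⟩ := fracQuot_of_decay (ε := 1 - β / 2) hβ0 hβ1 (by linarith) (by linarith)
  refine ⟨C₂ * (C₁ + 1), by positivity, fun x x' h t m hx hx' hxR hxR' hh ht hm hi hI => ?_⟩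
  obtain ⟨ha, hb⟩ := h₁ x x' h hxR hxR' hh
  have hm0 : 0 ≤ m := le_trans (by positivity) hm
  have hd0 : 0 ≤ ‖x - x'‖ + |h| := by positivity
  have hdm : C₁ * (‖x - x'‖ + |h|) ≤ (C₁ + 1) * m := by
    calc C₁ * (‖x - x'‖ + |h|) ≤ C₁ * m := by gcongr
      _ ≤ _ := by linarith
  rw [timeDeriv_fundSol_sub hn hs0 hs1 hβ0 hβ1 hx hx']
  have := (h₂ (fun τ => fundSol s (x, τ) - fundSol s (x', τ + h)) ((C₁ + 1) * m) t
    ((measurable_fundSol_time s x).sub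
      ((measurable_fundSol_time s x').comp (measurable_add_const h)))
    (fun τ hτ => ?_) hi ?_ (fun τ hτ => ?_) (fun τ τ' hτ hττ => ?_) ht).2
  · rw [show β + (1 - β / 2) = 1 + β / 2 by ring] at this
    refine this.trans (le_of_eq (by ring))
  · rw [fundSol_of_nonpos s x (by linarith), fundSol_of_nonpos s x' (by linarith [(abs_le.1 hh).2]),
      sub_zero]
  · refine hI.trans ?_
    nlinarith
  · refine (ha τ hτ).trans ?_
    have : τ⁻¹ ≤ τ ^ (-(1 - β / 2)) := by
      rw [← Real.rpow_neg_one]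
      exact Real.rpow_le_rpow_of_exponent_le (by linarith) (by linarith)
    have : 0 ≤ τ⁻¹ := inv_nonneg.2 (by linarith)
    gcongr
  · refine (hb τ τ' hτ hττ).trans ?_
    have : (τ ^ 2)⁻¹ ≤ τ ^ (-1 - (1 - β / 2)) := by
      rw [← Real.rpow_two, ← Real.rpow_neg (by linarith)]
      exact Real.rpow_le_rpow_of_exponent_le (by linarith) (by linarith)
    gcongr

/-- Differences of the kernel near the time axis, for large times. -/
lemma timeDeriv_fundSol_sub_le_near_axis {n : ℕ} (hn : 1 ≤ n) {s β ε : ℝ} (hs0 : 0 < s)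
    (hs1 : s ≤ 1) (hβ0 : 0 < β) (hβ1 : β < 1) (hε0 : 0 < ε) (hε1 : ε ≤ 1 / 2) {R : ℝ}
    (hR : 0 ≤ R) :
    ∃ C : ℝ, 0 < C ∧ ∀ (x x' : EuclideanSpace ℝ (Fin n)) (h t : ℝ), x ≠ 0 → x' ≠ 0 →
      ‖x‖ ≤ R → ‖x'‖ ≤ R → |h| ≤ 1 → 4 ≤ |t| →
      |timeDeriv β (fundSol s) (x, t) - timeDeriv β (fundSol s) (x', t + h)| ≤
        C * (1 + ‖x‖ ^ (-(n - 2 * s * ε)) + ‖x'‖ ^ (-(n - 2 * s * ε))) * |t| ^ (-(1 + β / 2)) := by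
  obtain ⟨C₁, hC₁, h₁⟩ := timeDeriv_fundSol_sub_le_of_large (n := n) hn hs0 hs1 hβ0 hβ1 hR
  obtain ⟨C₂, hC₂, h₂⟩ := fundSol_interpolation (n := n) hn hs0 hs1 hε0 hε1
  set I : ℝ := ∫ τ, innerPow 4 (-ε) τ with hI
  have hI0 : 0 ≤ I := integral_nonneg fun τ => innerPow_nonneg _ _ _
  have hIi : Integrable (innerPow 4 (-ε)) := integrable_innerPow (by norm_num) (by linarith)
  -- No smallness is sought here: 2R + 1 bounds the displacement, and C₂ I accounts for the
  -- integrable time singularity of each of the two terms.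
  set L : ℝ := 2 * R + 1 + C₂ * I with hL
  have hLp : 0 < L := by positivity
  refine ⟨C₁ * L, by positivity, fun x x' h t hx hx' hxR hxR' hh ht => ?_⟩
  set Φ := ‖x‖ ^ (-(n - 2 * s * ε)) with hΦ
  set Φ' := ‖x'‖ ^ (-(n - 2 * s * ε)) with hΦ'
  have hΦ0 : 0 ≤ Φ := by positivity
  have hΦ0' : 0 ≤ Φ' := by positivity
  have hD : Integrable fun τ => C₂ * Φ * innerPow 4 (-ε) τ + C₂ * Φ' * innerPow 4 (-ε) (τ + h) :=
    (hIi.const_mul _).add ((hIi.comp_add_right h).const_mul _)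
  have hle : ∀ τ ∈ Set.Icc (-1 : ℝ) 2, |fundSol s (x, τ) - fundSol s (x', τ + h)| ≤
      C₂ * Φ * innerPow 4 (-ε) τ + C₂ * Φ' * innerPow 4 (-ε) (τ + h) := by
    intro τ hτ
    refine (abs_sub _ _).trans (add_le_add ?_ ?_)
    · exact abs_fundSol_le_innerPow (by positivity) (h₂ x hx).1 (by linarith [hτ.2])
    · exact abs_fundSol_le_innerPow (by positivity) (h₂ x' hx').1
        (by linarith [hτ.2, (abs_le.1 hh).2])
  have hi : IntegrableOn (fun τ => fundSol s (x, τ) - fundSol s (x', τ + h)) (Set.Icc (-1) 2) :=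
    hD.integrableOn.mono' ((measurable_fundSol_time s x).sub
      ((measurable_fundSol_time s x').comp (measurable_add_const h))).aestronglyMeasurable
      ((ae_restrict_mem measurableSet_Icc).mono hle)
  have := h₁ x x' h t (L * (1 + Φ + Φ')) hx hx' hxR hxR' hh ht ?_ hi ?_
  · refine this.trans (le_of_eq (by ring))
  · have : ‖x - x'‖ ≤ 2 * R := (norm_sub_le _ _).trans (by linarith)
    have h0 : 0 ≤ C₂ * I := by positivity
    nlinarith [mul_nonneg hLp.le hΦ0, mul_nonneg hLp.le hΦ0']
  · calc ∫ τ in Set.Icc (-1) 2, |fundSol s (x, τ) - fundSol s (x', τ + h)|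
        ≤ ∫ τ in Set.Icc (-1) 2,
          (C₂ * Φ * innerPow 4 (-ε) τ + C₂ * Φ' * innerPow 4 (-ε) (τ + h)) :=
          setIntegral_mono_on hi.abs hD.integrableOn measurableSet_Icc hle
      _ ≤ ∫ τ, (C₂ * Φ * innerPow 4 (-ε) τ + C₂ * Φ' * innerPow 4 (-ε) (τ + h)) :=
          setIntegral_le_integral hD (Filter.Eventually.of_forall fun τ =>
            add_nonneg (mul_nonneg (by positivity) (innerPow_nonneg _ _ _))
              (mul_nonneg (by positivity) (innerPow_nonneg _ _ _)))
      _ = C₂ * I * (Φ + Φ') := by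
          rw [integral_add (hIi.const_mul _) ((hIi.comp_add_right h).const_mul _),
            integral_const_mul, integral_const_mul,
            integral_add_right_eq_self (innerPow 4 (-ε))]
          ring
      _ ≤ L * (1 + Φ + Φ') := by
          have : C₂ * I ≤ L := by rw [hL]; linarith
          have h0 : 0 ≤ Φ + Φ' := by positivity
          nlinarith

lemma abs_cos_sub_cos_le_abs_sub (a b : ℝ) : |Real.cos a - Real.cos b| ≤ |a - b| := by
  rw [Real.cos_sub_cos, abs_mul, abs_mul, abs_neg, abs_two]
  have h1 := Real.abs_sin_le_one ((a + b) / 2)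
  have h2 := Real.abs_sin_le_abs (x := (a - b) / 2)
  calc 2 * |Real.sin ((a + b) / 2)| * |Real.sin ((a - b) / 2)|
      ≤ 2 * 1 * |(a - b) / 2| := by gcongr
    _ = |a - b| := by rw [abs_div, abs_two]; ring

lemma fundSol_sub_space_le {n : ℕ} (hn : 1 ≤ n) {s : ℝ} (hs0 : 0 < s) :
    ∃ C : ℝ, 0 < C ∧ ∀ (x x' : EuclideanSpace ℝ (Fin n)) (t : ℝ), 0 < t →
      |fundSol s (x, t) - fundSol s (x', t)| ≤ C * (‖x - x'‖ * t ^ (-((n + 1) / (2 * s)))) := by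
  refine ⟨2 * Real.pi * ((4 * Real.pi ^ 2) ^ (-((n + 1) / (2 * s))) * expMoment n s 1) + 1,
    by have := expMoment_nonneg n s 1; positivity, fun x x' t ht => ?_⟩
  rw [fundSol_eq_integral_cos hn hs0 x ht, fundSol_eq_integral_cos hn hs0 x' ht,
    ← integral_sub (integrable_cos_mul_exp hn hs0 x ht) (integrable_cos_mul_exp hn hs0 x' ht)]
  have hb : (0 : ℝ) < 4 * Real.pi ^ 2 * t := by positivity
  have h := norm_integral_le_of_norm_le
    (f := fun ξ : EuclideanSpace ℝ (Fin n) => Real.cos (2 * Real.pi * inner ℝ ξ x) *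
      Real.exp (-(4 * Real.pi ^ 2 * t) * ‖ξ‖ ^ (2 * s)) - Real.cos (2 * Real.pi * inner ℝ ξ x') *
      Real.exp (-(4 * Real.pi ^ 2 * t) * ‖ξ‖ ^ (2 * s)))
    ((integrable_norm_rpow_mul_exp hn hs0 zero_le_one hb).const_mul
      (2 * Real.pi * ‖x - x'‖)) (Filter.Eventually.of_forall fun ξ => by
      rw [← sub_mul, norm_mul, Real.norm_eq_abs, Real.norm_eq_abs, abs_of_pos (Real.exp_pos _),
        Real.rpow_one, ← mul_assoc]
      gcongr
      refine (abs_cos_sub_cos_le_abs_sub _ _).trans ?_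
      rw [← mul_sub, ← inner_sub_right, abs_mul, abs_of_pos (by positivity : 0 < 2 * Real.pi),
        mul_assoc (2 * Real.pi), mul_comm ‖x - x'‖]
      gcongr
      exact abs_real_inner_le_norm _ _)
  rw [integral_const_mul, integral_norm_rpow_mul_exp hs0 hb,
    Real.mul_rpow (by positivity) ht.le] at h
  refine h.trans ?_
  have : 0 ≤ ‖x - x'‖ * t ^ (-((n + 1) / (2 * s))) := by positivity
  nlinarith

lemma rpow_neg_le_of_half_le {r a : ℝ} (hr : 1 / 2 ≤ r) (ha : 0 ≤ a) : r ^ (-a) ≤ 2 ^ a := by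
  calc r ^ (-a) ≤ (1 / 2 : ℝ) ^ (-a) :=
        Real.rpow_le_rpow_of_nonpos (by norm_num) hr (by linarith)
    _ = 2 ^ a := by rw [one_div, Real.inv_rpow (by norm_num), Real.rpow_neg (by norm_num), inv_inv]

/-- Away from the time axis the fundamental solution is Hölder continuous in space, uniformly in
time. -/
lemma fundSol_holder_space {n : ℕ} (hn : 1 ≤ n) {s : ℝ} (hs0 : 0 < s) (hs1 : s ≤ 1) :
    ∃ C κ : ℝ, 0 < C ∧ 0 < κ ∧ κ ≤ 1 ∧ ∀ (x x' : EuclideanSpace ℝ (Fin n)) (t : ℝ),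
      1 / 2 ≤ ‖x‖ → 1 / 2 ≤ ‖x'‖ → |fundSol s (x, t) - fundSol s (x', t)| ≤ C * ‖x - x'‖ ^ κ := by
  obtain ⟨C₁, hC₁, h₁⟩ := fundSol_lipschitz_time (n := n) hn hs0 hs1
  obtain ⟨C₂, hC₂, h₂⟩ := fundSol_sub_space_le (n := n) hn hs0
  obtain ⟨N, hN⟩ : ∃ N : ℝ, N = (n + 1) / (2 * s) := ⟨_, rfl⟩
  have hNp : 0 < N := by rw [hN]; positivity
  have hns : (0 : ℝ) ≤ n + 2 * s := by positivity
  set C := C₁ * 2 ^ (n + 2 * s) * 2 + C₂ with hC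
  have hCp : 0 < C := by positivity
  -- Balances the bound by t, good for small times, against ‖x - x'‖ t^{-N}, good for large times,
  -- so that the powers of t cancel.
  obtain ⟨θ, hθ⟩ : ∃ θ : ℝ, θ = N / (1 + N) := ⟨_, rfl⟩
  have hθ0 : 0 ≤ θ := by rw [hθ]; positivity
  have hθ1 : θ < 1 := by rw [hθ, div_lt_one (by positivity)]; linarith
  have hsmall : ∀ (x : EuclideanSpace ℝ (Fin n)) (t : ℝ), 0 < t → 1 / 2 ≤ ‖x‖ →
      |fundSol s (x, t)| ≤ C₁ * 2 ^ (n + 2 * s) * t := by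
    intro x t ht hx
    have hx0 : x ≠ 0 := by rintro rfl; norm_num at hx
    have := h₁ x t 0 hx0
    rw [fundSol_of_nonpos s x le_rfl, sub_zero, sub_zero, abs_of_pos ht] at this
    refine this.trans ?_
    gcongr
    exact rpow_neg_le_of_half_le hx hns
  refine ⟨C, 1 - θ, hCp, by linarith, by linarith, fun x x' t hx hx' => ?_⟩
  rcases le_or_gt t 0 with ht | ht
  · rw [fundSol_of_nonpos s x ht, fundSol_of_nonpos s x' ht, sub_self, abs_zero]; positivity
  have b1 : |fundSol s (x, t) - fundSol s (x', t)| ≤ C * t := by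
    refine (abs_sub _ _).trans ?_
    have := hsmall x t ht hx
    have := hsmall x' t ht hx'
    rw [hC]
    nlinarith
  have b2 : |fundSol s (x, t) - fundSol s (x', t)| ≤ C * (‖x - x'‖ * t ^ (-N)) := by
    rw [hN]
    refine (h₂ x x' t ht).trans ?_
    gcongr
    rw [hC]
    have : 0 ≤ C₁ * 2 ^ (n + 2 * s) * 2 := by positivity
    linarith
  refine (le_rpow_mul_rpow (abs_nonneg _) b1 b2 hθ0 hθ1.le).trans (le_of_eq ?_)
  rw [Real.mul_rpow hCp.le ht.le, Real.mul_rpow hCp.le (by positivity),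
    Real.mul_rpow (norm_nonneg _) (by positivity), ← Real.rpow_mul ht.le]
  have e1 : t ^ θ * t ^ (-N * (1 - θ)) = 1 := by
    rw [← Real.rpow_add ht, hθ]
    have : N / (1 + N) + -N * (1 - N / (1 + N)) = 0 := by field_simp; ring
    rw [this, Real.rpow_zero]
  have e2 : C ^ θ * C ^ (1 - θ) = C := by rw [← Real.rpow_add hCp]; simp
  calc _ = (C ^ θ * C ^ (1 - θ)) * ‖x - x'‖ ^ (1 - θ) * (t ^ θ * t ^ (-N * (1 - θ))) := by ring
    _ = _ := by rw [e1, e2, mul_one]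

/-- Hölder regularity and decay of the kernel away from the time axis. -/
lemma timeDeriv_fundSol_sub_le_away {n : ℕ} (hn : 1 ≤ n) {s β : ℝ} (hs0 : 0 < s)
    (hs1 : s ≤ 1) (hβ0 : 0 < β) (hβ1 : β < 1) {R L : ℝ} (hR : 0 ≤ R) (hL : 0 ≤ L) :
    ∃ C α : ℝ, 0 < C ∧ 0 < α ∧ ∀ (x x' : EuclideanSpace ℝ (Fin n)) (h t δ : ℝ), 1 / 2 ≤ ‖x‖ →
      1 / 2 ≤ ‖x'‖ → ‖x‖ ≤ R → ‖x'‖ ≤ R → 0 < δ → δ ≤ 1 → ‖x - x'‖ ≤ L * δ →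
      |h| ≤ δ ^ (2 * s) →
      |timeDeriv β (fundSol s) (x, t) - timeDeriv β (fundSol s) (x', t + h)| ≤
        C * δ ^ α * (1 + |t|) ^ (-(1 + β / 2)) := by
  obtain ⟨C₁, hC₁, h₁⟩ := fundSol_lipschitz_time (n := n) hn hs0 hs1
  obtain ⟨C₂, κ, hC₂, hκ0, hκ1, h₂⟩ := fundSol_holder_space (n := n) hn hs0 hs1
  obtain ⟨C₃, hC₃, h₃⟩ := timeDeriv_fundSol_sub_le_of_large (n := n) hn hs0 hs1 hβ0 hβ1 hR
  -- An exponent strictly between β and 1: interpolating the Lipschitz bound of `g` with its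
  -- smallness δ^a gives a γ-Hölder bound, enough for the fractional derivative, and leaves the
  -- factor δ^{a(1 - γ)}.
  obtain ⟨γ, hγ⟩ : ∃ γ : ℝ, γ = (1 + β) / 2 := ⟨_, rfl⟩
  obtain ⟨C₄, hC₄, h₄⟩ := fracQuot_of_holder (β := β) (γ := γ) hβ0 (by rw [hγ]; linarith)
  have hγ0 : 0 ≤ γ := by rw [hγ]; linarith
  have hγ1 : γ < 1 := by rw [hγ]; linarith
  have hns : (0 : ℝ) ≤ n + 2 * s := by positivity
  obtain ⟨Λ, hΛ⟩ : ∃ Λ : ℝ, Λ = C₁ * 2 ^ (n + 2 * s) := ⟨_, rfl⟩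
  have hΛ0 : 0 < Λ := by rw [hΛ]; positivity
  -- One exponent covering both the spatial displacement (κ) and the time displacement (2s).
  obtain ⟨a, ha⟩ : ∃ a : ℝ, a = min κ (2 * s) := ⟨_, rfl⟩
  have ha0 : 0 < a := by rw [ha]; exact lt_min hκ0 (by linarith)
  have ha1 : a ≤ 1 := by rw [ha]; exact (min_le_left _ _).trans hκ1
  have haκ : a ≤ κ := by rw [ha]; exact min_le_left _ _
  have has : a ≤ 2 * s := by rw [ha]; exact min_le_right _ _
  obtain ⟨B, hB⟩ : ∃ B : ℝ, B = C₂ * L ^ κ + 2 * Λ + L + 1 := ⟨_, rfl⟩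
  have hB0 : 0 < B := by rw [hB]; positivity
  have hlip : ∀ (x : EuclideanSpace ℝ (Fin n)) (t t' : ℝ), 1 / 2 ≤ ‖x‖ →
      |fundSol s (x, t) - fundSol s (x, t')| ≤ Λ * |t - t'| := by
    intro x t t' hx
    have hx0 : x ≠ 0 := by rintro rfl; norm_num at hx
    refine (h₁ x t t' hx0).trans ?_
    rw [hΛ]
    gcongr
    exact rpow_neg_le_of_half_le hx hns
  refine ⟨(C₄ * (2 * B) + C₃ * (3 * B)) * 5 ^ (1 + β / 2), a * (1 - γ), by positivity,
    mul_pos ha0 (by linarith), fun x x' h t δ hx hx' hxR hxR' hδ0 hδ1 hxx hh => ?_⟩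
  have hx0 : x ≠ 0 := by rintro rfl; norm_num at hx
  have hx0' : x' ≠ 0 := by rintro rfl; norm_num at hx'
  have hδs : δ ^ (2 * s) ≤ δ ^ a := Real.rpow_le_rpow_of_exponent_ge hδ0 hδ1 has
  have hδκ : δ ^ κ ≤ δ ^ a := Real.rpow_le_rpow_of_exponent_ge hδ0 hδ1 haκ
  have hδ1' : δ ≤ δ ^ a := by
    simpa using Real.rpow_le_rpow_of_exponent_ge hδ0 hδ1 ha1
  have hδα : δ ^ a ≤ δ ^ (a * (1 - γ)) :=
    Real.rpow_le_rpow_of_exponent_ge hδ0 hδ1 (by nlinarith)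
  have hδa0 : 0 < δ ^ a := Real.rpow_pos_of_pos hδ0 _
  have hδα0 : 0 < δ ^ (a * (1 - γ)) := Real.rpow_pos_of_pos hδ0 _
  have hh1 : |h| ≤ 1 := hh.trans (Real.rpow_le_one hδ0.le hδ1 (by linarith))
  set g : ℝ → ℝ := fun τ => fundSol s (x, τ) - fundSol s (x', τ + h) with hg
  have hgm : Measurable g := (measurable_fundSol_time s x).sub
    ((measurable_fundSol_time s x').comp (measurable_add_const h))
  have hsup : ∀ τ, |g τ| ≤ B * δ ^ a := by
    intro τ
    have e : g τ = (fundSol s (x, τ) - fundSol s (x', τ)) +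
        (fundSol s (x', τ) - fundSol s (x', τ + h)) := by simp only [hg]; ring
    have b1 : |fundSol s (x, τ) - fundSol s (x', τ)| ≤ C₂ * L ^ κ * δ ^ a := by
      refine (h₂ x x' τ hx hx').trans ?_
      calc C₂ * ‖x - x'‖ ^ κ ≤ C₂ * (L * δ) ^ κ := by gcongr
        _ = C₂ * L ^ κ * δ ^ κ := by rw [Real.mul_rpow hL hδ0.le]; ring
        _ ≤ _ := by gcongr
    have b2 : |fundSol s (x', τ) - fundSol s (x', τ + h)| ≤ Λ * δ ^ a := by
      refine (hlip x' τ (τ + h) hx').trans ?_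
      rw [show τ - (τ + h) = -h by ring, abs_neg]
      gcongr
      exact hh.trans hδs
    rw [e]
    refine (abs_add_le _ _).trans ((add_le_add b1 b2).trans ?_)
    rw [hB]
    nlinarith
  rcases le_or_gt 4 |t| with ht | ht
  · have hi : IntegrableOn g (Set.Icc (-1) 2) :=
      (integrableOn_const (C := B * δ ^ a) (by simp)).mono' hgm.aestronglyMeasurable
        (Filter.Eventually.of_forall hsup)
    have := h₃ x x' h t (3 * B * δ ^ (a * (1 - γ))) hx0 hx0' hxR hxR' hh1 ht ?_ hi ?_
    · refine this.trans ?_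
      -- The constant 5 serves both regimes: 1 + |t| ≤ 5 |t| when |t| ≥ 4, and 1 + |t| < 5
      -- otherwise.
      have e5 : |t| ^ (-(1 + β / 2)) ≤ 5 ^ (1 + β / 2) * (1 + |t|) ^ (-(1 + β / 2)) := by
        have h5 : (5 : ℝ) ^ (1 + β / 2) = (1 / 5 : ℝ) ^ (-(1 + β / 2)) := by
          rw [one_div, Real.inv_rpow (by norm_num), Real.rpow_neg (by norm_num), inv_inv]
        rw [h5, ← Real.mul_rpow (by norm_num) (by positivity)]
        exact Real.rpow_le_rpow_of_nonpos (by positivity) (by linarith) (by linarith)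
      calc C₃ * (3 * B * δ ^ (a * (1 - γ))) * |t| ^ (-(1 + β / 2))
          ≤ C₃ * (3 * B * δ ^ (a * (1 - γ))) *
            (5 ^ (1 + β / 2) * (1 + |t|) ^ (-(1 + β / 2))) := by gcongr
        _ = (C₃ * (3 * B)) * 5 ^ (1 + β / 2) * δ ^ (a * (1 - γ)) *
            (1 + |t|) ^ (-(1 + β / 2)) := by ring
        _ ≤ _ := by
          gcongr
          have : 0 ≤ C₄ * (2 * B) := by positivity
          linarith
    · have : |h| ≤ δ ^ a := hh.trans hδs
      have : ‖x - x'‖ ≤ L * δ ^ a := hxx.trans (by gcongr)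
      have hLB : L + 1 ≤ 3 * B := by
        rw [hB]
        have : 0 ≤ C₂ * L ^ κ := by positivity
        linarith
      calc ‖x - x'‖ + |h| ≤ (L + 1) * δ ^ a := by linarith
        _ ≤ 3 * B * δ ^ (a * (1 - γ)) := by gcongr
    · calc ∫ τ in Set.Icc (-1) 2, |g τ| ≤ ∫ τ in Set.Icc (-1 : ℝ) 2, B * δ ^ a :=
            setIntegral_mono_on hi.abs (integrableOn_const (by simp)) measurableSet_Icc
              fun τ _ => hsup τ
        _ = 3 * B * δ ^ a := by
            simp only [integral_const, smul_eq_mul, Real.volume_real_Icc, measureReal_restrict_apply_univ]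
            norm_num
            ring
        _ ≤ _ := by gcongr
  · rw [timeDeriv_fundSol_sub hn hs0 hs1 hβ0 hβ1 hx0 hx0']
    have hM : B * δ ^ a ≤ 2 * B * δ ^ (a * (1 - γ)) := by nlinarith
    have := (h₄ g (2 * B * δ ^ (a * (1 - γ))) t hgm (fun τ => ?_)
      (fun τ => (hsup τ).trans hM)).2
    · refine this.trans ?_
      have e5 : 1 ≤ 5 ^ (1 + β / 2) * (1 + |t|) ^ (-(1 + β / 2)) := by
        rw [Real.rpow_neg (by positivity), ← div_eq_mul_inv, one_le_div (by positivity)]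
        gcongr
        linarith
      calc C₄ * (2 * B * δ ^ (a * (1 - γ))) = C₄ * (2 * B) * δ ^ (a * (1 - γ)) * 1 := by ring
        _ ≤ C₄ * (2 * B) * δ ^ (a * (1 - γ)) *
            (5 ^ (1 + β / 2) * (1 + |t|) ^ (-(1 + β / 2))) := by gcongr
        _ = C₄ * (2 * B) * 5 ^ (1 + β / 2) * δ ^ (a * (1 - γ)) * (1 + |t|) ^ (-(1 + β / 2)) := by
            ring
        _ ≤ _ := by
          gcongr
          have : 0 ≤ C₃ * (3 * B) := by positivity
          linarith
    · have b1 : |g τ - g t| ≤ 2 * B * |τ - t| := by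
        have e : g τ - g t = (fundSol s (x, τ) - fundSol s (x, t)) -
            (fundSol s (x', τ + h) - fundSol s (x', t + h)) := by simp only [hg]; ring
        rw [e]
        refine (abs_sub _ _).trans ((add_le_add (hlip x τ t hx) (hlip x' _ _ hx')).trans ?_)
        rw [show τ + h - (t + h) = τ - t by ring, ← add_mul]
        gcongr
        rw [hB]
        have : 0 ≤ C₂ * L ^ κ := by positivity
        linarith
      have b2 : |g τ - g t| ≤ 2 * B * δ ^ a :=
        (abs_sub _ _).trans (by linarith [hsup τ, hsup t])
      refine (le_rpow_mul_rpow (abs_nonneg _) b1 b2 hγ0 hγ1.le).trans (le_of_eq ?_)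
      have e2 : (2 * B) ^ γ * (2 * B) ^ (1 - γ) = 2 * B := by
        rw [← Real.rpow_add (by positivity)]; simp
      rw [Real.mul_rpow (by positivity) (abs_nonneg _), Real.mul_rpow (by positivity) hδa0.le,
        ← Real.rpow_mul hδ0.le]
      calc _ = ((2 * B) ^ γ * (2 * B) ^ (1 - γ)) * δ ^ (a * (1 - γ)) * |τ - t| ^ γ := by ring
        _ = _ := by rw [e2]

/-! ### Measurability and local integrability of the kernel -/

lemma measurable_timeDeriv_fundSol {n : ℕ} (s β : ℝ) :
    Measurable (timeDeriv (n := n) β (fundSol s)) := by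
  unfold timeDeriv
  refine (StronglyMeasurable.integral_prod_right (ν := volume)
    (f := fun (p : SpaceTime n) (τ : ℝ) => timeQuotient β (fundSol s) p τ)
    (Measurable.stronglyMeasurable ?_)).measurable
  have h := measurable_fundSol (n := n) s
  have h1 : Measurable fun q : SpaceTime n × ℝ => fundSol s (q.1.1, q.2) :=
    h.comp (measurable_fst.fst.prodMk measurable_snd)
  have h2 : Measurable fun q : SpaceTime n × ℝ => fundSol s q.1 := h.comp measurable_fst
  simp only [Function.uncurry_def, timeQuotient]
  fun_prop

/-- The locally integrable weight `|z|^{-a}` near the origin, continued by a constant. -/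
noncomputable def weight {E : Type*} [Norm E] (a : ℝ) (z : E) : ℝ≥0∞ :=
  ENNReal.ofReal (innerPow 1 (-a) ‖z‖ + 1)

lemma rpow_neg_le_innerPow_add_one {a r : ℝ} (ha : 0 ≤ a) (hr : 0 ≤ r) :
    r ^ (-a) ≤ innerPow 1 (-a) r + 1 := by
  unfold innerPow
  rw [abs_of_nonneg hr]
  split_ifs with h
  · linarith
  · rw [zero_add]
    exact Real.rpow_le_one_of_one_le_of_nonpos (not_lt.1 h) (by linarith)

lemma measurable_innerPow (r a : ℝ) : Measurable (innerPow r a) := by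
  unfold innerPow
  exact Measurable.ite (measurableSet_lt (by fun_prop) (by fun_prop)) (by fun_prop) (by fun_prop)

lemma measurable_weight {E : Type*} [NormedAddCommGroup E] [MeasurableSpace E] [BorelSpace E]
    (a : ℝ) : Measurable (weight (E := E) a) := by
  have := measurable_innerPow 1 (-a)
  unfold weight
  fun_prop

/-- By translation invariance the singular part contributes at most its total integral, wherever the
pole `y` lies, and the constant part contributes the volume. -/
lemma lintegral_weight_le {E : Type*} [NormedAddCommGroup E] [MeasureSpace E] [BorelSpace E]
    [(volume : Measure E).IsAddRightInvariant] {a : ℝ}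
    (hi : Integrable fun z : E => innerPow 1 (-a) ‖z‖) :
    ∃ M : ℝ≥0∞, M ≠ ⊤ ∧ ∀ (S : Set E) (y : E),
      ∫⁻ x in S, weight a (x - y) ≤ M + volume S := by
  refine ⟨∫⁻ z : E, ENNReal.ofReal (innerPow 1 (-a) ‖z‖), hi.lintegral_lt_top.ne, fun S y => ?_⟩
  have e : ∀ x, weight a (x - y) = ENNReal.ofReal (innerPow 1 (-a) ‖x - y‖) + 1 := fun x => by
    rw [weight, ENNReal.ofReal_add (innerPow_nonneg _ _ _) zero_le_one, ENNReal.ofReal_one]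
  simp only [e]
  rw [lintegral_add_right _ measurable_const, setLIntegral_const, one_mul]
  refine add_le_add ((setLIntegral_le_lintegral _ _).trans (le_of_eq ?_)) le_rfl
  exact lintegral_sub_right_eq_self (fun z : E => ENNReal.ofReal (innerPow 1 (-a) ‖z‖)) y

lemma integrable_innerPow_norm {n : ℕ} (hn : 1 ≤ n) {a : ℝ} (ha : a < n) :
    Integrable fun z : EuclideanSpace ℝ (Fin n) => innerPow 1 (-a) ‖z‖ := by
  have : Nonempty (Fin n) := ⟨⟨0, hn⟩⟩
  refine (integrable_fun_norm_addHaar volume (f := innerPow 1 (-a))).2 ?_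
  have h := (integrable_innerPow (r := 1) (a := n - 1 - a) one_pos (by linarith)).integrableOn
    (s := Set.Ioi 0)
  refine h.congr_fun (fun y hy => ?_) measurableSet_Ioi
  have hy : 0 < y := hy
  simp only [finrank_euclideanSpace, Fintype.card_fin, smul_eq_mul, innerPow, abs_of_pos hy]
  split_ifs
  · rw [← Real.rpow_natCast, ← Real.rpow_add hy, Nat.cast_sub hn]
    congr 1
    push_cast; ring
  · simp

lemma ae_fst_ne_and_snd_ne {n : ℕ} (hn : 1 ≤ n) (b : SpaceTime n) :
    ∀ᵐ p : SpaceTime n, p.1 ≠ b.1 ∧ p.2 ≠ b.2 := by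
  have : Nonempty (Fin n) := ⟨⟨0, hn⟩⟩
  have h1 : ∀ᵐ x : EuclideanSpace ℝ (Fin n), x ≠ b.1 := ae_iff.2 (by simp)
  have h2 : ∀ᵐ t : ℝ, t ≠ b.2 := ae_iff.2 (by simp)
  exact (Measure.quasiMeasurePreserving_fst.ae h1).and (Measure.quasiMeasurePreserving_snd.ae h2)

lemma setLIntegral_prod_mul {α β : Type*} [MeasureSpace α] [MeasureSpace β]
    [SFinite (volume : Measure α)] [SFinite (volume : Measure β)] {f : α → ℝ≥0∞} {g : β → ℝ≥0∞}
    (hf : Measurable f) (hg : Measurable g) (S : Set α) (T : Set β) :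
    ∫⁻ p : α × β in S ×ˢ T, f p.1 * g p.2 = (∫⁻ x in S, f x) * ∫⁻ y in T, g y := by
  rw [Measure.volume_eq_prod, ← Measure.prod_restrict,
    lintegral_prod_mul hf.aemeasurable hg.aemeasurable]

/-- The kernel is locally integrable, uniformly under translations. -/
lemma lintegral_timeDeriv_fundSol_le {n : ℕ} (hn : 1 ≤ n) {s β : ℝ} (hs0 : 0 < s)
    (hs1 : s ≤ 1) (hβ0 : 0 < β) (hβ1 : β < 1) :
    ∃ M : ℝ≥0∞, M ≠ ⊤ ∧ ∀ (S : Set (EuclideanSpace ℝ (Fin n))) (T : Set ℝ) (b : SpaceTime n),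
      ∫⁻ p in S ×ˢ T, ‖timeDeriv β (fundSol s) (p - b)‖ₑ ≤
        M * ((M + volume S) * (M + volume T)) := by
  -- Makes both singularities integrable: n - 2sε < n in space and β + ε < 1 in time.
  obtain ⟨ε, hε⟩ : ∃ ε : ℝ, ε = (1 - β) / 2 := ⟨_, rfl⟩
  have hε0 : 0 < ε := by rw [hε]; linarith
  have hε1 : ε ≤ 1 / 2 := by rw [hε]; linarith
  have hβε : β + ε < 1 := by rw [hε]; linarith
  obtain ⟨C, hC, h⟩ := timeDeriv_fundSol_abs_le (n := n) hn hs0 hs1 hβ0 hβ1 hε0 hε1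
  have hn1 : (1 : ℝ) ≤ n := by exact_mod_cast hn
  have hse : 2 * s * ε ≤ 1 := by nlinarith
  have hse0 : 0 < 2 * s * ε := by positivity
  obtain ⟨M₁, hM₁, h₁⟩ := lintegral_weight_le
    (integrable_innerPow_norm (n := n) hn (a := n - 2 * s * ε) (by linarith))
  have e : ∀ z : ℝ, innerPow 1 (-(β + ε)) ‖z‖ = innerPow 1 (-(β + ε)) z := fun z => by
    simp only [innerPow, Real.norm_eq_abs, abs_abs]
  obtain ⟨M₂, hM₂, h₂⟩ := lintegral_weight_le (E := ℝ) (a := β + ε)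
    (by simp only [e]; exact integrable_innerPow one_pos (by linarith))
  refine ⟨ENNReal.ofReal C + M₁ + M₂, by simp [hM₁, hM₂], fun S T b => ?_⟩
  calc ∫⁻ p in S ×ˢ T, ‖timeDeriv β (fundSol s) (p - b)‖ₑ
      ≤ ∫⁻ p : SpaceTime n in S ×ˢ T, ENNReal.ofReal C *
        (weight (n - 2 * s * ε) (p.1 - b.1) * weight (β + ε) (p.2 - b.2)) := by
        refine lintegral_mono_ae ((ae_restrict_of_ae (ae_fst_ne_and_snd_ne hn b)).mono
          fun p hp => ?_)
        rw [Real.enorm_eq_ofReal_abs, weight, weight, ← ENNReal.ofReal_mul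
          (add_nonneg (innerPow_nonneg _ _ _) zero_le_one), ← ENNReal.ofReal_mul hC.le]
        refine ENNReal.ofReal_le_ofReal ?_
        refine (h (p.1 - b.1) (p.2 - b.2) (sub_ne_zero.2 hp.1) (sub_ne_zero.2 hp.2)).trans ?_
        rw [mul_assoc]
        have e1 := rpow_neg_le_innerPow_add_one (a := n - 2 * s * ε) (by linarith)
          (norm_nonneg (p.1 - b.1))
        have e2 := rpow_neg_le_innerPow_add_one (a := β + ε) (by linarith)
          (norm_nonneg (p.2 - b.2))
        rw [← Real.norm_eq_abs (p.2 - b.2)]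
        gcongr
        exact add_nonneg (innerPow_nonneg _ _ _) zero_le_one
    _ = ENNReal.ofReal C * ((∫⁻ x in S, weight (n - 2 * s * ε) (x - b.1)) *
        ∫⁻ t in T, weight (β + ε) (t - b.2)) := by
        have m1 : Measurable fun x : EuclideanSpace ℝ (Fin n) =>
          weight (n - 2 * s * ε) (x - b.1) := (measurable_weight _).comp (measurable_sub_const _)
        have m2 : Measurable fun t : ℝ => weight (β + ε) (t - b.2) :=
          (measurable_weight _).comp (measurable_sub_const _)
        rw [lintegral_const_mul' _ _ ENNReal.ofReal_ne_top, setLIntegral_prod_mul m1 m2]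
    _ ≤ ENNReal.ofReal C * ((M₁ + volume S) * (M₂ + volume T)) := by
        gcongr
        exacts [h₁ S b.1, h₂ T b.2]
    _ ≤ _ := by
        gcongr
        · exact (le_add_right (le_add_right le_rfl))
        · exact (le_add_right (le_add_left le_rfl))
        · exact le_add_left le_rfl

/-! ### Oscillation of the kernel over the unit cube -/

/-- The spatial unit cube centred at the origin. -/
def unitCube (n : ℕ) : Set (EuclideanSpace ℝ (Fin n)) := {x | ∀ i, |x i| ≤ 1 / 2}

lemma parabolicCube_zero_one {n : ℕ} (s : ℝ) :
    parabolicCube (n := n) s 0 1 = unitCube n ×ˢ Set.Icc (-(1 / 2)) (1 / 2) := by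
  ext p
  simp [parabolicCube, unitCube, abs_le]

lemma norm_le_of_mem_unitCube {n : ℕ} {x : EuclideanSpace ℝ (Fin n)} (hx : x ∈ unitCube n) :
    ‖x‖ ≤ Real.sqrt n / 2 := by
  rw [EuclideanSpace.norm_eq]
  have h : ∑ i, ‖x i‖ ^ 2 ≤ n * (1 / 2) ^ 2 := by
    calc ∑ i, ‖x i‖ ^ 2 ≤ ∑ _i : Fin n, (1 / 2 : ℝ) ^ 2 := by
          gcongr with i
          exact hx i
      _ = n * (1 / 2) ^ 2 := by simp
  calc Real.sqrt (∑ i, ‖x i‖ ^ 2) ≤ Real.sqrt (n * (1 / 2) ^ 2) := Real.sqrt_le_sqrt h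
    _ = Real.sqrt n / 2 := by
      rw [Real.sqrt_mul (by positivity), Real.sqrt_sq (by norm_num)]; ring

lemma isClosed_parabolicCube {n : ℕ} (s : ℝ) (p : SpaceTime n) (l : ℝ) :
    IsClosed (parabolicCube s p l) := by
  unfold parabolicCube
  rw [Set.ofPred_and, Set.ofPred_forall]
  refine (isClosed_iInter fun i => isClosed_le ?_ continuous_const).inter
    (isClosed_le (by fun_prop) continuous_const)
  fun_prop

lemma measurableSet_parabolicCube {n : ℕ} (s : ℝ) (p : SpaceTime n) (l : ℝ) :
    MeasurableSet (parabolicCube s p l) := (isClosed_parabolicCube s p l).measurableSet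

lemma volume_unitCube_lt_top (n : ℕ) : volume (unitCube n) < ⊤ := by
  refine (measure_mono fun x hx => ?_).trans_lt
    (measure_closedBall_lt_top (x := (0 : EuclideanSpace ℝ (Fin n))) (r := Real.sqrt n / 2))
  rw [mem_closedBall_zero_iff]
  exact norm_le_of_mem_unitCube hx

lemma volume_parabolicCube_zero_one_ne_top {n : ℕ} (s : ℝ) :
    volume (parabolicCube (n := n) s 0 1) ≠ ⊤ := by
  rw [parabolicCube_zero_one, Measure.volume_eq_prod, Measure.prod_prod]
  exact ENNReal.mul_ne_top (volume_unitCube_lt_top n).ne (by simp)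

lemma volume_parabolicCube_zero_one_ne_zero {n : ℕ} (s : ℝ) :
    volume (parabolicCube (n := n) s 0 1) ≠ 0 := by
  have hsub : Metric.ball (0 : SpaceTime n) (1 / 2) ⊆ parabolicCube s 0 1 := by
    intro p hp
    rw [mem_ball_zero_iff, Prod.norm_def, max_lt_iff] at hp
    rw [parabolicCube_zero_one]
    refine ⟨fun i => ?_, ?_⟩
    · exact (PiLp.norm_apply_le p.1 i).trans hp.1.le
    · exact abs_le.1 hp.2.le
  exact ((Metric.measure_ball_pos volume _ (by norm_num)).trans_le (measure_mono hsub)).ne'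

/-- The oscillation of the kernel over the unit cube, seen from `b`. -/
noncomputable def kernelOsc {n : ℕ} (s β : ℝ) (b : SpaceTime n) : ℝ≥0∞ :=
  ∫⁻ p in parabolicCube s 0 1, ∫⁻ p' in parabolicCube s 0 1,
    ‖timeDeriv β (fundSol s) (p - b) - timeDeriv β (fundSol s) (p' - b)‖ₑ

/-- Cells whose size is comparable to their distance to the time axis. -/
def axisCell {n : ℕ} (s : ℝ) (j : ℕ) (k : ℤ) : Set (SpaceTime n) :=
  {b | (j = 0 ∨ 2 ^ j * Real.sqrt n ≤ ‖b.1‖) ∧ ‖b.1‖ ≤ 2 ^ j * (2 * Real.sqrt n) ∧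
    k * ((2 : ℝ) ^ j) ^ (2 * s) ≤ b.2 ∧ b.2 ≤ (k + 1) * ((2 : ℝ) ^ j) ^ (2 * s)}

lemma abs_int_le_of_mem {u : ℝ} {k : ℤ} (h1 : (k : ℝ) ≤ u) (h2 : u ≤ k + 1) :
    |(k : ℝ)| - 1 ≤ |u| := by
  rcases le_total 0 (k : ℝ) with h | h
  · rw [abs_of_nonneg h, abs_of_nonneg (h.trans h1)]; linarith
  · rw [abs_of_nonpos h]
    linarith [neg_abs_le u]

lemma kernelOsc_le_of_bound {n : ℕ} {s β : ℝ} {b : SpaceTime n} {B : ℝ}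
    (h : ∀ p ∈ parabolicCube (n := n) s 0 1, ∀ p' ∈ parabolicCube (n := n) s 0 1,
      |timeDeriv β (fundSol s) (p - b) - timeDeriv β (fundSol s) (p' - b)| ≤ B) :
    kernelOsc s β b ≤ ENNReal.ofReal B * volume (parabolicCube (n := n) s 0 1) *
      volume (parabolicCube (n := n) s 0 1) := by
  unfold kernelOsc
  calc _ ≤ ∫⁻ p in parabolicCube (n := n) s 0 1, ∫⁻ p' in parabolicCube (n := n) s 0 1,
        ENNReal.ofReal B := by
        refine setLIntegral_mono measurable_const fun p hp => ?_
        refine setLIntegral_mono measurable_const fun p' hp' => ?_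
        rw [Real.enorm_eq_ofReal_abs]
        exact ENNReal.ofReal_le_ofReal (h p hp p' hp')
    _ = _ := by rw [setLIntegral_const, setLIntegral_const]

lemma setLIntegral_setLIntegral_add {α : Type*} [MeasurableSpace α] {μ : Measure α} {Q : Set α}
    {f : α → ℝ≥0∞} (hf : Measurable f) :
    ∫⁻ p in Q, ∫⁻ p' in Q, (f p + f p') ∂μ ∂μ = 2 * μ Q * ∫⁻ p in Q, f p ∂μ := by
  have e : ∀ p, ∫⁻ p' in Q, (f p + f p') ∂μ = f p * μ Q + ∫⁻ p' in Q, f p' ∂μ := fun p => by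
    rw [lintegral_add_left measurable_const, setLIntegral_const]
  simp only [e]
  rw [lintegral_add_left (hf.mul_const _), lintegral_mul_const _ hf, setLIntegral_const]
  ring

lemma norm_sub_le_of_mem_unitCube {n : ℕ} {x x' : EuclideanSpace ℝ (Fin n)}
    (hx : x ∈ unitCube n) (hx' : x' ∈ unitCube n) : ‖x - x'‖ ≤ Real.sqrt n := by
  linarith [norm_sub_le x x', norm_le_of_mem_unitCube hx, norm_le_of_mem_unitCube hx']

lemma rpow_neg_le_two_rpow_mul {a u v : ℝ} (ha : 0 ≤ a) (hu : 0 < u) (h : u / 2 ≤ v) :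
    v ^ (-a) ≤ 2 ^ a * u ^ (-a) := by
  calc v ^ (-a) ≤ (u / 2) ^ (-a) :=
        Real.rpow_le_rpow_of_nonpos (by positivity) h (by linarith)
    _ = 2 ^ a * u ^ (-a) := by
        rw [Real.div_rpow hu.le zero_le_two, Real.rpow_neg zero_le_two, div_inv_eq_mul, mul_comm]

/-- The triangle inequality and uniform local integrability suffice; the bound serves the finitely
many cells around the origin. -/
lemma kernelOsc_le {n : ℕ} (hn : 1 ≤ n) {s β : ℝ} (hs0 : 0 < s)
    (hs1 : s ≤ 1) (hβ0 : 0 < β) (hβ1 : β < 1) :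
    ∃ M : ℝ≥0∞, M ≠ ⊤ ∧ ∀ b : SpaceTime n, kernelOsc s β b ≤ M := by
  obtain ⟨M, hM, h⟩ := lintegral_timeDeriv_fundSol_le hn hs0 hs1 hβ0 hβ1
  have hv := volume_parabolicCube_zero_one_ne_top (n := n) s
  have hu := (volume_unitCube_lt_top n).ne
  refine ⟨2 * volume (parabolicCube (n := n) s 0 1) *
    (M * ((M + volume (unitCube n)) * (M + volume (Set.Icc (-(1 / 2 : ℝ)) (1 / 2))))),
    ENNReal.mul_ne_top (ENNReal.mul_ne_top (by simp) hv) (ENNReal.mul_ne_top hM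
      (ENNReal.mul_ne_top (by simp [hM, hu]) (by simp [hM]))), fun b => ?_⟩
  have hm : Measurable fun p : SpaceTime n => ‖timeDeriv β (fundSol s) (p - b)‖ₑ :=
    ((measurable_timeDeriv_fundSol s β).comp (measurable_sub_const b)).enorm
  calc kernelOsc s β b ≤ ∫⁻ p in parabolicCube (n := n) s 0 1, ∫⁻ p' in parabolicCube s 0 1,
        (‖timeDeriv β (fundSol s) (p - b)‖ₑ + ‖timeDeriv β (fundSol s) (p' - b)‖ₑ) :=
        lintegral_mono fun p => lintegral_mono fun p' => enorm_sub_le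
    _ = _ := setLIntegral_setLIntegral_add hm
    _ ≤ _ := by
        gcongr
        rw [parabolicCube_zero_one]
        exact h _ _ b

/-- Here the cube may meet the vertical line through `b`. The spatial singularity, of order n - s <
n, is integrated over the cube, and the large time separation supplies the decay. The threshold 9/2
leaves a separation of at least 4 for every point of the cube. -/
lemma kernelOsc_le_near_axis {n : ℕ} (hn : 1 ≤ n) {s β : ℝ} (hs0 : 0 < s)
    (hs1 : s ≤ 1) (hβ0 : 0 < β) (hβ1 : β < 1) :
    ∃ M : ℝ≥0∞, M ≠ ⊤ ∧ ∀ b : SpaceTime n, ‖b.1‖ ≤ 2 * Real.sqrt n → 9 / 2 ≤ |b.2| →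
      kernelOsc s β b ≤ M * ENNReal.ofReal (|b.2| ^ (-(1 + β / 2))) := by
  have hn1 : (1 : ℝ) ≤ n := by exact_mod_cast hn
  obtain ⟨C, hC, h⟩ := timeDeriv_fundSol_sub_le_near_axis (n := n) hn hs0 hs1 hβ0 hβ1
    (ε := 1 / 2) (by norm_num) le_rfl (R := 3 * Real.sqrt n) (by positivity)
  obtain ⟨a, ha⟩ : ∃ a : ℝ, a = n - 2 * s * (1 / 2) := ⟨_, rfl⟩
  rw [← ha] at h
  have ha0 : 0 ≤ a := by rw [ha]; linarith
  obtain ⟨M₁, hM₁, h₁⟩ := lintegral_weight_le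
    (integrable_innerPow_norm (n := n) hn (a := a) (by rw [ha]; linarith))
  have hv := volume_parabolicCube_zero_one_ne_top (n := n) s
  have hu := (volume_unitCube_lt_top n).ne
  refine ⟨ENNReal.ofReal (2 * C * 2 ^ (1 + β / 2)) *
    (2 * volume (parabolicCube (n := n) s 0 1) * (M₁ + volume (unitCube n))),
    ENNReal.mul_ne_top (by simp) (ENNReal.mul_ne_top (ENNReal.mul_ne_top (by simp) hv)
      (by simp [hM₁, hu])), fun b hb1 hb2 => ?_⟩
  have hm1 : Measurable fun x : EuclideanSpace ℝ (Fin n) => weight a (x - b.1) :=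
    (measurable_weight a).comp (measurable_sub_const b.1)
  have hm : Measurable fun p : SpaceTime n => weight a (p.1 - b.1) := hm1.comp measurable_fst
  obtain ⟨D, hD⟩ : ∃ D, D = 2 * C * 2 ^ (1 + β / 2) * |b.2| ^ (-(1 + β / 2)) := ⟨_, rfl⟩
  have hD0 : 0 ≤ D := by rw [hD]; positivity
  have key : ∀ p ∈ parabolicCube (n := n) s 0 1, ∀ p' ∈ parabolicCube (n := n) s 0 1,
      (p.1 ≠ b.1 ∧ p.2 ≠ b.2) → (p'.1 ≠ b.1 ∧ p'.2 ≠ b.2) →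
      ‖timeDeriv β (fundSol s) (p - b) - timeDeriv β (fundSol s) (p' - b)‖ₑ ≤
        ENNReal.ofReal D * (weight a (p.1 - b.1) + weight a (p'.1 - b.1)) := by
    intro p hp p' hp' hpb hpb'
    rw [parabolicCube_zero_one] at hp hp'
    have i1 := innerPow_nonneg 1 (-a) ‖p.1 - b.1‖
    have i2 := innerPow_nonneg 1 (-a) ‖p'.1 - b.1‖
    rw [weight, weight, ← ENNReal.ofReal_add (by linarith) (by linarith),
      ← ENNReal.ofReal_mul hD0, Real.enorm_eq_ofReal_abs]
    refine ENNReal.ofReal_le_ofReal ?_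
    have e1 := rpow_neg_le_innerPow_add_one ha0 (norm_nonneg (p.1 - b.1))
    have e2 := rpow_neg_le_innerPow_add_one ha0 (norm_nonneg (p'.1 - b.1))
    have n1 := norm_sub_le p.1 b.1
    have n2 := norm_sub_le p'.1 b.1
    have n3 := norm_le_of_mem_unitCube hp.1
    have n4 := norm_le_of_mem_unitCube hp'.1
    have hsq := Real.sqrt_nonneg (n : ℝ)
    have t1 : |p.2| ≤ 1 / 2 := abs_le.2 hp.2
    have t2 : |p'.2| ≤ 1 / 2 := abs_le.2 hp'.2
    have t3 : |b.2| - 1 / 2 ≤ |p.2 - b.2| := by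
      rw [abs_sub_comm]; linarith [abs_sub_abs_le_abs_sub b.2 p.2]
    have t4 : |p'.2 - p.2| ≤ 1 := by linarith [abs_sub p'.2 p.2]
    have h0 := h (p.1 - b.1) (p'.1 - b.1) (p'.2 - p.2) (p.2 - b.2) (sub_ne_zero.2 hpb.1)
      (sub_ne_zero.2 hpb'.1) (by linarith) (by linarith) t4 (by linarith)
    have e : p.2 - b.2 + (p'.2 - p.2) = p'.2 - b.2 := by ring
    rw [e] at h0
    refine h0.trans ?_
    have h5 := rpow_neg_le_two_rpow_mul (a := 1 + β / 2) (u := |b.2|) (v := |p.2 - b.2|)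
      (by linarith) (by linarith) (by linarith)
    calc _ ≤ C * (2 * (innerPow 1 (-a) ‖p.1 - b.1‖ + 1 + (innerPow 1 (-a) ‖p'.1 - b.1‖ + 1))) *
          (2 ^ (1 + β / 2) * |b.2| ^ (-(1 + β / 2))) := by
          gcongr
          linarith
      _ = _ := by rw [hD]; ring
  calc kernelOsc s β b ≤ ∫⁻ p in parabolicCube (n := n) s 0 1, ∫⁻ p' in parabolicCube s 0 1,
        ENNReal.ofReal D * (weight a (p.1 - b.1) + weight a (p'.1 - b.1)) := by
        have hae := ae_fst_ne_and_snd_ne hn b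
        have hQ := measurableSet_parabolicCube (n := n) s 0 1
        refine setLIntegral_mono_ae' hQ (hae.mono fun p hp hpQ => ?_)
        exact setLIntegral_mono_ae' hQ (hae.mono fun p' hp' hpQ' => key p hpQ p' hpQ' hp hp')
    _ = ENNReal.ofReal D * (2 * volume (parabolicCube (n := n) s 0 1) *
          ∫⁻ p in parabolicCube (n := n) s 0 1, weight a (p.1 - b.1)) := by
        simp only [lintegral_const_mul' _ _ ENNReal.ofReal_ne_top]
        rw [setLIntegral_setLIntegral_add hm]
    _ ≤ ENNReal.ofReal D * (2 * volume (parabolicCube (n := n) s 0 1) *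
          (M₁ + volume (unitCube n))) := by
        gcongr
        rw [parabolicCube_zero_one]
        have := setLIntegral_prod_mul hm1 (g := fun _ : ℝ => 1) measurable_const (unitCube n)
          (Set.Icc (-(1 / 2)) (1 / 2))
        simp only [mul_one] at this
        rw [this, setLIntegral_const, Real.volume_Icc]
        norm_num
        exact h₁ _ _
    _ = _ := by
        rw [hD, ENNReal.ofReal_mul (by positivity)]
        ring

/-- Scaling by δ puts `b` at spatial distance of order one from the axis and shrinks the cube to
size δ. Homogeneity then yields δ^{n + 2sβ}, and Hölder regularity the additional δ^α. -/
lemma kernelOsc_le_away {n : ℕ} (hn : 1 ≤ n) {s β : ℝ} (hs0 : 0 < s)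
    (hs1 : s ≤ 1) (hβ0 : 0 < β) (hβ1 : β < 1) :
    ∃ (M : ℝ≥0∞) (α : ℝ), M ≠ ⊤ ∧ 0 < α ∧ ∀ (b : SpaceTime n) (δ : ℝ), 0 < δ → δ ≤ 1 →
      Real.sqrt n ≤ δ * ‖b.1‖ → δ * ‖b.1‖ ≤ 2 * Real.sqrt n →
      kernelOsc s β b ≤ M * ENNReal.ofReal
        (δ ^ (n + 2 * s * β + α) * (1 + |δ ^ (2 * s) * b.2|) ^ (-(1 + β / 2))) := by
  have hn1 : (1 : ℝ) ≤ n := by exact_mod_cast hn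
  have hsq : 1 ≤ Real.sqrt n := Real.one_le_sqrt.2 hn1
  obtain ⟨C, α, hC, hα, h⟩ := timeDeriv_fundSol_sub_le_away (n := n) hn hs0 hs1 hβ0 hβ1
    (R := 3 * Real.sqrt n) (L := Real.sqrt n) (by positivity) (by positivity)
  have hv := volume_parabolicCube_zero_one_ne_top (n := n) s
  refine ⟨ENNReal.ofReal (C * 2 ^ (1 + β / 2)) * volume (parabolicCube (n := n) s 0 1) *
    volume (parabolicCube (n := n) s 0 1), α, ENNReal.mul_ne_top (ENNReal.mul_ne_top (by simp) hv)
      hv, hα, fun b δ hδ0 hδ1 hb1 hb2 => ?_⟩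
  have hδs : δ ^ (2 * s) ≤ 1 := Real.rpow_le_one hδ0.le hδ1 (by linarith)
  have hδs0 : 0 < δ ^ (2 * s) := by positivity
  have hx : ∀ x ∈ unitCube n, 1 / 2 ≤ ‖δ • (x - b.1)‖ ∧ ‖δ • (x - b.1)‖ ≤ 3 * Real.sqrt n := by
    intro x hx
    have n1 := norm_le_of_mem_unitCube hx
    have n2 := mul_le_mul_of_nonneg_left (norm_sub_le x b.1) hδ0.le
    have n3 := mul_le_mul_of_nonneg_left (norm_sub_norm_le b.1 x) hδ0.le
    have n4 : δ * ‖x‖ ≤ Real.sqrt n / 2 := by nlinarith [norm_nonneg x]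
    rw [norm_sub_rev] at n3
    rw [norm_smul, Real.norm_of_nonneg hδ0.le]
    constructor <;> nlinarith
  have hscale : ∀ p : SpaceTime n, timeDeriv β (fundSol s) (p - b) = δ ^ (n + 2 * s * β) *
      timeDeriv β (fundSol s) (δ • (p.1 - b.1), δ ^ (2 * s) * (p.2 - b.2)) := by
    intro p
    rw [timeDeriv_fundSol_smul s β hδ0, ← mul_assoc, ← Real.rpow_add hδ0, add_neg_cancel,
      Real.rpow_zero, one_mul]
    rfl
  refine (kernelOsc_le_of_bound (B := C * 2 ^ (1 + β / 2) * (δ ^ (n + 2 * s * β + α) *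
    (1 + |δ ^ (2 * s) * b.2|) ^ (-(1 + β / 2)))) fun p hp p' hp' => ?_).trans (le_of_eq ?_)
  · rw [parabolicCube_zero_one] at hp hp'
    have t1 : |p.2| ≤ 1 / 2 := abs_le.2 hp.2
    have t2 : |p'.2| ≤ 1 / 2 := abs_le.2 hp'.2
    have t4 : |δ ^ (2 * s) * (p'.2 - p.2)| ≤ δ ^ (2 * s) := by
      rw [abs_mul, abs_of_pos hδs0]
      nlinarith [abs_sub p'.2 p.2]
    have t3 : |δ ^ (2 * s) * b.2| - 1 / 2 ≤ |δ ^ (2 * s) * (p.2 - b.2)| := by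
      rw [abs_mul, abs_mul, abs_of_pos hδs0, abs_sub_comm]
      nlinarith [abs_sub_abs_le_abs_sub b.2 p.2]
    have t5 : ‖δ • (p.1 - b.1) - δ • (p'.1 - b.1)‖ ≤ Real.sqrt n * δ := by
      rw [← smul_sub, norm_smul, Real.norm_of_nonneg hδ0.le, sub_sub_sub_cancel_right, mul_comm]
      gcongr
      exact norm_sub_le_of_mem_unitCube hp.1 hp'.1
    have h0 := h _ _ _ (δ ^ (2 * s) * (p.2 - b.2)) δ (hx p.1 hp.1).1 (hx p'.1 hp'.1).1
      (hx p.1 hp.1).2 (hx p'.1 hp'.1).2 hδ0 hδ1 t5 t4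
    have e : δ ^ (2 * s) * (p.2 - b.2) + δ ^ (2 * s) * (p'.2 - p.2) =
      δ ^ (2 * s) * (p'.2 - b.2) := by ring
    rw [e] at h0
    rw [hscale p, hscale p', ← mul_sub, abs_mul, abs_of_pos (by positivity)]
    have h5 := rpow_neg_le_two_rpow_mul (a := 1 + β / 2) (u := 1 + |δ ^ (2 * s) * b.2|)
      (v := 1 + |δ ^ (2 * s) * (p.2 - b.2)|) (by linarith) (by positivity)
      (by linarith [abs_nonneg (δ ^ (2 * s) * b.2)])
    calc _ ≤ δ ^ (n + 2 * s * β) * (C * δ ^ α *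
          (2 ^ (1 + β / 2) * (1 + |δ ^ (2 * s) * b.2|) ^ (-(1 + β / 2)))) := by
          gcongr
          exact h0.trans (by gcongr)
      _ = _ := by rw [Real.rpow_add hδ0 _ α]; ring
  · rw [ENNReal.ofReal_mul (by positivity)]
    ring

/-- Three regimes: bounded oscillation near the origin, time decay along the axis, and, with δ =
2^{-j}, the Hölder gain away from the axis. -/
lemma kernelOsc_le_axisCell {n : ℕ} (hn : 1 ≤ n) {s β : ℝ} (hs0 : 0 < s)
    (hs1 : s ≤ 1) (hβ0 : 0 < β) (hβ1 : β < 1) :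
    ∃ (M : ℝ≥0∞) (α : ℝ), M ≠ ⊤ ∧ 0 < α ∧ ∀ (j : ℕ) (k : ℤ), ∀ b ∈ axisCell (n := n) s j k,
      kernelOsc s β b ≤ M * ENNReal.ofReal
        (((2 : ℝ) ^ j) ^ (-(n + 2 * s * β + α)) * (1 + |(k : ℝ)|) ^ (-(1 + β / 2))) := by
  obtain ⟨M₁, hM₁, h₁⟩ := kernelOsc_le hn hs0 hs1 hβ0 hβ1
  obtain ⟨M₂, hM₂, h₂⟩ := kernelOsc_le_near_axis hn hs0 hs1 hβ0 hβ1
  obtain ⟨M₃, α, hM₃, hα, h₃⟩ := kernelOsc_le_away hn hs0 hs1 hβ0 hβ1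
  obtain ⟨c, hc⟩ : ∃ c, c = ENNReal.ofReal (2 ^ (1 + β / 2)) := ⟨_, rfl⟩
  obtain ⟨d, hd⟩ : ∃ d, d = ENNReal.ofReal (7 ^ (1 + β / 2)) := ⟨_, rfl⟩
  refine ⟨M₁ * d + M₂ * c + M₃ * c, α, ?_, hα, fun j k b hb => ?_⟩
  · have : c ≠ ⊤ := by simp [hc]
    have : d ≠ ⊤ := by simp [hd]
    finiteness
  obtain ⟨hb1, hb2, hb3, hb4⟩ := hb
  have hk := abs_nonneg (k : ℝ)
  rcases eq_or_ne j 0 with rfl | hj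
  · simp only [pow_zero, Real.one_rpow, one_mul, mul_one] at hb2 hb3 hb4 ⊢
    -- Beyond 6 the cell lies at times larger than 5 in absolute value, past the threshold 9/2; up
    -- to 6 the weight (1 + |k|)^{-(1 + β/2)} is bounded below, which is where the 7 in `d` comes
    -- from.
    rcases le_or_gt |(k : ℝ)| 6 with h6 | h6
    · refine (h₁ b).trans ?_
      calc M₁ ≤ M₁ * (d * ENNReal.ofReal ((1 + |(k : ℝ)|) ^ (-(1 + β / 2)))) := by
            refine le_mul_of_one_le_right' ?_
            rw [hd, ← ENNReal.ofReal_mul (by positivity), ← ENNReal.ofReal_one]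
            refine ENNReal.ofReal_le_ofReal ?_
            rw [Real.rpow_neg (by positivity), ← div_eq_mul_inv, one_le_div (by positivity)]
            exact Real.rpow_le_rpow (by positivity) (by linarith) (by positivity)
        _ ≤ _ := by
            rw [← mul_assoc]
            gcongr
            exact le_add_right (le_add_right le_rfl)
    · have hbk := abs_int_le_of_mem hb3 hb4
      refine (h₂ b hb2 (by linarith)).trans ?_
      calc M₂ * ENNReal.ofReal (|b.2| ^ (-(1 + β / 2)))
          ≤ M₂ * (c * ENNReal.ofReal ((1 + |(k : ℝ)|) ^ (-(1 + β / 2)))) := by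
            gcongr
            rw [hc, ← ENNReal.ofReal_mul (by positivity)]
            exact ENNReal.ofReal_le_ofReal
              (rpow_neg_le_two_rpow_mul (by positivity) (by positivity) (by linarith))
        _ ≤ _ := by
            rw [← mul_assoc]
            gcongr
            exact le_add_right (le_add_left le_rfl)
  · have h2j : (0 : ℝ) < 2 ^ j := by positivity
    have hδ : ((2 : ℝ) ^ j)⁻¹ ^ (2 * s) * ((2 : ℝ) ^ j) ^ (2 * s) = 1 := by
      rw [← Real.mul_rpow (by positivity) (by positivity), inv_mul_cancel₀ h2j.ne', Real.one_rpow]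
    have hδ0 : 0 < ((2 : ℝ) ^ j)⁻¹ ^ (2 * s) := by positivity
    have hbk : |(k : ℝ)| - 1 ≤ |((2 : ℝ) ^ j)⁻¹ ^ (2 * s) * b.2| := by
      refine abs_int_le_of_mem ?_ ?_
      · have := mul_le_mul_of_nonneg_left hb3 hδ0.le
        rwa [mul_left_comm, hδ, mul_one] at this
      · have := mul_le_mul_of_nonneg_left hb4 hδ0.le
        rwa [mul_left_comm _ ((k : ℝ) + 1), hδ, mul_one] at this
    have hb1' := hb1.resolve_left hj
    refine (h₃ b ((2 : ℝ) ^ j)⁻¹ (by positivity) (inv_le_one_of_one_le₀ (one_le_pow₀ one_le_two))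
      ((le_inv_mul_iff₀ h2j).2 hb1') ((inv_mul_le_iff₀ h2j).2 hb2)).trans ?_
    calc _ ≤ M₃ * (c * ENNReal.ofReal
          (((2 : ℝ) ^ j) ^ (-(n + 2 * s * β + α)) * (1 + |(k : ℝ)|) ^ (-(1 + β / 2)))) := by
          gcongr
          rw [hc, ← ENNReal.ofReal_mul (by positivity), Real.inv_rpow h2j.le,
            ← Real.rpow_neg h2j.le, mul_left_comm]
          refine ENNReal.ofReal_le_ofReal (mul_le_mul_of_nonneg_left ?_ (by positivity))
          refine rpow_neg_le_two_rpow_mul (by positivity) (by positivity) ?_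
          linarith [abs_nonneg (((2 : ℝ) ^ j)⁻¹ ^ (2 * s) * b.2)]
      _ ≤ _ := by
          rw [← mul_assoc]
          gcongr
          exact le_add_left le_rfl

/-! ### Covering by cells and summation -/

lemma exists_mem_axisCell {n : ℕ} (hn : 1 ≤ n) (s : ℝ) (b : SpaceTime n) :
    ∃ (j : ℕ) (k : ℤ), b ∈ axisCell s j k := by
  have hsq : 0 < Real.sqrt n := Real.sqrt_pos.2 (by exact_mod_cast hn)
  have hex : ∃ j : ℕ, ‖b.1‖ ≤ 2 ^ j * (2 * Real.sqrt n) := by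
    obtain ⟨j, hj⟩ := pow_unbounded_of_one_lt (‖b.1‖ / (2 * Real.sqrt n)) (one_lt_two (α := ℝ))
    exact ⟨j, ((div_lt_iff₀ (by positivity)).1 hj).le⟩
  classical
  have hL : 0 < ((2 : ℝ) ^ Nat.find hex) ^ (2 * s) := by positivity
  -- Minimality of `j` provides the lower bound on the distance: failure of the upper bound at j - 1
  -- is precisely 2^j √n < ‖b.1‖.
  refine ⟨Nat.find hex, ⌊b.2 / ((2 : ℝ) ^ Nat.find hex) ^ (2 * s)⌋, ?_, Nat.find_spec hex,
    (le_div_iff₀ hL).1 (Int.floor_le _), ((div_lt_iff₀ hL).1 (Int.lt_floor_add_one _)).le⟩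
  rcases h : Nat.find hex with _ | m
  · exact Or.inl rfl
  · right
    have := Nat.find_min hex (m := m) (by omega)
    rw [pow_succ]
    linarith [not_le.1 this]

lemma axisCell_subset_parabolicBall {n : ℕ} {s : ℝ} (hs0 : 0 < s) (j : ℕ) (k : ℤ) :
    axisCell (n := n) s j k ⊆
      parabolicBall s (0, (k + 1 / 2) * ((2 : ℝ) ^ j) ^ (2 * s))
        (2 ^ j * (2 * Real.sqrt n + 1)) := by
  rintro b ⟨-, h1, h2, h3⟩
  have h2j : (0 : ℝ) < 2 ^ j := by positivity
  have hsq := Real.sqrt_nonneg (n : ℝ)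
  refine ⟨?_, ?_⟩
  · rw [dist_zero_right]
    linarith
  · have h4 : ((2 : ℝ) ^ j) ^ (2 * s) < (2 * (2 ^ j * (2 * Real.sqrt n + 1))) ^ (2 * s) :=
      Real.rpow_lt_rpow h2j.le (by nlinarith) (by linarith)
    refine lt_of_le_of_lt (abs_le.2 ⟨?_, ?_⟩) (div_lt_div_of_pos_right h4 zero_lt_two) <;>
      dsimp only <;> linarith

lemma summable_cell_weights {α a : ℝ} (hα : 0 < α) (ha : 1 < a) :
    Summable fun q : ℕ × ℤ => ((2 : ℝ) ^ q.1) ^ (-α) * (1 + |(q.2 : ℝ)|) ^ (-a) := by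
  have h1 : Summable fun j : ℕ => ((2 : ℝ) ^ j) ^ (-α) := by
    have e : (fun j : ℕ => ((2 : ℝ) ^ j) ^ (-α)) = fun j : ℕ => ((2 : ℝ) ^ (-α)) ^ j := by
      funext j
      rw [← Real.rpow_natCast, ← Real.rpow_natCast, ← Real.rpow_mul zero_le_two,
        ← Real.rpow_mul zero_le_two, mul_comm]
    rw [e]
    exact summable_geometric_of_lt_one (by positivity)
      (Real.rpow_lt_one_of_one_lt_of_neg one_lt_two (by linarith))
  have h0 : Summable fun k : ℕ => (1 + (k : ℝ)) ^ (-a) := by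
    have := (summable_nat_add_iff 1).2 (Real.summable_nat_rpow.2 (show -a < -1 by linarith))
    refine this.congr fun k => ?_
    push_cast
    rw [add_comm]
  have h2 : Summable fun k : ℤ => (1 + |(k : ℝ)|) ^ (-a) := by
    refine Summable.of_nat_of_neg ?_ ?_ <;> simpa using h0
  exact h1.mul_of_nonneg h2 (fun _ => by positivity) (fun _ => by positivity)

/-- On each cell the growth of the measure cancels 2^{-j(n + 2sβ)} exactly, so the gain 2^{-jα} sums
over `j` and the time decay sums over `k`. The cells may overlap, which does no harm to an upper
bound. -/
lemma lintegral_kernelOsc_le {n : ℕ} (hn : 1 ≤ n) {s β : ℝ} (hs0 : 0 < s)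
    (hs1 : s ≤ 1) (hβ0 : 0 < β) (hβ1 : β < 1) :
    ∃ M : ℝ≥0∞, M ≠ ⊤ ∧ ∀ (ν : Measure (SpaceTime n)) (A : ℝ),
      HasParabolicGrowth s (n + 2 * s * β) A ν →
        ∫⁻ b, kernelOsc s β b ∂ν ≤ M * ENNReal.ofReal A := by
  obtain ⟨M, α, hM, hα, h⟩ := kernelOsc_le_axisCell hn hs0 hs1 hβ0 hβ1
  obtain ⟨ρ, hρ⟩ : ∃ ρ : ℝ, ρ = n + 2 * s * β := ⟨_, rfl⟩
  rw [← hρ] at h ⊢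
  obtain ⟨D, hD⟩ : ∃ D : ℝ, D = 2 * Real.sqrt n + 1 := ⟨_, rfl⟩
  have hD0 : 0 < D := by rw [hD]; positivity
  have hsum := summable_cell_weights (α := α) (a := 1 + β / 2) hα (by linarith)
  obtain ⟨w, hw⟩ : ∃ w : ℕ × ℤ → ℝ,
    w = fun q => ((2 : ℝ) ^ q.1) ^ (-α) * (1 + |(q.2 : ℝ)|) ^ (-(1 + β / 2)) := ⟨_, rfl⟩
  rw [← hw] at hsum
  have hw0 : ∀ q, 0 ≤ w q := fun q => by rw [hw]; positivity
  refine ⟨M * ENNReal.ofReal (D ^ ρ) * ∑' q, ENNReal.ofReal (w q), ?_, fun ν A hν => ?_⟩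
  · rw [← ENNReal.ofReal_tsum_of_nonneg hw0 hsum]
    finiteness
  have hA := hν.1
  have hcell : ∀ q : ℕ × ℤ, ∫⁻ b in axisCell s q.1 q.2, kernelOsc s β b ∂ν ≤
      M * ENNReal.ofReal (D ^ ρ) * ENNReal.ofReal A * ENNReal.ofReal (w q) := by
    rintro ⟨j, k⟩
    have h2j : (0 : ℝ) < 2 ^ j := by positivity
    calc _ ≤ ∫⁻ _ in axisCell s j k, M * ENNReal.ofReal
          (((2 : ℝ) ^ j) ^ (-(ρ + α)) * (1 + |(k : ℝ)|) ^ (-(1 + β / 2))) ∂ν :=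
          setLIntegral_mono measurable_const fun b hb => h j k b hb
      _ = M * ENNReal.ofReal (((2 : ℝ) ^ j) ^ (-(ρ + α)) * (1 + |(k : ℝ)|) ^ (-(1 + β / 2))) *
          ν (axisCell s j k) := setLIntegral_const _ _
      _ ≤ M * ENNReal.ofReal (((2 : ℝ) ^ j) ^ (-(ρ + α)) * (1 + |(k : ℝ)|) ^ (-(1 + β / 2))) *
          ENNReal.ofReal (A * (2 ^ j * D) ^ ρ) := by
          gcongr
          rw [hD]
          exact (measure_mono (axisCell_subset_parabolicBall hs0 j k)).trans
            (hν.2 _ _ (by positivity))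
      _ = _ := by
          rw [mul_assoc, mul_assoc, mul_assoc, ← ENNReal.ofReal_mul (by positivity),
            ← ENNReal.ofReal_mul hA.le, ← ENNReal.ofReal_mul (by positivity), hw]
          congr 2
          rw [Real.mul_rpow h2j.le hD0.le, neg_add, Real.rpow_add h2j, Real.rpow_neg h2j.le ρ]
          have : ((2 : ℝ) ^ j) ^ ρ ≠ 0 := by positivity
          field_simp
  have huniv : (⋃ q : ℕ × ℤ, axisCell (n := n) s q.1 q.2) = Set.univ :=
    Set.eq_univ_of_forall fun b => by
      obtain ⟨j, k, hb⟩ := exists_mem_axisCell hn s b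
      exact Set.mem_iUnion.2 ⟨(j, k), hb⟩
  calc ∫⁻ b, kernelOsc s β b ∂ν
      = ∫⁻ b in ⋃ q : ℕ × ℤ, axisCell (n := n) s q.1 q.2, kernelOsc s β b ∂ν := by
        rw [huniv, Measure.restrict_univ]
    _ ≤ ∑' q : ℕ × ℤ, ∫⁻ b in axisCell s q.1 q.2, kernelOsc s β b ∂ν := lintegral_iUnion_le _ _
    _ ≤ ∑' q : ℕ × ℤ, M * ENNReal.ofReal (D ^ ρ) * ENNReal.ofReal A * ENNReal.ofReal (w q) :=
        ENNReal.tsum_le_tsum hcell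
    _ = _ := by rw [ENNReal.tsum_mul_left]; ring

/-! ### Parabolic scaling -/

/-- The parabolic dilation by `l` followed by the translation by `p₀`. -/
noncomputable def parabolicEquiv {n : ℕ} (s : ℝ) (p₀ : SpaceTime n) {l : ℝ} (hl : 0 < l) :
    SpaceTime n ≃ᵐ SpaceTime n :=
  Homeomorph.toMeasurableEquiv
    { toFun := fun p => (p₀.1 + l • p.1, p₀.2 + l ^ (2 * s) * p.2)
      invFun := fun p => (l⁻¹ • (p.1 - p₀.1), (l ^ (2 * s))⁻¹ * (p.2 - p₀.2))
      left_inv := fun p => by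
        have h : l ^ (2 * s) ≠ 0 := by positivity
        simp [smul_smul, inv_mul_cancel₀ hl.ne', inv_mul_cancel_left₀ h]
      right_inv := fun p => by
        have h : l ^ (2 * s) ≠ 0 := by positivity
        simp [smul_smul, mul_inv_cancel₀ hl.ne', mul_inv_cancel_left₀ h]
      continuous_toFun := by fun_prop
      continuous_invFun := by fun_prop }

lemma parabolicEquiv_apply {n : ℕ} (s : ℝ) (p₀ : SpaceTime n) {l : ℝ} (hl : 0 < l)
    (p : SpaceTime n) :
    parabolicEquiv s p₀ hl p = (p₀.1 + l • p.1, p₀.2 + l ^ (2 * s) * p.2) := rfl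

/-- The value of the Jacobian constant never matters: it enters the oscillation integral and the
squared volume of the cube alike. -/
lemma map_parabolicEquiv_volume {n : ℕ} (s : ℝ) (p₀ : SpaceTime n) {l : ℝ} (hl : 0 < l) :
    ∃ c : ℝ≥0∞, c ≠ 0 ∧ c ≠ ⊤ ∧
      (volume : Measure (SpaceTime n)).map (parabolicEquiv s p₀ hl) = c • volume := by
  have hls : 0 < l ^ (2 * s) := by positivity
  obtain ⟨L, hL⟩ : ∃ L : SpaceTime n ≃ₗ[ℝ] SpaceTime n, ∀ p, L p = (l • p.1, l ^ (2 * s) * p.2) :=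
    ⟨(LinearEquiv.smulOfNeZero ℝ _ l hl.ne').prodCongr
      (LinearEquiv.smulOfNeZero ℝ ℝ _ hls.ne'), fun p => rfl⟩
  have hdet : LinearMap.det (L : SpaceTime n →ₗ[ℝ] SpaceTime n) ≠ 0 :=
    (LinearEquiv.isUnit_det' L).ne_zero
  refine ⟨ENNReal.ofReal |(LinearMap.det (L : SpaceTime n →ₗ[ℝ] SpaceTime n))⁻¹|, ?_, by simp, ?_⟩
  · rw [Ne, ENNReal.ofReal_eq_zero, not_le]
    exact abs_pos.2 (inv_ne_zero hdet)
  · have e : (parabolicEquiv s p₀ hl : SpaceTime n → SpaceTime n) =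
        (fun p => p₀ + p) ∘ (L : SpaceTime n →ₗ[ℝ] SpaceTime n) := by
      funext p
      simp only [parabolicEquiv_apply, Function.comp, LinearEquiv.coe_coe, hL]
      rfl
    have : (volume : Measure (SpaceTime n)).IsAddHaarMeasure :=
      Measure.prod.instIsAddHaarMeasure volume volume
    have hLm : Measurable (L : SpaceTime n →ₗ[ℝ] SpaceTime n) :=
      (LinearMap.continuous_of_finiteDimensional _).measurable
    rw [e, ← Measure.map_map (measurable_const_add p₀) hLm,
      Measure.map_linearMap_addHaar_eq_smul_addHaar volume hdet, Measure.map_smul,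
      map_add_left_eq_self]

lemma parabolicEquiv_preimage_parabolicCube {n : ℕ} (s : ℝ) (p₀ : SpaceTime n) {l : ℝ}
    (hl : 0 < l) : parabolicEquiv s p₀ hl ⁻¹' parabolicCube s p₀ l = parabolicCube s 0 1 := by
  have hls : 0 < l ^ (2 * s) := by positivity
  ext p
  simp only [Set.mem_preimage, parabolicEquiv_apply, parabolicCube, Set.mem_ofPred_eq]
  refine and_congr (forall_congr' fun i => ?_) ?_
  · simp only [PiLp.add_apply, PiLp.smul_apply, smul_eq_mul, add_sub_cancel_left, abs_mul,
      abs_of_pos hl, Prod.fst_zero, PiLp.zero_apply, sub_zero]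
    rw [div_eq_mul_one_div l, mul_le_mul_iff_right₀ hl]
  · simp only [add_sub_cancel_left, abs_mul, abs_of_pos hls, Prod.snd_zero, sub_zero,
      Real.one_rpow]
    rw [div_eq_mul_one_div (l ^ (2 * s)), mul_le_mul_iff_right₀ hls]

lemma setLIntegral_parabolicCube {n : ℕ} {s : ℝ} {p₀ : SpaceTime n} {l : ℝ} (hl : 0 < l)
    {c : ℝ≥0∞} (hc : (volume : Measure (SpaceTime n)).map (parabolicEquiv s p₀ hl) = c • volume)
    (F : SpaceTime n → ℝ≥0∞) :
    c * ∫⁻ p in parabolicCube s p₀ l, F p =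
      ∫⁻ p in parabolicCube s 0 1, F (parabolicEquiv s p₀ hl p) := by
  rw [← smul_eq_mul, ← lintegral_smul_measure, ← Measure.restrict_smul, ← hc,
    MeasurableEquiv.restrict_map, lintegral_map_equiv, parabolicEquiv_preimage_parabolicCube]

/-- Parabolic balls are mapped to parabolic balls with radii multiplied by `l`; the factor l^ρ is
later cancelled by the homogeneity of the kernel. -/
lemma HasParabolicGrowth.map_parabolicEquiv_symm {n : ℕ} {s ρ A : ℝ}
    {μ : Measure (SpaceTime n)} (h : HasParabolicGrowth s ρ A μ) (p₀ : SpaceTime n) {l : ℝ}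
    (hl : 0 < l) :
    HasParabolicGrowth s ρ (A * l ^ ρ) (μ.map (parabolicEquiv s p₀ hl).symm) := by
  have hls : 0 < l ^ (2 * s) := by positivity
  refine ⟨mul_pos h.1 (by positivity), fun p r hr => ?_⟩
  rw [MeasurableEquiv.map_apply, mul_assoc, ← Real.mul_rpow hl.le hr.le]
  refine (measure_mono fun q hq => ?_).trans (h.2 (parabolicEquiv s p₀ hl p) (l * r) (by positivity))
  obtain ⟨q, rfl⟩ := (parabolicEquiv s p₀ hl).surjective q
  rw [Set.mem_preimage, MeasurableEquiv.symm_apply_apply] at hq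
  obtain ⟨h1, h2⟩ := hq
  simp only [parabolicEquiv_apply]
  refine ⟨?_, ?_⟩
  · rw [dist_add_left, dist_smul₀, Real.norm_of_nonneg hl.le]
    gcongr
  · rw [add_sub_add_left_eq_sub, ← mul_sub, abs_mul, abs_of_pos hls, mul_left_comm 2 l r,
      Real.mul_rpow hl.le (by positivity), mul_div_assoc]
    gcongr

lemma lintegral_oscillation_parabolicCube_le {n : ℕ} (hn : 1 ≤ n) {s β : ℝ} (hs0 : 0 < s)
    (hs1 : s ≤ 1) (hβ0 : 0 < β) (hβ1 : β < 1) :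
    ∃ M : ℝ≥0∞, M ≠ ⊤ ∧ ∀ (μ : Measure (SpaceTime n)) (A : ℝ),
      HasParabolicGrowth s (n + 2 * s * β) A μ → ∀ (p₀ : SpaceTime n) (l : ℝ), 0 < l →
        volume (parabolicCube s p₀ l) ≠ 0 ∧ volume (parabolicCube s p₀ l) ≠ ⊤ ∧
        ∫⁻ q, (∫⁻ p in parabolicCube s p₀ l, ∫⁻ p' in parabolicCube s p₀ l,
          ‖timeDeriv β (fundSol s) (p - q) - timeDeriv β (fundSol s) (p' - q)‖ₑ) ∂μ ≤
            M * ENNReal.ofReal A * volume (parabolicCube s p₀ l) ^ 2 := by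
  obtain ⟨M, hM, h⟩ := lintegral_kernelOsc_le hn hs0 hs1 hβ0 hβ1
  have hvt := volume_parabolicCube_zero_one_ne_top (n := n) s
  have hv0 := volume_parabolicCube_zero_one_ne_zero (n := n) s
  obtain ⟨v, hv⟩ : ∃ v, v = volume (parabolicCube (n := n) s 0 1) := ⟨_, rfl⟩
  rw [← hv] at hvt hv0
  refine ⟨M * (v ^ 2)⁻¹, ENNReal.mul_ne_top hM (by simp [hv0]), fun μ A hμ p₀ l hl => ?_⟩
  obtain ⟨c, hc0, hct, hc⟩ := map_parabolicEquiv_volume s p₀ hl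
  have hvol : c * volume (parabolicCube s p₀ l) = v := by
    have := setLIntegral_parabolicCube hl hc (fun _ => 1)
    rwa [setLIntegral_const, setLIntegral_const, one_mul, one_mul, ← hv] at this
  have hQ0 : volume (parabolicCube s p₀ l) ≠ 0 := fun h0 => hv0 (by rw [← hvol, h0, mul_zero])
  have hQt : volume (parabolicCube s p₀ l) ≠ ⊤ := fun h0 =>
    hvt (by rw [← hvol, h0, ENNReal.mul_top hc0])
  refine ⟨hQ0, hQt, ?_⟩
  -- Two changes of variables, in p and in p', produce c²; homogeneity extracts the power of `l` and
  -- leaves the unit cube.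
  have hosc : ∀ q, c ^ 2 * ∫⁻ p in parabolicCube s p₀ l, ∫⁻ p' in parabolicCube s p₀ l,
      ‖timeDeriv β (fundSol s) (p - q) - timeDeriv β (fundSol s) (p' - q)‖ₑ =
      ENNReal.ofReal (l ^ (-(n + 2 * s * β))) *
        kernelOsc s β ((parabolicEquiv s p₀ hl).symm q) := by
    intro q
    obtain ⟨q, rfl⟩ := (parabolicEquiv s p₀ hl).surjective q
    have hK : ∀ p, timeDeriv β (fundSol s) (parabolicEquiv s p₀ hl p - parabolicEquiv s p₀ hl q) =
        l ^ (-(n + 2 * s * β)) * timeDeriv β (fundSol s) (p - q) := by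
      intro p
      have e : parabolicEquiv s p₀ hl p - parabolicEquiv s p₀ hl q =
          (l • (p.1 - q.1), l ^ (2 * s) * (p.2 - q.2)) := by
        simp only [parabolicEquiv_apply, Prod.mk_sub_mk, add_sub_add_left_eq_sub, smul_sub,
          mul_sub]
      rw [e, timeDeriv_fundSol_smul s β hl]
      rfl
    rw [pow_two, mul_assoc, ← lintegral_const_mul' _ _ hct]
    simp only [setLIntegral_parabolicCube hl hc, MeasurableEquiv.symm_apply_apply, hK, ← mul_sub,
      enorm_mul]
    rw [Real.enorm_of_nonneg (by positivity)]
    simp only [lintegral_const_mul' _ _ ENNReal.ofReal_ne_top]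
    rfl
  have hA := hμ.1
  have hmain : c ^ 2 * ∫⁻ q, (∫⁻ p in parabolicCube s p₀ l, ∫⁻ p' in parabolicCube s p₀ l,
      ‖timeDeriv β (fundSol s) (p - q) - timeDeriv β (fundSol s) (p' - q)‖ₑ) ∂μ ≤
      M * ENNReal.ofReal A := by
    rw [← lintegral_const_mul' _ _ (by finiteness)]
    simp only [hosc]
    rw [lintegral_const_mul' _ _ ENNReal.ofReal_ne_top,
      ← lintegral_map_equiv (fun b => kernelOsc s β b)]
    calc _ ≤ ENNReal.ofReal (l ^ (-(n + 2 * s * β))) *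
          (M * ENNReal.ofReal (A * l ^ (n + 2 * s * β))) := by
          gcongr
          exact h _ _ (hμ.map_parabolicEquiv_symm p₀ hl)
      _ = _ := by
          rw [mul_left_comm, ← ENNReal.ofReal_mul (by positivity), mul_left_comm (l ^ _) A,
            ← Real.rpow_add hl, neg_add_cancel, Real.rpow_zero, mul_one]
  have hc2 : c ^ 2 ≠ 0 := pow_ne_zero 2 hc0
  have hc2t : c ^ 2 ≠ ⊤ := by finiteness
  refine (ENNReal.mul_le_mul_iff_right hc2 hc2t).1 (hmain.trans (le_of_eq ?_))
  have e : c ^ 2 * (M * (v ^ 2)⁻¹ * ENNReal.ofReal A * volume (parabolicCube s p₀ l) ^ 2) =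
      M * ENNReal.ofReal A * ((v ^ 2)⁻¹ * (c * volume (parabolicCube s p₀ l)) ^ 2) := by ring
  rw [e, hvol, ENNReal.inv_mul_cancel (by positivity) (by finiteness), mul_one]

/-! ### From the kernel to the potential and its BMO norm -/

lemma lintegral_enorm_sub_average_le {α : Type*} [MeasurableSpace α] {μ : Measure α} {Q : Set α}
    (h0 : μ Q ≠ 0) (ht : μ Q ≠ ⊤) {f : α → ℝ} (hf : IntegrableOn f Q μ) :
    ∫⁻ p in Q, ‖f p - ⨍ p' in Q, f p' ∂μ‖ₑ ∂μ ≤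
      (μ Q)⁻¹ * ∫⁻ p in Q, ∫⁻ p' in Q, ‖f p - f p'‖ₑ ∂μ ∂μ := by
  rw [← lintegral_const_mul' _ _ (by simp [h0])]
  refine lintegral_mono fun p => ?_
  have hr : μ.real Q ≠ 0 := by rw [Measure.real, ENNReal.toReal_ne_zero]; exact ⟨h0, ht⟩
  -- The deviation from the mean is the mean of the differences f p - f p'.
  have e : f p - ⨍ p' in Q, f p' ∂μ = (μ.real Q)⁻¹ * ∫ p' in Q, (f p - f p') ∂μ := by
    rw [integral_sub (f := fun _ => f p) (integrableOn_const ht) hf, setIntegral_const, setAverage_eq, smul_eq_mul,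
      smul_eq_mul, mul_sub, inv_mul_cancel_left₀ hr]
  have e2 : ‖(μ.real Q)⁻¹‖ₑ = (μ Q)⁻¹ := by
    rw [enorm_inv hr, Real.enorm_of_nonneg measureReal_nonneg, Measure.real,
      ENNReal.ofReal_toReal ht]
  rw [e, enorm_mul, e2]
  gcongr
  exact enorm_integral_le_lintegral_enorm _

lemma measurable_timeDeriv_fundSol_sub {n : ℕ} (s β : ℝ) :
    Measurable fun z : SpaceTime n × SpaceTime n => timeDeriv β (fundSol s) (z.1 - z.2) :=
  (measurable_timeDeriv_fundSol s β).comp (measurable_fst.sub measurable_snd)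

/-- The fractional derivative exists off the time axis, and for each q the vertical line through q
is Lebesgue null; Fubini exchanges the two almost-everywhere quantifiers. -/
lemma ae_timeDerivExists {n : ℕ} (hn : 1 ≤ n) {s β : ℝ} (hs0 : 0 < s)
    (hs1 : s ≤ 1) (hβ0 : 0 < β) (hβ1 : β < 1) (μ : Measure (SpaceTime n)) [SFinite μ] :
    ∀ᵐ p : SpaceTime n, ∀ᵐ q ∂μ, TimeDerivExists β (fundSol s) (p - q) := by
  have h : ∀ᵐ p : SpaceTime n, ∀ᵐ q ∂μ, p.1 ≠ q.1 := by
    refine (Measure.ae_ae_comm ?_).2 (Filter.Eventually.of_forall fun q =>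
      (ae_fst_ne_and_snd_ne hn q).mono fun p hp => hp.1)
    exact (measurableSet_eq_fun measurable_fst.fst measurable_snd.fst).compl
  refine h.mono fun p hp => hp.mono fun q hq => ?_
  exact integrable_fracQuot_fundSol hn hs0 hs1 hβ0 hβ1 (sub_ne_zero.2 hq) _

/-- By Tonelli, the local integral of the kernel is bounded uniformly over its translates, and μ has
finite total mass; the growth condition plays no role here. -/
lemma lintegral_closedBall_lintegral_lt_top {n : ℕ} (hn : 1 ≤ n) {s β : ℝ} (hs0 : 0 < s)
    (hs1 : s ≤ 1) (hβ0 : 0 < β) (hβ1 : β < 1) (μ : Measure (SpaceTime n)) [IsFiniteMeasure μ]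
    (r : ℝ) :
    ∫⁻ p in Metric.closedBall (0 : SpaceTime n) r,
      ∫⁻ q, ‖timeDeriv β (fundSol s) (p - q)‖ₑ ∂μ < ⊤ := by
  obtain ⟨M, hM, h⟩ := lintegral_timeDeriv_fundSol_le hn hs0 hs1 hβ0 hβ1
  rw [lintegral_lintegral_swap (measurable_timeDeriv_fundSol_sub s β).enorm.aemeasurable]
  have hball : Metric.closedBall (0 : SpaceTime n) r =
      Metric.closedBall (0 : EuclideanSpace ℝ (Fin n)) r ×ˢ Metric.closedBall (0 : ℝ) r :=
    (closedBall_prod_same _ _ _).symm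
  rw [hball]
  refine (lintegral_mono fun q => h _ _ q).trans_lt ?_
  rw [lintegral_const]
  have h1 : volume (Metric.closedBall (0 : EuclideanSpace ℝ (Fin n)) r) ≠ ⊤ :=
    measure_closedBall_lt_top.ne
  have h2 : volume (Metric.closedBall (0 : ℝ) r) ≠ ⊤ := measure_closedBall_lt_top.ne
  finiteness

lemma ae_integrable_timeDeriv_fundSol_sub {n : ℕ} (hn : 1 ≤ n) {s β : ℝ} (hs0 : 0 < s)
    (hs1 : s ≤ 1) (hβ0 : 0 < β) (hβ1 : β < 1) (μ : Measure (SpaceTime n)) [IsFiniteMeasure μ] :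
    ∀ᵐ p : SpaceTime n, Integrable (fun q => timeDeriv β (fundSol s) (p - q)) μ := by
  have hm := measurable_timeDeriv_fundSol_sub (n := n) s β
  have h : ∀ N : ℕ, ∀ᵐ p : SpaceTime n, p ∈ Metric.closedBall (0 : SpaceTime n) N →
      ∫⁻ q, ‖timeDeriv β (fundSol s) (p - q)‖ₑ ∂μ < ⊤ := fun N => by
    rw [← ae_restrict_iff' Metric.isClosed_closedBall.measurableSet]
    exact ae_lt_top hm.enorm.lintegral_prod_right'
      (lintegral_closedBall_lintegral_lt_top hn hs0 hs1 hβ0 hβ1 μ N).ne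
  refine (ae_all_iff.2 h).mono fun p hp => ?_
  obtain ⟨N, hN⟩ := exists_nat_ge ‖p‖
  exact ⟨(hm.comp measurable_prodMk_left).aestronglyMeasurable,
    hp N (mem_closedBall_zero_iff.2 hN)⟩

lemma locallyIntegrable_potential {n : ℕ} (hn : 1 ≤ n) {s β : ℝ} (hs0 : 0 < s)
    (hs1 : s ≤ 1) (hβ0 : 0 < β) (hβ1 : β < 1) (μ : Measure (SpaceTime n)) [IsFiniteMeasure μ] :
    LocallyIntegrable (potential (timeDeriv β (fundSol s)) μ) := by
  have hm := measurable_timeDeriv_fundSol_sub (n := n) s β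
  intro x
  refine ⟨Metric.closedBall 0 (‖x‖ + 1), ?_, ?_⟩
  · exact Filter.mem_of_superset (Metric.isOpen_ball.mem_nhds
      (mem_ball_zero_iff.2 (lt_add_one ‖x‖))) Metric.ball_subset_closedBall
  · refine ⟨?_, ?_⟩
    · exact (hm.stronglyMeasurable.integral_prod_right').aestronglyMeasurable
    · exact (lintegral_mono fun p => enorm_integral_le_lintegral_enorm _).trans_lt
        (lintegral_closedBall_lintegral_lt_top hn hs0 hs1 hβ0 hβ1 μ _)

/-- For almost all p and p' both potentials converge absolutely, so their difference is a single
integral of the difference of kernels; Tonelli then moves the μ-integral outside. -/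
lemma oscillation_potential_le {n : ℕ} (hn : 1 ≤ n) {s β : ℝ} (hs0 : 0 < s)
    (hs1 : s ≤ 1) (hβ0 : 0 < β) (hβ1 : β < 1) (μ : Measure (SpaceTime n)) [IsFiniteMeasure μ]
    (Q : Set (SpaceTime n)) :
    ∫⁻ p in Q, ∫⁻ p' in Q, ‖potential (timeDeriv β (fundSol s)) μ p -
        potential (timeDeriv β (fundSol s)) μ p'‖ₑ ≤
      ∫⁻ q, (∫⁻ p in Q, ∫⁻ p' in Q,
        ‖timeDeriv β (fundSol s) (p - q) - timeDeriv β (fundSol s) (p' - q)‖ₑ) ∂μ := by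
  have hm := measurable_timeDeriv_fundSol (n := n) s β
  have hint := ae_integrable_timeDeriv_fundSol_sub hn hs0 hs1 hβ0 hβ1 μ
  calc _ ≤ ∫⁻ p in Q, ∫⁻ p' in Q, ∫⁻ q,
        ‖timeDeriv β (fundSol s) (p - q) - timeDeriv β (fundSol s) (p' - q)‖ₑ ∂μ := by
        refine lintegral_mono_ae ((ae_restrict_of_ae hint).mono fun p hp => ?_)
        refine lintegral_mono_ae ((ae_restrict_of_ae hint).mono fun p' hp' => ?_)
        rw [potential, potential, ← integral_sub hp hp']
        exact enorm_integral_le_lintegral_enorm _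
    _ = ∫⁻ p in Q, ∫⁻ q, (∫⁻ p' in Q,
        ‖timeDeriv β (fundSol s) (p - q) - timeDeriv β (fundSol s) (p' - q)‖ₑ) ∂μ := by
        refine lintegral_congr fun p => lintegral_lintegral_swap (Measurable.aemeasurable ?_)
        exact ((hm.comp (measurable_snd.const_sub p)).sub
          (hm.comp (measurable_fst.sub measurable_snd))).enorm
    _ = _ := by
        refine lintegral_lintegral_swap (Measurable.aemeasurable ?_)
        refine Measurable.lintegral_prod_right' (f := fun z : (SpaceTime n × SpaceTime n) ×
          SpaceTime n => ‖timeDeriv β (fundSol s) (z.1.1 - z.1.2) -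
            timeDeriv β (fundSol s) (z.2 - z.1.2)‖ₑ) ?_
        exact ((hm.comp (measurable_fst.fst.sub measurable_fst.snd)).sub
          (hm.comp (measurable_snd.sub measurable_fst.snd))).enorm

lemma isCompact_parabolicCube {n : ℕ} (s : ℝ) (p₀ : SpaceTime n) {l : ℝ} (hl : 0 < l) :
    IsCompact (parabolicCube s p₀ l) := by
  have h1 : IsCompact (parabolicCube (n := n) s 0 1) := by
    refine ((isCompact_closedBall (0 : EuclideanSpace ℝ (Fin n)) (Real.sqrt n / 2)).prod
      (isCompact_Icc (a := -(1 / 2 : ℝ)) (b := 1 / 2))).of_isClosed_subset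
      (isClosed_parabolicCube s 0 1) ?_
    rw [parabolicCube_zero_one]
    exact Set.prod_mono_left fun x hx => mem_closedBall_zero_iff.2 (norm_le_of_mem_unitCube hx)
  have hcont : Continuous (parabolicEquiv s p₀ hl) := by
    change Continuous fun p : SpaceTime n => (p₀.1 + l • p.1, p₀.2 + l ^ (2 * s) * p.2)
    fun_prop
  have h2 := h1.image hcont
  rwa [← parabolicEquiv_preimage_parabolicCube s p₀ hl,
    Set.image_preimage_eq _ (parabolicEquiv s p₀ hl).surjective] at h2

lemma parabolicBMONorm_potential_le {n : ℕ} (hn : 1 ≤ n) {s β : ℝ} (hs0 : 0 < s)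
    (hs1 : s ≤ 1) (hβ0 : 0 < β) (hβ1 : β < 1) :
    ∃ M : ℝ≥0∞, M ≠ ⊤ ∧ ∀ (μ : Measure (SpaceTime n)) [IsFiniteMeasure μ] (A : ℝ),
      HasParabolicGrowth s (n + 2 * s * β) A μ →
        parabolicBMONorm s (potential (timeDeriv β (fundSol s)) μ) ≤ M * ENNReal.ofReal A := by
  obtain ⟨M, hM, h⟩ := lintegral_oscillation_parabolicCube_le hn hs0 hs1 hβ0 hβ1
  refine ⟨M, hM, fun μ _ A hμ => iSup_le fun p₀ => iSup_le fun l => iSup_le fun hl => ?_⟩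
  obtain ⟨h0, ht, hosc⟩ := h μ A hμ p₀ l hl
  have hf := (locallyIntegrable_potential hn hs0 hs1 hβ0 hβ1 μ).integrableOn_isCompact
    (isCompact_parabolicCube s p₀ hl)
  have hQ := (lintegral_enorm_sub_average_le h0 ht hf).trans (mul_le_mul_right
    ((oscillation_potential_le hn hs0 hs1 hβ0 hβ1 μ (parabolicCube s p₀ l)).trans hosc) _)
  refine (mul_le_mul_right hQ _).trans (le_of_eq ?_)
  have e : ∀ V : ℝ≥0∞, V⁻¹ * (V⁻¹ * (M * ENNReal.ofReal A * V ^ 2)) =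
      M * ENNReal.ofReal A * ((V⁻¹ * V) * (V⁻¹ * V)) := fun V => by ring
  rw [e, ENNReal.inv_mul_cancel h0 ht, mul_one, mul_one]

end FracHeat

theorem mainTheorem9 (n : ℕ) (hn : 1 ≤ n) (s β : ℝ) (hs0 : 0 < s) (hs1 : s ≤ 1)
    (hβ0 : 0 < β) (hβ1 : β < 1) :
    ∃ C : ℝ, 0 < C ∧
      ∀ (μ : Measure (FracHeat.SpaceTime n)) [IsFiniteMeasure μ] (A : ℝ),
        FracHeat.HasParabolicGrowth s (n + 2 * s * β) A μ →
          (∀ᵐ p : FracHeat.SpaceTime n,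
            (∀ᵐ q ∂μ, FracHeat.TimeDerivExists β (FracHeat.fundSol s) (p - q)) ∧
              Integrable (fun q => FracHeat.timeDeriv β (FracHeat.fundSol s) (p - q)) μ) ∧
          LocallyIntegrable
            (FracHeat.potential (FracHeat.timeDeriv β (FracHeat.fundSol s)) μ) ∧
          FracHeat.parabolicBMONorm s
            (FracHeat.potential (FracHeat.timeDeriv β (FracHeat.fundSol s)) μ) ≤
              ENNReal.ofReal (C * A) := by
  obtain ⟨M, hM, h⟩ := FracHeat.parabolicBMONorm_potential_le hn hs0 hs1 hβ0 hβ1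
  refine ⟨M.toReal + 1, by positivity, fun μ _ A hμ => ⟨?_, ?_, ?_⟩⟩
  · exact (FracHeat.ae_timeDerivExists hn hs0 hs1 hβ0 hβ1 μ).and
      (FracHeat.ae_integrable_timeDeriv_fundSol_sub hn hs0 hs1 hβ0 hβ1 μ)
  · exact FracHeat.locallyIntegrable_potential hn hs0 hs1 hβ0 hβ1 μ
  · refine (h μ A hμ).trans ?_
    rw [ENNReal.ofReal_mul (by positivity)]
    gcongr
    rw [← ENNReal.ofReal_toReal hM]
    exact ENNReal.ofReal_le_ofReal (by simp)
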